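/- **Conventions.** A *ribbon* is a connected (possibly empty) skew shape $R=\lambda/\mu$ containing no $2\times 2$ block of cells. Let $m=|R|$ be its size, and let $[a,b]=\{j:\lambda_j>\mu_j\}$ be the set of indices of its nonempty rows (so $[a,b-1]=\emptyset$ if $R$ is empty). Label the cells of $R$ by $1,\dots,m$ sequentially, starting from the top-right cell; $\mathrm{Des}(R)$ is the set of $t\in[m-1]$ such that the cell labelled $t$ lies immediately above the cell labelled $t+1$, and $\mathrm{NDes}(R)=[m-1]\setminus\mathrm{Des}(R)$. For $J\subseteq\mathbb N$ put $d(J,R)=\{\sum_{j=1}^{i}(\lambda_j-\mu_j): i\in J\}$. For $\ell(\lambda)\le n$ the $n\times n$ (dual) Jacobi–Trudi matrix of $R$ is $\mathrm{JT}_R(\mathbf x)=\bigl(e_{\lambda_i-\mu_j-i+j}(\mathbf x)\bigr)_{i,j=1}^n$, where $e_d$ is the elementary symmetric function ($e_0=1$, and $e_d=0$ for $d<0$), and $*$ is the entrywise (Hadamard) product. $s_\nu$ is the Schur function, and $f^{\nu}(A)$ is the number of standard Young tableaux of shape $\nu$ with descent set $A$, where $i$ is a descent of a tableau if $i+1$ lies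 in a strictly lower row than $i$. Let $\mathrm{TL}_n(2)$ be the $\mathbb C$-algebra generated by $t_1,\dots,t_{n-1}$ with the relations $t_i^2=2t_i$, $t_it_jt_i=t_i$ if $|i-j|=1$, and $t_it_j=t_jt_i$ if $|i-j|\ge2$; it has as a basis the Kauffman diagrams (noncrossing perfect matchings of $n$ left and $n$ right points), multiplied by concatenation with every closed loop replaced by a factor $2$. Let $\theta:\mathbb C[\mathfrak S_n]\to \mathrm{TL}_n(2)$ be the algebra homomorphism with $\theta(\mathsf s_i)=t_i-1$, where $\mathsf s_i=(i,i+1)$ and permutations are composed from left to right. For a Kauffman diagram $\tau$ let $f_\tau(w)$ be the coefficient of $\tau$ in $\theta(w)$, and let $\mathrm{imm}_\tau(M)=\sum_{w\in\mathfrak S_n}f_\tau(w)\,M_{1,w(1)}\cdots M_{n,w(n)}$. For $I\subseteq[n-1]$ let $\tau(I)=\prod_{i\in I}t_i$ (product in increasing order), which is a Kauffman diagram. **Theorem.** Let $k\ge1$ and $I\subseteq[n-1]$. (1) Let $R^{(i)}=\lambda^{(i)}/\mu^{(i)}$, $1\le i\le k$, be ribbons with $\ell(\lambda^{(i)})\le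 n$, let $m_i$ be the size of $R^{(i)}$, and let $[a_i,b_i]=\{j:\lambda^{(i)}_j>\mu^{(i)}_j\}$. Then $$\mathrm{imm}_{\tau(I)}\bigl(\mathrm{JT}_{R^{(1)}}(\mathbf x^{(1)})*\cdots*\mathrm{JT}_{R^{(k)}}(\mathbf x^{(k)})\bigr)=\sum_{\nu_1\vdash m_1,\dots,\nu_k\vdash m_k}\Bigl(\sum_{\substack{I_i\subseteq[a_i,b_i-1]\\ I_1\cap\cdots\cap I_k=I}}\ \prod_{i=1}^k f^{\nu_i}\bigl(\mathrm{NDes}(R^{(i)})\cup d(I_i,R^{(i)})\bigr)\Bigr)\,s_{\nu_1}(\mathbf x^{(1)})\cdots s_{\nu_k}(\mathbf x^{(k)}).$$ (2) Let $R=\lambda/\mu$ be a ribbon of size $m$ with $\ell(\lambda)\le n$. Then $$\mathrm{imm}_{\tau(I)}\bigl(\mathrm{JT}_{R}(\mathbf x^{(1)})*\cdots*\mathrm{JT}_{R}(\mathbf x^{(k)})\bigr)=\sum_{\nu_1,\dots,\nu_k\vdash m}\Bigl(\sum_{\substack{A_1,\dots,A_k\subseteq[m-1]\\ A_1\cap\cdots\cap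 A_k=\mathrm{NDes}(R)\cup d(I,R)}} f^{\nu_1}(A_1)\cdots f^{\nu_k}(A_k)\Bigr)\,s_{\nu_1}(\mathbf x^{(1)})\cdots s_{\nu_k}(\mathbf x^{(k)}).$$ In both expansions the coefficients are manifestly nonnegative integers. -/

import Mathlib

namespace RibbonImmanant

/-! ### Kauffman diagrams

A Kauffman diagram has `n` points on the left (`Sum.inl i`) and `n` points on the right
(`Sum.inr i`), `0 ≤ i < n`, joined in pairs by `n` nonintersecting arcs drawn inside the convex
hull of the points. Index `i` here is index `i + 1` in one-based numbering, for points as well as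
for generators: `i : Fin (n - 1)` stands for the generator with one-based index `i + 1`. -/

/-- The position of a point on the boundary of the convex hull: up the left side, then down the
right side. -/
def boundaryPos (n : ℕ) : Fin n ⊕ Fin n → ℕ
  | .inl i => i
  | .inr i => 2 * n - 1 - i

/-- Kauffman diagrams: noncrossing perfect matchings of the `2n` points. Two arcs drawn in the convex
hull cross exactly when their end points alternate along the boundary. -/
@[ext]
structure KauffmanDiagram (n : ℕ) where
  partner : Fin n ⊕ Fin n → Fin n ⊕ Fin n
  partner_partner : ∀ p, partner (partner p) = p
  partner_ne : ∀ p, partner p ≠ p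
  noncrossing : ∀ p q, ¬ (boundaryPos n p < boundaryPos n q ∧
    boundaryPos n q < boundaryPos n (partner p) ∧
    boundaryPos n (partner p) < boundaryPos n (partner q))

/-- The lower of the two points that the `i`-th generator acts on. -/
def lo {n : ℕ} (i : Fin (n - 1)) : Fin n := ⟨i, by omega⟩
/-- The upper of the two points that the `i`-th generator acts on. -/
def hi {n : ℕ} (i : Fin (n - 1)) : Fin n := ⟨i + 1, by omega⟩

/-- Join `a` with `b`, and join the former partners of `a` and `b` with each other. -/
def rewire {P : Type*} [DecidableEq P] (a b : P) (m : P → P) (p : P) : P :=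
  if p = a then b else if p = b then a
  else if p = m a then m b else if p = m b then m a else m p

section rewire
variable {P : Type*} [DecidableEq P] {m : P → P}

theorem rewire_rewire (hm : ∀ p, m (m p) = p) (hf : ∀ p, m p ≠ p) (a b : P) (p : P) :
    rewire a b m (rewire a b m p) = p := by
  grind [rewire]

theorem rewire_ne (hm : ∀ p, m (m p) = p) (hf : ∀ p, m p ≠ p) (a b : P) (hab : a ≠ b) (p : P) :
    rewire a b m p ≠ p := by
  grind [rewire]

theorem rewire_idem (hm : ∀ p, m (m p) = p) (a b : P) (hab : a ≠ b) :
    rewire a b (rewire a b m) = rewire a b m := by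
  funext p; grind [rewire]

theorem rewire_braid (hm : ∀ p, m (m p) = p) (hf : ∀ p, m p ≠ p) (a b c : P) (hab : a ≠ b) (hbc : b ≠ c) (hac : a ≠ c) :
    rewire a b (rewire b c (rewire a b m)) = rewire a b m := by
  funext p; grind [rewire]

theorem rewire_comm (hm : ∀ p, m (m p) = p) (hf : ∀ p, m p ≠ p) (a b c d : P) (hab : a ≠ b) (hbc : b ≠ c) (hac : a ≠ c)
    (hbd : b ≠ d) (had : a ≠ d) (hcd : c ≠ d) :
    rewire a b (rewire c d m) = rewire c d (rewire a b m) := by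
  funext p; grind (splits := 25) [rewire]
end rewire

theorem boundaryPos_injective (n : ℕ) : Function.Injective (boundaryPos n) := by
  rintro (i | i) (j | j) h <;> simp only [boundaryPos] at h
  · exact congrArg _ (Fin.ext h)
  · omega
  · omega
  · exact congrArg _ (Fin.ext (by omega))

/-- The diagram of the identity: all arcs are horizontal. -/
def KauffmanDiagram.id (n : ℕ) : KauffmanDiagram n where
  partner := Sum.swap
  partner_partner := Sum.swap_swap
  partner_ne := by rintro (i | i) <;> simp
  noncrossing := by
    rintro (i | i) (j | j) <;> simp [boundaryPos] <;> omega

theorem rewire_noncrossing {P : Type*} [DecidableEq P] {m : P → P} (f : P → ℕ)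
   (hfi : Function.Injective f) (hm : ∀ p, m (m p) = p) (hf : ∀ p, m p ≠ p)
   (hnc : ∀ p q, ¬ (f p < f q ∧ f q < f (m p) ∧ f (m p) < f (m q)))
   (a b : P) (hab : f b = f a + 1) (p q : P) :
   ¬ (f p < f q ∧ f q < f (rewire a b m p) ∧ f (rewire a b m p) < f (rewire a b m q)) := by
  have hne : ∀ x y, x ≠ y → f x ≠ f y := fun x y h h' => h (hfi h')
  have hab' : a ≠ b := fun h => by subst h; omega
  -- the rewired chord `(m a, m b)` against an old chord `(x, m x)`
  have cross : ∀ x, x ≠ a → x ≠ b → m x ≠ a → m x ≠ b →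
      ¬ (f (m a) < f x ∧ f x < f (m b) ∧ f (m b) < f (m x)) ∧
      ¬ (f (m b) < f x ∧ f x < f (m a) ∧ f (m a) < f (m x)) ∧
      ¬ (f x < f (m a) ∧ f (m a) < f (m x) ∧ f (m x) < f (m b)) ∧
      ¬ (f x < f (m b) ∧ f (m b) < f (m x) ∧ f (m x) < f (m a)) := by
    intro x h1 h2 h3 h4
    have e1 := hne _ _ h1
    have e2 := hne _ _ h2
    have e3 := hne _ _ h3
    have e4 := hne _ _ h4
    have ha := hm a
    have hb := hm b
    have hx := hm x
    refine ⟨?_, ?_, ?_, ?_⟩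
    · have A1 := hnc (m a) x
      have A2 := hnc b x
      have A3 := hnc x (m b)
      rw [ha] at A1
      rw [hb] at A3
      clear hnc hne
      omega
    · have A1 := hnc (m b) x
      have A2 := hnc a x
      have A3 := hnc x (m a)
      rw [hb] at A1
      rw [ha] at A3
      clear hnc hne
      omega
    · have A1 := hnc x b
      have A2 := hnc a x
      have A3 := hnc x (m a)
      rw [ha] at A3
      clear hnc hne
      omega
    · have A1 := hnc x a
      have A2 := hnc b x
      have A3 := hnc x (m b)
      rw [hb] at A3
      clear hnc hne
      omega
  have ma : ∀ x, m x = a ↔ x = m a := fun x => ⟨fun h => by rw [← h, hm], fun h => by rw [h, hm]⟩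
  have mb : ∀ x, m x = b ↔ x = m b := fun x => ⟨fun h => by rw [← h, hm], fun h => by rw [h, hm]⟩
  simp only [ne_eq, ma, mb] at cross
  have cp := cross p
  have cq := cross q
  have n1 := hne p a
  have n2 := hne p b
  have n3 := hne q a
  have n4 := hne q b
  have n5 := hne (m p) a
  have n6 := hne (m p) b
  have n7 := hne (m q) a
  have n8 := hne (m q) b
  have hpq := hnc p q
  rw [ne_eq, ma] at n5 n7
  rw [ne_eq, mb] at n6 n8
  clear hnc hne cross ma mb hf hm hfi
  unfold rewire
  by_cases pa : p = a
  · subst pa; rw [if_pos rfl]; omega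
  by_cases pb : p = b
  · subst pb; rw [if_neg pa, if_pos rfl]; omega
  by_cases qa : q = a
  · subst qa; simp only [if_pos]; omega
  by_cases qb : q = b
  · subst qb; rw [if_neg qa, if_pos rfl]; omega
  rw [if_neg pa, if_neg pb, if_neg qa, if_neg qb]
  by_cases pma : p = m a
  · subst pma
    rw [if_pos rfl]
    split_ifs with h1 h2
    · subst h1; omega
    · subst h2; omega
    · have := cq qa qb h1 h2; omega
  by_cases pmb : p = m b
  · subst pmb
    rw [if_neg pma, if_pos rfl]
    split_ifs with h1 h2
    · subst h1; omega
    · subst h2; omega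
    · have := cq qa qb h1 h2; omega
  rw [if_neg pma, if_neg pmb]
  have := cp pa pb pma pmb
  split_ifs with h1 h2
  · subst h1; omega
  · subst h2; omega
  · exact hpq

/-! ### The symmetric group -/

/-- The simple transposition of `i` and `i + 1`. -/
def simpleRefl {n : ℕ} (i : Fin (n - 1)) : Equiv.Perm (Fin n) := Equiv.swap (lo i) (hi i)

theorem lo_ne_hi {n : ℕ} (i : Fin (n - 1)) : lo i ≠ hi i := by simp [lo, hi]

section presentation

/-! A map on the simple transpositions that respects the Coxeter relations extends to the
symmetric group (`exists_perm_hom`). -/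

variable {n : ℕ} {M : Type*} [Monoid M] {g : Fin (n - 1) → M}

theorem simpleRefl_lo (i : Fin (n - 1)) : simpleRefl i (lo i) = hi i := Equiv.swap_apply_left ..
theorem simpleRefl_hi (i : Fin (n - 1)) : simpleRefl i (hi i) = lo i := Equiv.swap_apply_right ..
theorem simpleRefl_of_ne (i : Fin (n - 1)) (x : Fin n) (h : x ≠ lo i) (h' : x ≠ hi i) :
    simpleRefl i x = x := Equiv.swap_apply_of_ne_of_ne h h'
theorem mul_simpleRefl_cancel (w : Equiv.Perm (Fin n)) (i : Fin (n - 1)) :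
    w * simpleRefl i * simpleRefl i = w := by
  rw [mul_assoc, simpleRefl, Equiv.swap_mul_self, mul_one]

/-- A weight that drops when a descent of a permutation is removed. -/
def permWeight (w : Equiv.Perm (Fin n)) : ℤ := ∑ j : Fin n, ((n : ℤ) - j) * (w j : ℤ)

theorem permWeight_lt {w : Equiv.Perm (Fin n)} {i : Fin (n - 1)} (h : w (hi i) < w (lo i)) :
    permWeight (w * simpleRefl i) < permWeight w := by
  have h1 : permWeight (w * simpleRefl i)
      = ∑ j : Fin n, ((n : ℤ) - (simpleRefl i j : Fin n)) * (w j : ℤ) := by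
    unfold permWeight
    rw [← Equiv.sum_comp (simpleRefl i)]
    refine Finset.sum_congr rfl fun j _ => ?_
    congr 3
    simp [simpleRefl]
  have h2 : permWeight (w * simpleRefl i) - permWeight w = (w (hi i) : ℤ) - w (lo i) := by
    rw [h1, permWeight, ← Finset.sum_sub_distrib, Fintype.sum_eq_add (lo i) (hi i) (lo_ne_hi i)]
    · rw [simpleRefl_lo, simpleRefl_hi]
      simp only [lo, hi]; push_cast; ring
    · rintro x ⟨hx, hx'⟩
      rw [simpleRefl_of_ne i x hx hx']; ring
  have : ((w (hi i) : Fin n) : ℤ) < (w (lo i) : Fin n) := by exact_mod_cast h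
  omega

theorem permWeight_nonneg (w : Equiv.Perm (Fin n)) : 0 ≤ permWeight w :=
  Finset.sum_nonneg fun j _ => mul_nonneg (by have := j.2; omega) (by positivity)

theorem exists_descent {w : Equiv.Perm (Fin n)} (h : w ≠ 1) : ∃ i : Fin (n - 1), w (hi i) < w (lo i) := by
  by_contra! hc
  apply h
  have hmono : StrictMono w := by
    cases n with
    | zero => exact Subsingleton.strictMono _
    | succ k =>
      rw [Fin.strictMono_iff_lt_succ]
      intro i
      refine lt_of_le_of_ne (hc ⟨i, by omega⟩) fun e => ?_
      have := w.injective e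
      simp [Fin.ext_iff] at this
  have := (hmono.range_inj (strictMono_id (α := Fin n))).1 (by rw [w.surjective.range_eq]; simp)
  ext x
  rw [this]; rfl

/-- Evaluation of reduced words. -/
inductive Reduced (g : Fin (n - 1) → M) : Equiv.Perm (Fin n) → M → Prop
  | one : Reduced g 1 1
  | step {w x i} : w (lo i) < w (hi i) → Reduced g w x → Reduced g (w * simpleRefl i) (x * g i)

theorem Reduced.cases_descent {w : Equiv.Perm (Fin n)} {x : M} (h : Reduced g w x) :
    (w = 1 ∧ x = 1) ∨ ∃ i y, w (hi i) < w (lo i) ∧ Reduced g (w * simpleRefl i) y ∧ x = y * g i := by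
  cases h with
  | one => exact .inl ⟨rfl, rfl⟩
  | @step w x i h1 h2 =>
    refine .inr ⟨i, x, ?_, ?_, rfl⟩
    · simpa [simpleRefl_lo, simpleRefl_hi] using h1
    · rwa [mul_simpleRefl_cancel]

theorem Reduced.of_descent {w : Equiv.Perm (Fin n)} {y : M} {i : Fin (n - 1)}
    (h : w (hi i) < w (lo i)) (hy : Reduced g (w * simpleRefl i) y) : Reduced g w (y * g i) := by
  rw [← mul_simpleRefl_cancel w i]
  exact .step (by simpa [simpleRefl_lo, simpleRefl_hi] using h) hy

theorem Reduced.exists (g : Fin (n - 1) → M) (w : Equiv.Perm (Fin n)) : ∃ x, Reduced g w x := by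
  induction hN : (permWeight w).toNat using Nat.strong_induction_on generalizing w with
  | _ N ih =>
    by_cases h : w = 1
    · exact ⟨1, h ▸ .one⟩
    obtain ⟨i, hi⟩ := exists_descent h
    have := permWeight_lt hi
    have := permWeight_nonneg w
    obtain ⟨y, hy⟩ := ih _ (by have := permWeight_nonneg (w * simpleRefl i); omega) (w * simpleRefl i) rfl
    exact ⟨_, .of_descent hi hy⟩

theorem simpleRefl_comm {i j : Fin (n - 1)} (h : (i : ℕ) + 2 ≤ j) :
    simpleRefl i * simpleRefl j = simpleRefl j * simpleRefl i := by
  refine (Equiv.Perm.disjoint_iff_disjoint_support.mpr ?_).commute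
  rw [simpleRefl, simpleRefl, Equiv.Perm.support_swap (lo_ne_hi i), Equiv.Perm.support_swap (lo_ne_hi j)]
  rw [Finset.disjoint_left]
  simp only [Finset.mem_insert, Finset.mem_singleton, lo, hi]
  rintro x (rfl | rfl) <;> simp [Fin.ext_iff] <;> omega

theorem simpleRefl_braid {i j : Fin (n - 1)} (h : (i : ℕ) + 1 = j) :
    simpleRefl i * simpleRefl j * simpleRefl i = simpleRefl j * simpleRefl i * simpleRefl j := by
  have e : lo j = hi i := by simp [lo, hi, h]
  have h1 := lo_ne_hi i
  have h2 := lo_ne_hi j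
  have h3 : lo i ≠ hi j := by simp only [lo, hi, ne_eq, Fin.mk.injEq]; omega
  rw [e] at h2
  unfold simpleRefl
  rw [e]
  ext x
  simp only [Equiv.Perm.mul_apply, Equiv.swap_apply_def]
  congr 1
  grind

theorem Reduced.unique (hcomm : ∀ i j : Fin (n - 1), (i : ℕ) + 2 ≤ j → g i * g j = g j * g i)
    (hbraid : ∀ i j : Fin (n - 1), (i : ℕ) + 1 = j → g i * g j * g i = g j * g i * g j)
    {w : Equiv.Perm (Fin n)} {x x' : M} (h : Reduced g w x) (h' : Reduced g w x') : x = x' := by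
  induction hN : (permWeight w).toNat using Nat.strong_induction_on generalizing w x x' with
  | _ N ih =>
  have IH : ∀ {v : Equiv.Perm (Fin n)} {z z' : M} {i : Fin (n - 1)}, w (hi i) < w (lo i) →
      v = w * simpleRefl i → Reduced g v z → Reduced g v z' → z = z' := by
    intro v z z' i hi hv hz hz'
    have h1 := permWeight_lt hi
    rw [← hv] at h1
    have := permWeight_nonneg v
    exact ih _ (by omega) hz hz' rfl
  have hone : ∀ i : Fin (n - 1), ¬ ((1 : Equiv.Perm (Fin n)) (hi i) < (1 : Equiv.Perm (Fin n)) (lo i)) := by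
    intro i; simp [lo, hi, Fin.lt_def]
  -- the diamond, for two different descents
  have diamond : ∀ {i j : Fin (n - 1)} {y y' : M}, (i : ℕ) < j → w (hi i) < w (lo i) →
      w (hi j) < w (lo j) → Reduced g (w * simpleRefl i) y → Reduced g (w * simpleRefl j) y' →
      y * g i = y' * g j := by
    intro i j y y' hij hdi hdj hy hy'
    by_cases hfar : (i : ℕ) + 2 ≤ j
    · obtain ⟨z, hz⟩ := Reduced.exists g (w * simpleRefl i * simpleRefl j)
      have ne1 : hi j ≠ lo i := by simp only [lo, hi, ne_eq, Fin.mk.injEq]; omega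
      have ne2 : hi j ≠ hi i := by simp only [lo, hi, ne_eq, Fin.mk.injEq]; omega
      have ne3 : lo j ≠ lo i := by simp only [lo, hi, ne_eq, Fin.mk.injEq]; omega
      have ne4 : lo j ≠ hi i := by simp only [lo, hi, ne_eq, Fin.mk.injEq]; omega
      have r1 : Reduced g (w * simpleRefl i) (z * g j) := .of_descent (by
        simp only [Equiv.Perm.mul_apply, simpleRefl_of_ne i _ ne1 ne2, simpleRefl_of_ne i _ ne3 ne4]
        exact hdj) hz
      have r2 : Reduced g (w * simpleRefl j) (z * g i) := .of_descent (by
        simp only [Equiv.Perm.mul_apply, simpleRefl_of_ne j _ ne3.symm ne1.symm,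
          simpleRefl_of_ne j _ ne4.symm ne2.symm]
        exact hdi) (by rwa [mul_assoc, ← simpleRefl_comm hfar, ← mul_assoc])
      rw [IH hdi rfl hy r1, IH hdj rfl hy' r2, mul_assoc, mul_assoc, hcomm i j hfar]
    · have hadj : (i : ℕ) + 1 = j := by omega
      have e : lo j = hi i := by simp [lo, hi, hadj]
      have ne1 : hi j ≠ lo i := by simp only [lo, hi, ne_eq, Fin.mk.injEq]; omega
      have ne2 : hi j ≠ hi i := by simp only [lo, hi, ne_eq, Fin.mk.injEq]; omega
      rw [e] at hdj
      obtain ⟨z, hz⟩ := Reduced.exists g (w * simpleRefl i * simpleRefl j * simpleRefl i)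
      have ej : simpleRefl j (hi i) = hi j := by rw [← e]; exact simpleRefl_lo j
      have ej' : simpleRefl j (hi j) = hi i := by rw [← e]; exact simpleRefl_hi j
      have ej'' : simpleRefl j (lo i) = lo i := simpleRefl_of_ne j _ (by rw [e]; exact lo_ne_hi i) ne1.symm
      have ei := simpleRefl_of_ne i _ ne1 ne2
      have r1 : Reduced g (w * simpleRefl i * simpleRefl j) (z * g i) := .of_descent (by
        simp only [Equiv.Perm.mul_apply, ej, ej'', simpleRefl_lo, ei]
        exact hdj) hz
      have r2 : Reduced g (w * simpleRefl i) (z * g i * g j) := .of_descent (by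
        simp only [Equiv.Perm.mul_apply, e, simpleRefl_hi, ei]
        exact hdj.trans hdi) r1
      have r3 : Reduced g (w * simpleRefl j * simpleRefl i) (z * g j) := .of_descent (by
        simp only [Equiv.Perm.mul_apply, e, simpleRefl_hi, ei, ej', ej'']
        exact hdi) (by
          rw [mul_assoc, mul_assoc, ← mul_assoc (simpleRefl j), ← simpleRefl_braid hadj]
          simpa only [mul_assoc] using hz)
      have r4 : Reduced g (w * simpleRefl j) (z * g j * g i) := .of_descent (by
        simp only [Equiv.Perm.mul_apply, ej, ej'']
        exact hdj.trans hdi) r3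
      have := hbraid i j hadj
      rw [IH hdi rfl hy r2, IH (i := j) (by rw [e]; exact hdj) rfl hy' r4]
      simp only [mul_assoc] at this ⊢
      rw [this]
  rcases h.cases_descent with ⟨rfl, rfl⟩ | ⟨i, y, hdi, hy, rfl⟩
  · rcases h'.cases_descent with ⟨-, rfl⟩ | ⟨j, y', hdj, -, -⟩
    · rfl
    · exact absurd hdj (hone j)
  · rcases h'.cases_descent with ⟨rfl, -⟩ | ⟨j, y', hdj, hy', rfl⟩
    · exact absurd hdi (hone i)
    · rcases lt_trichotomy (i : ℕ) j with hlt | heq | hgt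
      · exact diamond hlt hdi hdj hy hy'
      · obtain rfl := Fin.ext heq
        rw [IH hdi rfl hy hy']
      · exact (diamond hgt hdj hdi hy' hy).symm

theorem exists_perm_hom (hsq : ∀ i, g i * g i = 1)
    (hcomm : ∀ i j : Fin (n - 1), (i : ℕ) + 2 ≤ j → g i * g j = g j * g i)
    (hbraid : ∀ i j : Fin (n - 1), (i : ℕ) + 1 = j → g i * g j * g i = g j * g i * g j) :
    ∃ F : Equiv.Perm (Fin n) →* M, ∀ i, F (simpleRefl i) = g i := by
  choose F hF using Reduced.exists g
  have uniq : ∀ {w x}, Reduced g w x → F w = x := fun h => Reduced.unique hcomm hbraid (hF _) h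
  have hstep : ∀ w i, F (w * simpleRefl i) = F w * g i := by
    intro w i
    rcases lt_or_ge (w (lo i)) (w (hi i)) with h | h
    · exact uniq (.step h (hF w))
    · have h' := lt_of_le_of_ne h (fun e => lo_ne_hi i (w.injective e).symm)
      rw [uniq (.of_descent h' (hF (w * simpleRefl i))), mul_assoc, hsq, mul_one]
  have hone : F 1 = 1 := uniq .one
  have hmul : ∀ v x, Reduced g v x → ∀ w, F (w * v) = F w * F v := by
    intro v x hv
    induction hv with
    | one => intro w; rw [mul_one, hone, mul_one]
    | step _ _ ih => intro w; rw [← mul_assoc, hstep, hstep, ih, mul_assoc]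
  refine ⟨⟨⟨F, hone⟩, fun w v => hmul v _ (hF v) w⟩, fun i => ?_⟩
  have := hstep 1 i
  rwa [one_mul, hone, one_mul] at this

end presentation

/-! ### The Temperley--Lieb algebra -/

/-- The defining relations of the Temperley--Lieb algebra. -/
inductive TemperleyLiebRel (ξ : ℂ) (n : ℕ) :
    FreeAlgebra ℂ (Fin (n - 1)) → FreeAlgebra ℂ (Fin (n - 1)) → Prop
  | sq (i) : TemperleyLiebRel ξ n (FreeAlgebra.ι ℂ i * FreeAlgebra.ι ℂ i) (ξ • FreeAlgebra.ι ℂ i)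
  | braid (i j : Fin (n - 1)) : (i : ℕ) + 1 = j ∨ (j : ℕ) + 1 = i → TemperleyLiebRel ξ n
      (FreeAlgebra.ι ℂ i * FreeAlgebra.ι ℂ j * FreeAlgebra.ι ℂ i) (FreeAlgebra.ι ℂ i)
  | comm (i j : Fin (n - 1)) : (i : ℕ) + 2 ≤ j ∨ (j : ℕ) + 2 ≤ i → TemperleyLiebRel ξ n
      (FreeAlgebra.ι ℂ i * FreeAlgebra.ι ℂ j) (FreeAlgebra.ι ℂ j * FreeAlgebra.ι ℂ i)

/-- The Temperley--Lieb algebra: generators `t_1, …, t_{n-1}`, with the relations `t_i ^ 2 = ξ t_i`,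
`t_i t_j t_i = t_i` if `|i - j| = 1`, and `t_i t_j = t_j t_i` if `|i - j| ≥ 2`. -/
abbrev TemperleyLieb (ξ : ℂ) (n : ℕ) : Type := RingQuot (TemperleyLiebRel ξ n)

namespace TemperleyLieb
variable {ξ : ℂ} {n : ℕ}

/-- The generators `t_i`. -/
noncomputable def tGen (ξ : ℂ) {n : ℕ} (i : Fin (n - 1)) : TemperleyLieb ξ n :=
  RingQuot.mkAlgHom ℂ (TemperleyLiebRel ξ n) (FreeAlgebra.ι ℂ i)

theorem t_sq (i : Fin (n - 1)) : tGen ξ i * tGen ξ i = ξ • tGen ξ i := by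
  have := RingQuot.mkAlgHom_rel ℂ (TemperleyLiebRel.sq (ξ := ξ) i)
  rw [map_mul, map_smul] at this
  exact this

theorem t_braid {i j : Fin (n - 1)} (h : (i : ℕ) + 1 = j ∨ (j : ℕ) + 1 = i) :
    tGen ξ i * tGen ξ j * tGen ξ i = tGen ξ i := by
  have := RingQuot.mkAlgHom_rel ℂ (TemperleyLiebRel.braid (ξ := ξ) i j h)
  simp only [map_mul] at this
  exact this

theorem t_comm {i j : Fin (n - 1)} (h : (i : ℕ) + 2 ≤ j ∨ (j : ℕ) + 2 ≤ i) :
    tGen ξ i * tGen ξ j = tGen ξ j * tGen ξ i := by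
  have := RingQuot.mkAlgHom_rel ℂ (TemperleyLiebRel.comm (ξ := ξ) i j h)
  simp only [map_mul] at this
  exact this

end TemperleyLieb

open TemperleyLieb (tGen t_sq t_braid t_comm)

/-- The symmetric group with permutations composed from left to right. Mathlib composes
permutations from right to left, so this is the opposite group. -/
abbrev PermL (n : ℕ) : Type := (Equiv.Perm (Fin n))ᵐᵒᵖ

/-- The simple transposition `s_i`. -/
def sGen {n : ℕ} (i : Fin (n - 1)) : PermL n := MulOpposite.op (simpleRefl i)

theorem exists_theta (n : ℕ) : ∃ θ : MonoidAlgebra ℂ (PermL n) →ₐ[ℂ] TemperleyLieb 2 n,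
    ∀ i, θ (MonoidAlgebra.of ℂ _ (sGen i)) = tGen 2 i - 1 := by
  obtain ⟨F, hF⟩ := exists_perm_hom (n := n) (g := fun i => (tGen 2 i - 1 : TemperleyLieb 2 n))
    (fun i => by
      have := t_sq (ξ := 2) i
      simp only [sub_mul, mul_sub, this, one_mul, mul_one, two_smul]; abel)
    (fun i j h => by
      have := t_comm (ξ := 2) (i := i) (j := j) (.inl h)
      simp only [sub_mul, mul_sub, this, one_mul, mul_one]; abel)
    (fun i j h => by
      have h1 := t_braid (ξ := 2) (i := i) (j := j) (.inl h)
      have h2 := t_braid (ξ := 2) (i := j) (j := i) (.inr h)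
      have h3 := t_sq (ξ := 2) i
      have h4 := t_sq (ξ := 2) j
      simp only [sub_mul, mul_sub, h1, h2, h3, h4, one_mul, mul_one, two_smul]; abel)
  refine ⟨MonoidAlgebra.lift ℂ _ _ (F.comp (MulEquiv.inv' (Equiv.Perm (Fin n))).symm.toMonoidHom), fun i => ?_⟩
  simp [sGen, ← hF, simpleRefl]

/-- The algebra homomorphism `θ : ℂ[S_n] → TL_n(2)` determined by `θ(s_i) = t_i - 1`. -/
noncomputable def theta (n : ℕ) : MonoidAlgebra ℂ (PermL n) →ₐ[ℂ] TemperleyLieb 2 n :=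
  (exists_theta n).choose

theorem theta_s {n : ℕ} (i : Fin (n - 1)) :
    theta n (MonoidAlgebra.of ℂ _ (sGen i)) = tGen 2 i - 1 := (exists_theta n).choose_spec i

/-! ### The diagram basis -/

namespace KauffmanDiagram
variable {n : ℕ}

/-- Put the diagram of `t_i` to the left of `D` and remove a closed loop, if there is one. -/
def hook (i : Fin (n - 1)) (D : KauffmanDiagram n) : KauffmanDiagram n where
  partner := rewire (.inl (lo i)) (.inl (hi i)) D.partner
  partner_partner := rewire_rewire D.partner_partner D.partner_ne _ _
  partner_ne := rewire_ne D.partner_partner D.partner_ne _ _ (by simp [lo, hi])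
  noncrossing := rewire_noncrossing _ (boundaryPos_injective n) D.partner_partner D.partner_ne
    D.noncrossing _ _ rfl

/-- A closed loop arises exactly if `D` joins the left points `i` and `i + 1`; it counts `ξ`. -/
def loopFactor (ξ : ℂ) (i : Fin (n - 1)) (D : KauffmanDiagram n) : ℂ :=
  if D.partner (.inl (lo i)) = .inl (hi i) then ξ else 1

/-- Left multiplication by `t_i` on linear combinations of diagrams, by concatenation. -/
noncomputable def stack (ξ : ℂ) (i : Fin (n - 1)) : Module.End ℂ (KauffmanDiagram n →₀ ℂ) :=
  Finsupp.linearCombination ℂ fun D => Finsupp.single (hook i D) (loopFactor ξ i D)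

theorem stack_single (ξ : ℂ) (i : Fin (n - 1)) (D : KauffmanDiagram n) (c : ℂ) :
    stack ξ i (Finsupp.single D c) = Finsupp.single (hook i D) (c * loopFactor ξ i D) := by
  simp [stack]

theorem stack_sq (ξ : ℂ) (i : Fin (n - 1)) : stack ξ i * stack ξ i = ξ • stack (n := n) ξ i := by
  refine Finsupp.lhom_ext fun D c => ?_
  have h1 : hook i (hook i D) = hook i D :=
    KauffmanDiagram.ext (rewire_idem D.partner_partner _ _ (by simp [lo, hi]))
  have h2 : loopFactor ξ i (hook i D) = ξ := by simp [loopFactor, hook, rewire]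
  simp only [Module.End.mul_apply, LinearMap.smul_apply, stack_single, h1, h2, Finsupp.smul_single,
    smul_eq_mul]
  congr 1; ring

theorem stack_braid (ξ : ℂ) {i j : Fin (n - 1)} (h : (i : ℕ) + 1 = j ∨ (j : ℕ) + 1 = i) :
    stack ξ i * stack ξ j * stack ξ i = stack (n := n) ξ i := by
  refine Finsupp.lhom_ext fun D c => ?_
  have hab := lo_ne_hi i
  have hcd := lo_ne_hi j
  have hx : (lo j = hi i ∧ hi j ≠ lo i ∧ hi j ≠ hi i) ∨ (hi j = lo i ∧ lo j ≠ lo i ∧ lo j ≠ hi i) := by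
    simp only [lo, hi, ne_eq, Fin.mk.injEq]; omega
  have hm := D.partner_partner
  have hf := D.partner_ne
  have h1 : hook i (hook j (hook i D)) = hook i D := by
    apply KauffmanDiagram.ext
    funext p
    simp only [hook]
    grind (splits := 25) [rewire]
  have h2 : loopFactor ξ j (hook i D) = 1 := by
    simp only [loopFactor, hook]
    grind [rewire]
  have h3 : loopFactor ξ i (hook j (hook i D)) = 1 := by
    simp only [loopFactor, hook]
    grind (splits := 25) [rewire]
  simp only [Module.End.mul_apply, stack_single, h1, h2, h3, mul_one]

theorem stack_comm (ξ : ℂ) {i j : Fin (n - 1)} (h : (i : ℕ) + 2 ≤ j ∨ (j : ℕ) + 2 ≤ i) :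
    stack ξ i * stack ξ j = stack (n := n) ξ j * stack ξ i := by
  refine Finsupp.lhom_ext fun D c => ?_
  have hab := lo_ne_hi i
  have hcd := lo_ne_hi j
  have hx : lo i ≠ lo j ∧ lo i ≠ hi j ∧ hi i ≠ lo j ∧ hi i ≠ hi j := by
    simp only [lo, hi, ne_eq, Fin.mk.injEq]; omega
  have hm := D.partner_partner
  have hf := D.partner_ne
  have h1 : hook i (hook j D) = hook j (hook i D) :=
    KauffmanDiagram.ext (rewire_comm hm hf _ _ _ _ (by simpa using hab) (by simpa using hx.2.2.1)
      (by simpa using hx.1) (by simpa using hx.2.2.2) (by simpa using hx.2.1) (by simpa using hcd))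
  have h2 : loopFactor ξ j D * loopFactor ξ i (hook j D)
      = loopFactor ξ i D * loopFactor ξ j (hook i D) := by
    simp only [loopFactor, hook]
    grind (splits := 25) [rewire]
  simp only [Module.End.mul_apply, stack_single, h1, mul_assoc, h2]

end KauffmanDiagram

/-- The action of the Temperley--Lieb algebra on linear combinations of diagrams. -/
noncomputable def diagramAction (ξ : ℂ) (n : ℕ) :
    TemperleyLieb ξ n →ₐ[ℂ] Module.End ℂ (KauffmanDiagram n →₀ ℂ) :=
  RingQuot.liftAlgHom ℂ ⟨FreeAlgebra.lift ℂ (KauffmanDiagram.stack ξ), by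
    rintro x y (i | ⟨i, j, h⟩ | ⟨i, j, h⟩)
    · simpa using KauffmanDiagram.stack_sq ξ i
    · simpa using KauffmanDiagram.stack_braid ξ h
    · simpa using KauffmanDiagram.stack_comm ξ h⟩

theorem diagramAction_t (ξ : ℂ) {n : ℕ} (i : Fin (n - 1)) :
    diagramAction ξ n (tGen ξ i) = KauffmanDiagram.stack ξ i := by
  simp [diagramAction, tGen]

/-- The expansion of an element of the Temperley--Lieb algebra in the basis of Kauffman diagrams: its
product with the identity diagram. -/
noncomputable def diagramExpansion (ξ : ℂ) (n : ℕ) :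
    TemperleyLieb ξ n →ₗ[ℂ] (KauffmanDiagram n →₀ ℂ) :=
  (LinearMap.applyₗ (Finsupp.single (KauffmanDiagram.id n) 1)).comp (diagramAction ξ n).toLinearMap

/-- The diagram `τ(I)` of the product of the `t_i`, `i ∈ I`, in increasing order; see
`diagramExpansion_theta_beta`. -/
def tau {n : ℕ} (I : Finset (Fin (n - 1))) : KauffmanDiagram n :=
  (I.sort (· ≤ ·)).foldr KauffmanDiagram.hook (KauffmanDiagram.id n)

/-- `β(I)` is the product of the `1 + s_i`, `i ∈ I`, in increasing order. -/
noncomputable def beta {n : ℕ} (I : Finset (Fin (n - 1))) : MonoidAlgebra ℂ (PermL n) :=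
  ((I.sort (· ≤ ·)).map fun i => 1 + MonoidAlgebra.of ℂ _ (sGen i)).prod

theorem foldr_hook_partner {n : ℕ} (l : List (Fin (n - 1))) (x : Fin n)
    (h : ∀ i ∈ l, (x : ℕ) < i) :
    (l.foldr KauffmanDiagram.hook (KauffmanDiagram.id n)).partner (.inl x) = .inr x := by
  induction l with
  | nil => rfl
  | cons i l ih =>
    have hi' := h i (by simp)
    have ih := ih fun j hj => h j (by simp [hj])
    rw [List.foldr_cons]
    set D := l.foldr KauffmanDiagram.hook (KauffmanDiagram.id n)
    have hm := D.partner_partner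
    have e1 : x ≠ lo i := by simp only [lo, ne_eq, Fin.ext_iff]; omega
    have e2 : x ≠ hi i := by simp only [hi, ne_eq, Fin.ext_iff]; omega
    simp only [KauffmanDiagram.hook]
    grind [rewire]

/-- `τ(I) = θ(β(I))`. -/
theorem diagramExpansion_theta_beta {n : ℕ} (I : Finset (Fin (n - 1))) :
    diagramExpansion 2 n (theta n (beta I)) = Finsupp.single (tau I) 1 := by
  have h1 : theta n (beta I) = ((I.sort (· ≤ ·)).map fun i => tGen 2 i).prod := by
    rw [beta, map_list_prod, List.map_map]
    congr 2
    funext i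
    simp only [Function.comp, map_add, map_one, theta_s]; abel
  rw [h1, tau, diagramExpansion]
  have hs : (I.sort (· ≤ ·)).Pairwise (· < ·) := (I.sortedLT_sort).pairwise
  generalize I.sort (· ≤ ·) = l at hs
  change diagramAction 2 n _ _ = _
  induction l with
  | nil => simp
  | cons i l ih =>
    rw [List.pairwise_cons] at hs
    have hp := foldr_hook_partner l (lo i) (fun j hj => hs.1 j hj)
    rw [List.map_cons, List.prod_cons, map_mul, Module.End.mul_apply, ih hs.2, diagramAction_t,
      KauffmanDiagram.stack_single, List.foldr_cons]
    simp [KauffmanDiagram.loopFactor, hp]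

/-! ### Immanants -/

/-- The function `f_τ`: the coefficient of `τ` in `θ(w)`. -/
noncomputable def tlFunction {n : ℕ} (τ : KauffmanDiagram n) (w : Equiv.Perm (Fin n)) : ℂ :=
  diagramExpansion 2 n (theta n (MonoidAlgebra.of ℂ (PermL n) (MulOpposite.op w))) τ

/-- The `f`-immanant of a matrix. -/
noncomputable def immanant {n : ℕ} {A : Type*} [CommRing A] [Algebra ℂ A]
    (f : Equiv.Perm (Fin n) → ℂ) (M : Matrix (Fin n) (Fin n) A) : A :=
  ∑ w : Equiv.Perm (Fin n), f w • ∏ i, M i (w i)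

/-- The Temperley--Lieb immanant of a Kauffman diagram. -/
noncomputable def tlImmanant {n : ℕ} {A : Type*} [CommRing A] [Algebra ℂ A]
    (τ : KauffmanDiagram n) (M : Matrix (Fin n) (Fin n) A) : A :=
  immanant (tlFunction τ) M

/-- The entrywise product of a family of matrices. -/
def hadamardProd {k n : ℕ} {A : Type*} [CommRing A] (M : Fin k → Matrix (Fin n) (Fin n) A) :
    Matrix (Fin n) (Fin n) A :=
  Matrix.of fun p q => ∏ i, M i p q

/-! ### Skew shapes and ribbons

Rows and columns of Young diagrams are numbered from `0`. -/

/-- A skew shape `λ/μ`, where `λ = outer` and `μ = inner`. -/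
structure SkewShape where
  outer : YoungDiagram
  inner : YoungDiagram
  inner_le : inner ≤ outer

namespace SkewShape

/-- The cells of `λ/μ`. -/
def cells (R : SkewShape) : Finset (ℕ × ℕ) := R.outer.cells \ R.inner.cells

/-- The number of cells of `λ/μ`. -/
def size (R : SkewShape) : ℕ := R.cells.card

/-- The length `ℓ(λ)`. -/
def length (R : SkewShape) : ℕ := R.outer.colLen 0

/-- The number of cells in a row; the subtraction is not truncated, as `μ ⊆ λ`. -/
def rowSize (R : SkewShape) (j : ℕ) : ℕ := R.outer.rowLen j - R.inner.rowLen j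

/-- A ribbon is a connected skew shape without a `2 × 2` block. Cells that share a side are adjacent.
The empty shape is allowed. -/
def IsRibbon (R : SkewShape) : Prop :=
  ((SimpleGraph.hasse (ℕ × ℕ)).induce (R.cells : Set (ℕ × ℕ))).Preconnected ∧
  ¬ ∃ i j, (i, j) ∈ R.cells ∧ (i, j + 1) ∈ R.cells ∧ (i + 1, j) ∈ R.cells ∧
    (i + 1, j + 1) ∈ R.cells

/-- The label of a cell of a ribbon when its cells are numbered `1, 2, …` from the top-right cell:
the number of cells up to and including `c`, reading rows from top to bottom and each row from right
to left. -/
def label (R : SkewShape) (c : ℕ × ℕ) : ℕ :=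
  (R.cells.filter fun c' => c'.1 < c.1 ∨ (c'.1 = c.1 ∧ c.2 ≤ c'.2)).card

/-- `Des(R)`: those `a ∈ [m - 1]` for which the cell labelled `a` is immediately above the cell
labelled `a + 1`. -/
def des (R : SkewShape) : Finset ℕ :=
  (Finset.Icc 1 (R.size - 1)).filter fun a => ∃ c ∈ R.cells, (c.1 + 1, c.2) ∈ R.cells ∧
    R.label c = a ∧ R.label (c.1 + 1, c.2) = a + 1

/-- `NDes(R) = [m - 1] \ Des(R)`. -/
def ndes (R : SkewShape) : Finset ℕ := Finset.Icc 1 (R.size - 1) \ R.des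

/-- `d(J, R)`: the sums of the sizes of the first `i` rows, for `i ∈ J`. -/
def d (J : Finset ℕ) (R : SkewShape) : Finset ℕ :=
  J.image fun i => ∑ j ∈ Finset.range i, R.rowSize j

/-- The one-based indices of the nonempty rows. For a ribbon this is an interval `[a, b]`. -/
def rows (R : SkewShape) : Set ℕ := {j | 1 ≤ j ∧ R.inner.rowLen (j - 1) < R.outer.rowLen (j - 1)}

/-- The number `a` of the first nonempty row. -/
noncomputable def firstRow (R : SkewShape) : ℕ := sInf R.rows

/-- The number `b` of the last nonempty row. -/
noncomputable def lastRow (R : SkewShape) : ℕ := sSup R.rows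

/-- The set `[a, b - 1]`; it is empty if there is at most one nonempty row. -/
noncomputable def innerRows (R : SkewShape) : Finset ℕ := Finset.Ico R.firstRow R.lastRow

end SkewShape

/-- One-based indexing: the subset of `[n - 1]` that a set of indices in `Fin (n - 1)` stands for. -/
def oneBased {n : ℕ} (I : Finset (Fin (n - 1))) : Finset ℕ := I.image fun i : Fin (n - 1) => (i : ℕ) + 1

open scoped Classical in
/-- The tuples `(J_1, …, J_k)` with `J_i ⊆ S_i` for all `i` and `J_1 ∩ ⋯ ∩ J_k = T`. -/
noncomputable def tuplesWithInter {k : ℕ} (S : Fin k → Finset ℕ) (T : Finset ℕ) :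
    Finset (Fin k → Finset ℕ) :=
  (Fintype.piFinset fun i => (S i).powerset).filter fun J => ⋂ i, (J i : Set ℕ) = (T : Set ℕ)

/-! ### Partitions and tableaux -/

/-- The partitions of `m`. -/
abbrev PartitionOf (m : ℕ) : Type := {ν : YoungDiagram // ν.card = m}

theorem YoungDiagram_cells_subset (ν : YoungDiagram) :
    ν.cells ⊆ Finset.range ν.card ×ˢ Finset.range ν.card := by
  rintro ⟨i, j⟩ h
  have hc : (i, j) ∈ ν := h
  have h1 : ν.colLen j ≤ ν.card := by
    rw [YoungDiagram.colLen_eq_card]; exact Finset.card_le_card (Finset.filter_subset _ _)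
  have h2 : ν.rowLen i ≤ ν.card := by
    rw [YoungDiagram.rowLen_eq_card]; exact Finset.card_le_card (Finset.filter_subset _ _)
  rw [Finset.mem_product, Finset.mem_range, Finset.mem_range]
  exact ⟨(YoungDiagram.mem_iff_lt_colLen.1 hc).trans_le h1,
    (YoungDiagram.mem_iff_lt_rowLen.1 hc).trans_le h2⟩

instance (m : ℕ) : Finite (PartitionOf m) := by
  refine Finite.of_injective
    (β := (Finset.range m ×ˢ Finset.range m).powerset)
    (fun ν => ⟨ν.1.cells, by
      have := YoungDiagram_cells_subset ν.1
      rw [ν.2] at this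
      exact Finset.mem_powerset.2 this⟩) fun ν ν' h => ?_
  exact Subtype.ext (YoungDiagram.ext (congrArg Subtype.val h))

noncomputable instance (m : ℕ) : Fintype (PartitionOf m) := Fintype.ofFinite _

/-- A tableau is standard if each of `1, …, |ν|` appears exactly once. -/
def IsStandard {ν : YoungDiagram} (T : SemistandardYoungTableau ν) : Prop :=
  Set.BijOn (fun c : ℕ × ℕ => T c.1 c.2) ν.cells (Set.Icc 1 ν.card)

/-- The descent set of a standard tableau: those `a` for which `a + 1` is in a lower row than `a`. -/
def tableauDes {ν : YoungDiagram} (T : SemistandardYoungTableau ν) : Set ℕ :=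
  {a | ∃ c ∈ ν.cells, ∃ c' ∈ ν.cells, T c.1 c.2 = a ∧ T c'.1 c'.2 = a + 1 ∧ c.1 < c'.1}

/-- `f^ν(A)`: the number of standard Young tableaux of shape `ν` with descent set `A`. -/
noncomputable def sytCount (ν : YoungDiagram) (A : Finset ℕ) : ℕ :=
  Nat.card {T : SemistandardYoungTableau ν // IsStandard T ∧ tableauDes T = (A : Set ℕ)}

/-! ### Symmetric functions

Symmetric functions are formal power series in variables `x_0, x_1, …`, and multi-symmetric
functions are formal power series in variables `x^{(i)}_j`. -/

/-- The power series in `k` alphabets of variables. -/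
abbrev MultiSeries (k : ℕ) : Type := MvPowerSeries (Fin k × ℕ) ℂ

/-- The power series `f(x)`, written in the variables `x^{(i)}`. -/
noncomputable def inVars {k : ℕ} (i : Fin k) (f : MvPowerSeries ℕ ℂ) : MultiSeries k :=
  MvPowerSeries.rename (Function.Embedding.sectR i ℕ) f

open scoped Classical in
/-- The elementary symmetric function `e_d`: the sum of all squarefree monomials of degree `d`.
It is `0` if `d < 0`. -/
noncomputable def elemSymm (d : ℤ) : MvPowerSeries ℕ ℂ :=
  fun δ => if (δ.degree : ℤ) = d ∧ ∀ v, δ v ≤ 1 then 1 else 0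

/-- The Schur function `s_ν`, the generating function of the semistandard tableaux of shape `ν`: the
coefficient of `x^δ` is the number of tableaux in which each `v` appears `δ v` times. -/
noncomputable def schur (ν : YoungDiagram) : MvPowerSeries ℕ ℂ :=
  fun δ => (Nat.card {T : SemistandardYoungTableau ν //
    ∀ v, (ν.cells.filter fun c => T c.1 c.2 = v).card = δ v} : ℂ)

/-- The `n × n` (dual) Jacobi--Trudi matrix with entries `e_{λ_p - μ_q - p + q}`. -/
noncomputable def jacobiTrudi (n : ℕ) (R : SkewShape) :
    Matrix (Fin n) (Fin n) (MvPowerSeries ℕ ℂ) :=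
  Matrix.of fun p q => elemSymm
    ((R.outer.rowLen p : ℤ) - (R.inner.rowLen q : ℤ) - ((p : ℕ) : ℤ) + ((q : ℕ) : ℤ))

end RibbonImmanant

open RibbonImmanant

/-! The Jacobi–Trudi matrix of a ribbon vanishes below the subdiagonal, and its subdiagonal entries
are 0 or 1; an entrywise product of such matrices has the same form. Hence only permutations with
w(x) ≥ x − 1 contribute to an immanant. These are the increasing products w_S of the s_i, i ∈ S
(`ascendingPerm`), and S can be read off from w_S as its set of drops. Writing s_i = (1 + s_i) − 1
and using θ(1 + s_i) = t_i, the coefficient of τ(I) in θ(w_S) is (−1)^|S∖I| if I ⊆ S and 0 otherwise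
(`tlFunction_tau_ascendingPerm`); this needs that different sets J give different diagrams τ(J).

For one ribbon, the product of the matrix entries along w_S is zero unless S ⊆ [a, b−1]. Otherwise
the indices outside S cut the rows into blocks, and a block with r cells contributes e_r. By the
dual Pieri rule the product of these e_r is a sum of Schur functions whose coefficients count
standard tableaux built up from vertical strips of the sizes r. These are the tableaux with descents
at every number of [m−1] that is not a cut, that is, at all of NDes(R) ∪ d(S,R). Sorted by exact
descent set, they give the sum over S ⊆ J ⊆ [a, b−1] in `prod_jacobiTrudi_ascendingPerm`.

For k ribbons these sums are multiplied: w_S collects the tuples with S ⊆ J_1 ∩ ⋯ ∩ J_k. The signed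
sum over all S between I and this intersection vanishes unless the two are equal
(`alternating_sum_Icc`), which proves (1). For (2), J ↦ NDes(R) ∪ d(J,R) is a bijection from the
subsets of [a, b−1] to the subsets of [m−1] containing NDes(R), and it respects intersections
(`sum_tuples_ribbon`).

The dual Pieri rule `elemSymm_mul_schur` is proved by induction on the number of variables.
Splitting off the last variable turns both sides into sums over pairs of a vertical and a horizontal
strip, taken in opposite orders. They agree by the local rule `card_strips`, which comes from a row
by row comparison of two counting polynomials. -/

namespace RibbonImmanant

/-! ### Immanants of Hessenberg matrices -/

section Hessenberg
variable {n : ℕ}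

/-- The permutation that is the product of the simple transpositions `s_i`, `i ∈ S`, in increasing
order, composed from left to right. -/
def ascendingPerm (S : Finset (Fin (n - 1))) : Equiv.Perm (Fin n) :=
  ((S.sort (· ≤ ·)).map sGen).prod.unop

/-- In the opposite group the first letter of a word acts first. -/
theorem unop_prod_sGen_cons (i : Fin (n - 1)) (l : List (Fin (n - 1))) (x : Fin n) :
    ((i :: l).map sGen).prod.unop x = (l.map sGen).prod.unop (simpleRefl i x) := by
  simp [sGen]

theorem prod_sGen_apply_of_lt (l : List (Fin (n - 1))) (x : Fin n)
    (h : ∀ i ∈ l, (x : ℕ) < i) : (l.map sGen).prod.unop x = x := by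
  induction l with
  | nil => simp
  | cons i l ih =>
    have := h i (by simp)
    rw [unop_prod_sGen_cons, simpleRefl_of_ne i x
      (by simp only [lo, ne_eq, Fin.ext_iff]; omega) (by simp only [hi, ne_eq, Fin.ext_iff]; omega)]
    exact ih fun j hj => h j (by simp [hj])

/-- A letter that lowers a point sends it to `lo i`, which all later, larger letters fix. So a point
drops at most once, and by one. -/
theorem le_prod_sGen_apply (l : List (Fin (n - 1))) (hl : l.Pairwise (· < ·)) (x : Fin n) :
    (x : ℕ) ≤ ((l.map sGen).prod.unop x : Fin n) + 1 := by
  induction l generalizing x with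
  | nil => simp
  | cons i l ih =>
    rw [List.pairwise_cons] at hl
    rw [unop_prod_sGen_cons]
    by_cases h1 : x = lo i
    · have := ih hl.2 (hi i)
      rw [h1, simpleRefl_lo]
      simp only [lo, hi] at this ⊢; omega
    by_cases h2 : x = hi i
    · rw [h2, simpleRefl_hi, prod_sGen_apply_of_lt l (lo i) (fun j hj => hl.1 j hj)]
      simp [lo, hi]
    · rw [simpleRefl_of_ne i x h1 h2]
      exact ih hl.2 x

/-- The drops of an increasing product are its letters, so the set of letters can be recovered from
the permutation. -/
theorem prod_sGen_apply_hi (l : List (Fin (n - 1))) (hl : l.Pairwise (· < ·)) (j : Fin (n - 1)) :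
    (l.map sGen).prod.unop (hi j) = lo j ↔ j ∈ l := by
  induction l with
  | nil => simp [(lo_ne_hi j).symm]
  | cons i l ih =>
    have hl' := List.pairwise_cons.1 hl
    rw [unop_prod_sGen_cons]
    rcases lt_trichotomy (j : ℕ) i with h | h | h
    · have hj : j ∉ i :: l := by
        intro hj
        rcases List.mem_cons.1 hj with rfl | hj
        · omega
        · have := hl'.1 j hj
          rw [Fin.lt_def] at this; omega
      simp only [hj, iff_false]
      -- If the smallest letter first raises `hi j` to `hi i`, a later drop by one cannot bring it
      -- down to `lo j`.
      by_cases h1 : hi j = lo i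
      · rw [h1, simpleRefl_lo]
        have := le_prod_sGen_apply l hl'.2 (hi i)
        intro e
        rw [e] at this
        simp only [lo, hi, Fin.ext_iff] at this h1
        omega
      · rw [simpleRefl_of_ne i _ h1 (by simp only [hi, ne_eq, Fin.ext_iff]; omega), ih hl'.2]
        exact fun h => hj (List.mem_cons_of_mem _ h)
    · obtain rfl : j = i := Fin.ext h
      rw [simpleRefl_hi, prod_sGen_apply_of_lt l (lo j) (fun k hk => hl'.1 k hk)]
      simp
    · rw [simpleRefl_of_ne i _ (by simp only [lo, hi, ne_eq, Fin.ext_iff]; omega)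
        (by simp only [hi, ne_eq, Fin.ext_iff]; omega), ih hl'.2, List.mem_cons]
      have : j ≠ i := by rintro rfl; omega
      simp [this]

theorem le_ascendingPerm_apply (S : Finset (Fin (n - 1))) (x : Fin n) :
    (x : ℕ) ≤ (ascendingPerm S x : Fin n) + 1 :=
  le_prod_sGen_apply _ (S.sortedLT_sort).pairwise x

theorem ascendingPerm_apply_hi (S : Finset (Fin (n - 1))) (j : Fin (n - 1)) :
    ascendingPerm S (hi j) = lo j ↔ j ∈ S := by
  rw [ascendingPerm, prod_sGen_apply_hi _ (S.sortedLT_sort).pairwise, Finset.mem_sort]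

theorem ascendingPerm_injective : Function.Injective (ascendingPerm (n := n)) := by
  intro S S' h
  ext j
  rw [← ascendingPerm_apply_hi, ← ascendingPerm_apply_hi, h]

/-- A permutation that maps an upper segment into itself maps the complement into itself. -/
theorem perm_lt_of_lt {w : Equiv.Perm (Fin n)} {t : ℕ}
    (h : ∀ x : Fin n, t ≤ x → t ≤ (w x : ℕ)) (x : Fin n) (hx : (x : ℕ) < t) : (w x : ℕ) < t := by
  by_contra hc
  set s : Finset (Fin n) := Finset.univ.filter fun x => t ≤ (x : ℕ)
  have hs : s.map w.toEmbedding = s := Finset.eq_of_subset_of_card_le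
    (fun y hy => by
      obtain ⟨z, hz, rfl⟩ := Finset.mem_map.1 hy
      simpa [s] using h z (by simpa [s] using hz)) (by simp)
  have hx' : w x ∈ s.map w.toEmbedding := by rw [hs]; simpa [s] using hc
  rw [Finset.mem_map_equiv] at hx'
  simp [s] at hx'
  omega

/-- Since a point drops by at most one, the only way to cross below `t` is the step from `t` to `t -
1`. -/
theorem le_apply_of_ne {w : Equiv.Perm (Fin n)} (hw : ∀ x : Fin n, (x : ℕ) ≤ (w x : ℕ) + 1)
    {t : ℕ} (ht : ∀ j : Fin (n - 1), (j : ℕ) + 1 = t → w (hi j) ≠ lo j) (x : Fin n)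
    (hx : t ≤ x) : t ≤ (w x : ℕ) := by
  by_contra hc
  have h1 := hw x
  have := ht ⟨(w x : ℕ), by omega⟩ (by simp; omega)
  apply this
  have : hi (n := n) ⟨(w x : ℕ), by omega⟩ = x := by simp only [hi, Fin.ext_iff]; omega
  rw [this]
  simp [lo]

/-- The values are determined from the last point upwards. A drop fixes the value at `x`. If there
is no drop at `x`, the points from `x` on are permuted among themselves, and `x` gets the one value
that the points after it leave over. -/
theorem hessenberg_perm_ext {w w' : Equiv.Perm (Fin n)} (hw : ∀ x : Fin n, (x : ℕ) ≤ (w x : ℕ) + 1)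
    (hw' : ∀ x : Fin n, (x : ℕ) ≤ (w' x : ℕ) + 1)
    (h : ∀ j, w (hi j) = lo j ↔ w' (hi j) = lo j) : w = w' := by
  suffices ∀ N : ℕ, ∀ x : Fin n, n ≤ (x : ℕ) + N → w x = w' x by
    ext x; rw [this n x (by omega)]
  intro N
  induction N with
  | zero => intro x hx; omega
  | succ N ih =>
    intro x hx
    by_cases hj : ∃ j, hi j = x ∧ w (hi j) = lo j
    · obtain ⟨j, rfl, hj⟩ := hj
      rw [hj, (h j).1 hj]
    push Not at hj
    have hup := le_apply_of_ne hw (t := x) (fun j e => hj j (Fin.ext e))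
    have hup' := le_apply_of_ne hw' (t := x)
      (fun j e e' => hj j (Fin.ext e) ((h j).2 e'))
    by_contra hne
    obtain ⟨y, hy⟩ := w'.surjective (w x)
    have hyx : y ≠ x := by rintro rfl; exact hne hy.symm
    rcases lt_or_gt_of_ne hyx with hlt | hgt
    · have h1 := perm_lt_of_lt hup' y hlt
      rw [hy] at h1
      have := hup x le_rfl
      omega
    · have := ih y (by rw [Fin.lt_def] at hgt; omega)
      rw [hy] at this
      exact hyx (w.injective this)

/-- The value of `ascendingPerm S` at the beginning of a run of consecutive elements of `S`. -/
theorem ascendingPerm_apply_start (S : Finset (Fin (n - 1))) (p q : Fin n) (hpq : p ≤ q)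
    (hp : ∀ j : Fin (n - 1), j ∈ S → hi j ≠ p) (hq : ∀ j : Fin (n - 1), j ∈ S → lo j ≠ q)
    (h : ∀ j : Fin (n - 1), p ≤ lo j → hi j ≤ q → j ∈ S) : ascendingPerm S p = q := by
  have h1 := le_apply_of_ne (le_ascendingPerm_apply S) (t := p)
    (fun j e e' => hp j ((ascendingPerm_apply_hi S j).1 e') (Fin.ext e)) p le_rfl
  have h2 := perm_lt_of_lt (le_apply_of_ne (le_ascendingPerm_apply S) (t := (q : ℕ) + 1)
    (fun j e e' => hq j ((ascendingPerm_apply_hi S j).1 e') (Fin.ext (by simp only [lo]; omega)))) p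
    (by rw [Fin.le_def] at hpq; omega)
  -- Otherwise the value `v` satisfies p ≤ v < q. Then `v` is an element of `S`, so v + 1 is also
  -- sent to `v`, and injectivity gives p = v + 1.
  by_contra hne
  have h3 : (ascendingPerm S p : ℕ) ≠ q := fun e => hne (Fin.ext e)
  set v := ascendingPerm S p with hv
  have h4 := h ⟨v, by omega⟩ (Fin.le_def.2 h1)
    (Fin.le_def.2 (by simp only [hi]; omega))
  rw [← ascendingPerm_apply_hi] at h4
  have h5 : ascendingPerm S (hi ⟨v, by omega⟩) = v := by rw [h4]; simp [lo]
  have h6 := (ascendingPerm S).injective (h5.trans hv)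
  simp only [hi, Fin.ext_iff] at h6
  omega

/-- The `f`-immanant of a Hessenberg matrix. -/
theorem immanant_hessenberg {A : Type*} [CommRing A] [Algebra ℂ A] (f : Equiv.Perm (Fin n) → ℂ)
    (M : Matrix (Fin n) (Fin n) A) (hM : ∀ p q : Fin n, (q : ℕ) + 1 < p → M p q = 0) :
    immanant f M = ∑ S : Finset (Fin (n - 1)), f (ascendingPerm S) • ∏ i, M i (ascendingPerm S i) := by
  classical
  rw [immanant, ← Finset.sum_image (s := Finset.univ) (g := ascendingPerm)
    (f := fun w => f w • ∏ i, M i (w i)) (ascendingPerm_injective.injOn)]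
  symm
  refine Finset.sum_subset (Finset.subset_univ _) fun w _ hw => ?_
  -- A permutation without a drop by two or more is the ascending permutation of its set of drops,
  -- so every other permutation meets a zero entry.
  have : ∃ x : Fin n, (w x : ℕ) + 1 < x := by
    by_contra! hc
    apply hw
    rw [Finset.mem_image]
    refine ⟨Finset.univ.filter fun j => w (hi j) = lo j, Finset.mem_univ _, ?_⟩
    refine hessenberg_perm_ext (le_ascendingPerm_apply _) hc fun j => ?_
    simp [ascendingPerm_apply_hi]
  obtain ⟨x, hx⟩ := this
  rw [Finset.prod_eq_zero (Finset.mem_univ x) (hM x (w x) hx), smul_zero]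

/-! ### The coefficients of the diagrams `τ(I)` -/

theorem foldr_hook_cons_partner (l : List (Fin (n - 1))) (i : Fin (n - 1)) :
    ((i :: l).foldr KauffmanDiagram.hook (KauffmanDiagram.id n)).partner (.inl (lo i)) =
      .inl (hi i) := by
  simp [KauffmanDiagram.hook, rewire]

/-- The smallest letter can be read off: it joins the left points `lo i` and `hi i`, whereas a word
with only larger letters joins left `lo i` to right `lo i`. Once the smallest letters agree, they
can be removed. -/
theorem foldr_hook_injective (l l' : List (Fin (n - 1))) (hl : l.Pairwise (· < ·))
    (hl' : l'.Pairwise (· < ·)) (h : l.foldr KauffmanDiagram.hook (KauffmanDiagram.id n) =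
      l'.foldr KauffmanDiagram.hook (KauffmanDiagram.id n)) : l = l' := by
  have key : ∀ (i : Fin (n - 1)) (l l' : List (Fin (n - 1))),
      (i :: l).foldr KauffmanDiagram.hook (KauffmanDiagram.id n) =
        l'.foldr KauffmanDiagram.hook (KauffmanDiagram.id n) → ¬ ∀ j ∈ l', i < j := by
    intro i l l' h hlt
    have h1 := foldr_hook_cons_partner l i
    rw [h, foldr_hook_partner l' (lo i) (fun j hj => hlt j hj)] at h1
    simp at h1
  induction l generalizing l' with
  | nil =>
    cases l' with
    | nil => rfl
    | cons i l' => exact absurd (by simp) (key i l' [] h.symm)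
  | cons i l ih =>
    cases l' with
    | nil => exact absurd (by simp) (key i l [] h)
    | cons i' l' =>
      have hl1 := List.pairwise_cons.1 hl
      have hl1' := List.pairwise_cons.1 hl'
      rcases lt_trichotomy i i' with hlt | rfl | hgt
      · refine absurd ?_ (key i l (i' :: l') h)
        intro j hj
        rcases List.mem_cons.1 hj with rfl | hj
        · exact hlt
        · exact hlt.trans (hl1'.1 j hj)
      · congr 1
        refine ih l' hl1.2 hl1'.2 ?_
        have e1 := foldr_hook_partner l (lo i) (fun j hj => hl1.1 j hj)
        have e2 := foldr_hook_partner l' (lo i) (fun j hj => hl1'.1 j hj)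
        rw [List.foldr_cons, List.foldr_cons] at h
        set D := l.foldr KauffmanDiagram.hook (KauffmanDiagram.id n)
        set D' := l'.foldr KauffmanDiagram.hook (KauffmanDiagram.id n)
        have h' : ∀ p, rewire (.inl (lo i)) (.inl (hi i)) D.partner p =
          rewire (.inl (lo i)) (.inl (hi i)) D'.partner p := fun p => congrFun
            (congrArg KauffmanDiagram.partner h) p
        have hm := D.partner_partner
        have hm' := D'.partner_partner
        have hf := D.partner_ne
        have hf' := D'.partner_ne
        have hne : (Sum.inl (lo i) : Fin n ⊕ Fin n) ≠ .inl (hi i) := by simpa using lo_ne_hi i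
        apply KauffmanDiagram.ext
        funext p
        -- A hook forgets the partners of its two points. That of `lo i` is known to be the right
        -- point `lo i`, and after the hook this right point is joined to the former partner of `hi
        -- i`.
        have hb : D.partner (.inl (hi i)) = D'.partner (.inl (hi i)) := by
          have := h' (.inr (lo i))
          grind [rewire]
        have := h' p
        grind [rewire]
      · refine absurd ?_ (key i' l' (i :: l) h.symm)
        intro j hj
        rcases List.mem_cons.1 hj with rfl | hj
        · exact hgt
        · exact hgt.trans (hl1.1 j hj)

theorem tau_injective : Function.Injective (tau (n := n)) := by
  intro I J h
  have := foldr_hook_injective _ _ (I.sortedLT_sort).pairwise (J.sortedLT_sort).pairwise h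
  rw [← I.sort_toFinset (· ≤ ·), this, J.sort_toFinset]

/-- The expansion of a product of the generators `s_i` in the elements `β(J)`. -/
theorem of_op_ascendingPerm (S : Finset (Fin (n - 1))) :
    MonoidAlgebra.of ℂ (PermL n) (MulOpposite.op (ascendingPerm S)) =
      ∑ J ∈ S.powerset, (-1 : ℂ) ^ (S \ J).card • beta J := by
  classical
  rw [ascendingPerm, MulOpposite.op_unop]
  have hs : (S.sort (· ≤ ·)).Pairwise (· < ·) := (S.sortedLT_sort).pairwise
  have hS : S = (S.sort (· ≤ ·)).toFinset := (S.sort_toFinset _).symm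
  generalize hl : S.sort (· ≤ ·) = l at hs hS
  clear hl
  induction l generalizing S with
  | nil => subst hS; simp [beta, MonoidAlgebra.one_def]
  | cons i l ih =>
    rw [List.pairwise_cons] at hs
    have hi : i ∉ l.toFinset := fun h => lt_irrefl _ (hs.1 i (by simpa using h))
    rw [List.map_cons, List.prod_cons, map_mul, ih _ hs.2 rfl, hS, List.toFinset_cons,
      Finset.sum_powerset_insert hi, Finset.mul_sum, ← Finset.sum_add_distrib]
    refine Finset.sum_congr rfl fun J hJ => ?_
    rw [Finset.mem_powerset] at hJ
    have hiJ : i ∉ J := fun h => hi (hJ h)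
    -- As `i` is smaller than all elements of `J`, left multiplication by s_i = (1 + s_i) − 1 turns
    -- β(J) into β({i} ∪ J) − β(J).
    have hb : beta (insert i J) = (1 + MonoidAlgebra.of ℂ _ (sGen i)) * beta J := by
      rw [beta, Finset.sort_insert _ (fun j hj => (hs.1 j (by simpa using hJ hj)).le) hiJ,
        List.map_cons, List.prod_cons, beta]
    have h1 : insert i l.toFinset \ J = insert i (l.toFinset \ J) :=
      Finset.insert_sdiff_of_notMem _ hiJ
    have h2 : insert i l.toFinset \ insert i J = l.toFinset \ J := by
      ext x; simp only [Finset.mem_sdiff, Finset.mem_insert]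
      constructor
      · rintro ⟨rfl | h, h'⟩
        · simp at h'
        · exact ⟨h, fun h'' => h' (.inr h'')⟩
      · rintro ⟨h, h'⟩
        exact ⟨.inr h, by rintro (rfl | h''); exacts [hi h, h' h'']⟩
    rw [hb, h1, h2, Finset.card_insert_of_notMem (by simp [hi]), pow_succ, add_mul, one_mul,
      mul_smul_comm, mul_neg_one, neg_smul, smul_add]
    abel

/-- Applying θ to the expansion in the β(J) gives a combination of the distinct diagrams τ(J), from
which the coefficient of τ(I) is read off. -/
theorem tlFunction_tau_ascendingPerm (I S : Finset (Fin (n - 1))) :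
    tlFunction (tau I) (ascendingPerm S) = if I ⊆ S then (-1) ^ (S \ I).card else 0 := by
  classical
  rw [tlFunction, of_op_ascendingPerm, map_sum, map_sum, Finsupp.finsetSum_apply]
  have : ∀ J ∈ S.powerset, (diagramExpansion 2 n (theta n ((-1 : ℂ) ^ (S \ J).card • beta J))) (tau I) =
      if J = I then (-1) ^ (S \ I).card else 0 := by
    intro J _
    rw [map_smul, map_smul, diagramExpansion_theta_beta, Finsupp.smul_apply, Finsupp.single_apply]
    by_cases h : J = I
    · simp [h]
    · rw [if_neg (fun e => h (tau_injective e)), if_neg h, smul_zero]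
  rw [Finset.sum_congr rfl this, Finset.sum_ite_eq']
  simp

theorem tlImmanant_hessenberg {A : Type*} [CommRing A] [Algebra ℂ A] (I : Finset (Fin (n - 1)))
    (M : Matrix (Fin n) (Fin n) A) (hM : ∀ p q : Fin n, (q : ℕ) + 1 < p → M p q = 0) :
    tlImmanant (tau I) M = ∑ S : Finset (Fin (n - 1)),
      if I ⊆ S then (-1) ^ (S \ I).card * ∏ i, M i (ascendingPerm S i) else 0 := by
  rw [tlImmanant, immanant_hessenberg _ M hM]
  refine Finset.sum_congr rfl fun S _ => ?_
  rw [tlFunction_tau_ascendingPerm]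
  split_ifs
  · rw [Algebra.smul_def, map_pow, map_neg, map_one]
  · rw [zero_smul]

end Hessenberg

/-! ### Young diagrams and strips -/

section Diagrams

theorem YoungDiagram_ext_rowLen {μ ν : YoungDiagram} (h : ∀ i, μ.rowLen i = ν.rowLen i) : μ = ν := by
  ext ⟨i, j⟩
  rw [YoungDiagram.mem_cells, YoungDiagram.mem_cells, YoungDiagram.mem_iff_lt_rowLen,
    YoungDiagram.mem_iff_lt_rowLen, h]

theorem YoungDiagram_card_eq_sum (μ : YoungDiagram) {L : ℕ} (hL : ∀ i, L ≤ i → μ.rowLen i = 0) :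
    μ.card = ∑ i ∈ Finset.range L, μ.rowLen i := by
  rw [YoungDiagram.card, Finset.card_eq_sum_card_fiberwise (f := Prod.fst) (t := Finset.range L)]
  · exact Finset.sum_congr rfl fun i _ => (μ.rowLen_eq_card).symm
  · rintro ⟨i, j⟩ h
    have h' : (i, j) ∈ μ := h
    rw [YoungDiagram.mem_iff_lt_rowLen] at h'
    by_contra hc
    have := hL i (by simpa using hc)
    omega

theorem YoungDiagram_rowLen_eq_zero (μ : YoungDiagram) {i : ℕ} (h : μ.card ≤ i) : μ.rowLen i = 0 := by
  by_contra hc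
  have h1 : (i, 0) ∈ μ := YoungDiagram.mem_iff_lt_rowLen.2 (by omega)
  have h2 := YoungDiagram_cells_subset μ h1
  simp at h2
  omega

/-- The Young diagram with prescribed row lengths. -/
def diagramOfRows (f : ℕ → ℕ) (L : ℕ) (hf : Antitone f) : YoungDiagram where
  cells := (Finset.range L ×ˢ Finset.range (f 0)).filter fun c => c.2 < f c.1
  isLowerSet := by
    rintro ⟨i, j⟩ ⟨i', j'⟩ ⟨hi, hj⟩ h
    simp only [Finset.coe_filter, Finset.mem_product, Finset.mem_range, Set.mem_ofPred_eq] at *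
    have := hf hi
    omega

theorem rowLen_diagramOfRows (f : ℕ → ℕ) (L : ℕ) (hf : Antitone f) (hL : ∀ i, L ≤ i → f i = 0)
    (i : ℕ) : (diagramOfRows f L hf).rowLen i = f i := by
  refine eq_of_forall_lt_iff fun j => ?_
  rw [← YoungDiagram.mem_iff_lt_rowLen, ← YoungDiagram.mem_cells]
  simp only [diagramOfRows, Finset.mem_filter, Finset.mem_product, Finset.mem_range]
  have := hf (Nat.zero_le i)
  have := hL i
  omega

/-- The finite set of Young diagrams with at most `m` cells. -/
noncomputable def diagramsUpTo (m : ℕ) : Finset YoungDiagram :=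
  Set.Finite.toFinset (s := {ν : YoungDiagram | ν.card ≤ m})
    ((Set.finite_range fun ν : Σ k : Fin (m + 1), PartitionOf k => ν.2.1).subset
      fun ν hν => ⟨⟨⟨ν.card, Nat.lt_succ_of_le hν⟩, ν, rfl⟩, rfl⟩)

theorem mem_diagramsUpTo {m : ℕ} {ν : YoungDiagram} : ν ∈ diagramsUpTo m ↔ ν.card ≤ m := by
  simp [diagramsUpTo]

theorem sum_partitionOf {A : Type*} [AddCommMonoid A] {m K : ℕ} (hK : m ≤ K)
    (F : YoungDiagram → A) :
    ∑ ν : PartitionOf m, F ν.1 = ∑ ν ∈ diagramsUpTo K with ν.card = m, F ν := by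
  refine (Finset.sum_subtype _ (fun ν => ?_) F).symm
  rw [Finset.mem_filter, mem_diagramsUpTo]
  exact ⟨fun h => h.2, fun h => ⟨h.trans_le hK, h⟩⟩

/-- `λ/μ` is a vertical strip. -/
def IsVStrip (μ ν : YoungDiagram) : Prop :=
  ∀ i, μ.rowLen i ≤ ν.rowLen i ∧ ν.rowLen i ≤ μ.rowLen i + 1

/-- `λ/μ` is a horizontal strip. -/
def IsHStrip (μ ν : YoungDiagram) : Prop :=
  ∀ i, μ.rowLen i ≤ ν.rowLen i ∧ ν.rowLen (i + 1) ≤ μ.rowLen i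

theorem le_of_rowLen_le {μ ν : YoungDiagram} (h : ∀ i, μ.rowLen i ≤ ν.rowLen i) : μ ≤ ν := by
  rintro ⟨i, j⟩ hc
  rw [YoungDiagram.mem_iff_lt_rowLen] at hc ⊢
  exact hc.trans_le (h i)

theorem card_le_of_rowLen_le {μ ν : YoungDiagram} (h : ∀ i, μ.rowLen i ≤ ν.rowLen i) :
    μ.card ≤ ν.card :=
  Finset.card_le_card (YoungDiagram.cells_subset_iff.2 (le_of_rowLen_le h))

theorem IsVStrip.card_le {μ ν : YoungDiagram} (h : IsVStrip μ ν) : μ.card ≤ ν.card :=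
  card_le_of_rowLen_le fun i => (h i).1

theorem IsHStrip.card_le {μ ν : YoungDiagram} (h : IsHStrip μ ν) : μ.card ≤ ν.card :=
  card_le_of_rowLen_le fun i => (h i).1

end Diagrams

/-! ### The local rule

Vertical and horizontal strips commute up to the addition of one cell. -/

section LocalRule
open Polynomial

/-- The choices for row `i` of a diagram `ν` for which `ν/μ` is a vertical strip and `ν/ρ` a
horizontal strip. -/
noncomputable def upperFactor (ρ μ : ℕ → ℕ) (i : ℕ) : ℕ[X] :=
  (if ρ i ≤ μ i ∧ (i = 0 ∨ μ i ≤ ρ (i - 1)) then 1 else 0) +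
    X * (if ρ i ≤ μ i + 1 ∧ (i = 0 ∨ μ i + 1 ≤ ρ (i - 1)) then 1 else 0)

/-- The choices for row `i` of a diagram `κ` for which `ρ/κ` is a vertical strip and `μ/κ` a
horizontal strip. -/
noncomputable def lowerFactor (ρ μ : ℕ → ℕ) (i : ℕ) : ℕ[X] :=
  (if μ (i + 1) ≤ ρ i ∧ ρ i ≤ μ i then 1 else 0) +
    X * (if μ (i + 1) + 1 ≤ ρ i ∧ ρ i ≤ μ i + 1 then 1 else 0)

/-- The upper factor of row `i` sees `ρ (i - 1)`, the lower one `μ (i + 1)`, so the partial products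
are out of step. The discrepancy after row `L` depends only on whether μ (L + 1) = ρ L, and this
correction is carried from row to row. The second claim covers partial products that have already
vanished. -/
theorem prod_upperFactor_aux (ρ μ : ℕ → ℕ) (hρ : Antitone ρ) (hμ : Antitone μ) (L : ℕ) :
    (μ (L + 1) ≤ ρ L → ∏ i ∈ Finset.range (L + 1), upperFactor ρ μ i =
      (if μ (L + 1) = ρ L then 1 + X else 1) * ∏ i ∈ Finset.range (L + 1), lowerFactor ρ μ i) ∧
    (ρ L < μ (L + 1) → ∏ i ∈ Finset.range (L + 1), lowerFactor ρ μ i = 0) := by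
  have hz : ∀ L, ρ L < μ (L + 1) → lowerFactor ρ μ L = 0 := by
    intro L h
    rw [lowerFactor, if_neg (by omega), if_neg (by omega)]; simp
  induction L with
  | zero =>
    refine ⟨fun h => ?_, fun h => by simp [hz 0 h]⟩
    have := hμ (Nat.zero_le 1)
    simp only [zero_add, Finset.range_one, Finset.prod_singleton, upperFactor, lowerFactor, true_or,
      and_true] at h ⊢
    split_ifs <;> first | omega | ring
  | succ L ih =>
    refine ⟨fun h => ?_, fun h => by rw [Finset.prod_range_succ, hz _ h, mul_zero]⟩
    rw [Finset.prod_range_succ, Finset.prod_range_succ (lowerFactor ρ μ)]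
    rcases lt_or_ge (ρ L) (μ (L + 1)) with h' | h'
    · have hu : upperFactor ρ μ (L + 1) = 0 := by
        rw [upperFactor, Nat.add_sub_cancel, if_neg (by omega), if_neg (by omega)]; simp
      rw [ih.2 h', hu, mul_zero, zero_mul, mul_zero]
    · rw [ih.1 h']
      -- The correction moves past one row; this is a finite case distinction on the relative order
      -- of four row lengths.
      have key : (if μ (L + 1) = ρ L then 1 + X else 1) * upperFactor ρ μ (L + 1) =
          (if μ (L + 1 + 1) = ρ (L + 1) then 1 + X else 1) * lowerFactor ρ μ (L + 1) := by
        have h1 := hρ (Nat.le_succ L)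
        have h2 := hμ (Nat.le_succ (L + 1))
        simp only [upperFactor, lowerFactor, Nat.succ_eq_add_one, Nat.add_sub_cancel,
          Nat.add_eq_zero_iff, one_ne_zero, and_false, false_or] at *
        split_ifs <;> first | omega | ring
      calc _ = ((if μ (L + 1) = ρ L then 1 + X else 1) * upperFactor ρ μ (L + 1)) *
            ∏ i ∈ Finset.range (L + 1), lowerFactor ρ μ i := by ring
        _ = _ := by rw [key]; ring

/-- Beyond the last row, μ (L + 1) = 0 = ρ L, so the final correction is `1 + X`. This factor is the
extra cell in the local rule. -/
theorem prod_upperFactor (ρ μ : ℕ → ℕ) (hρ : Antitone ρ) (hμ : Antitone μ) (L : ℕ) (h : ρ L = 0)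
    (h' : μ L = 0) : ∏ i ∈ Finset.range (L + 1), upperFactor ρ μ i =
      (1 + X) * ∏ i ∈ Finset.range (L + 1), lowerFactor ρ μ i := by
  have h1 := hμ (show L ≤ L + 1 by omega)
  rw [h', Nat.le_zero] at h1
  have := (prod_upperFactor_aux ρ μ hρ hμ L).1 (by omega)
  rwa [if_pos (by omega)] at this

/-- Expanding the product chooses the set `A` of rows that contribute the term with `X`. -/
theorem coeff_prod_indicator (L j : ℕ) (P Q : ℕ → Prop) [DecidablePred P] [DecidablePred Q] :
    (∏ i ∈ Finset.range L, ((if P i then 1 else 0) + X * (if Q i then 1 else 0) : ℕ[X])).coeff j =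
      ((Finset.range L).powerset.filter fun A =>
        (∀ i ∈ Finset.range L, if i ∈ A then Q i else P i) ∧ A.card = j).card := by
  simp_rw [add_comm (ite _ _ _ : ℕ[X])]
  rw [Finset.prod_add, Polynomial.finsetSum_coeff, Finset.card_filter]
  refine Finset.sum_congr rfl fun A hA => ?_
  rw [Finset.mem_powerset] at hA
  rw [Finset.prod_mul_distrib, Finset.prod_const, Finset.prod_ite_zero, Finset.prod_ite_zero,
    Finset.prod_const_one, Finset.prod_const_one]
  have hiff : (∀ i ∈ Finset.range L, if i ∈ A then Q i else P i) ↔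
      (∀ i ∈ A, Q i) ∧ ∀ i ∈ Finset.range L \ A, P i := by
    constructor
    · intro h
      exact ⟨fun i hi => by simpa [hi] using h i (hA hi), fun i hi => by
        rw [Finset.mem_sdiff] at hi; simpa [hi.2] using h i hi.1⟩
    · rintro ⟨h1, h2⟩ i hi
      split_ifs with h
      exacts [h1 i h, h2 i (Finset.mem_sdiff.2 ⟨hi, h⟩)]
  simp only [hiff]
  by_cases h1 : ∀ i ∈ A, Q i
  · by_cases h2 : ∀ i ∈ Finset.range L \ A, P i
    · rw [if_pos h1, if_pos h2, mul_one, mul_one, Polynomial.coeff_X_pow]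
      exact if_congr ⟨fun h => ⟨⟨h1, h2⟩, h.symm⟩, fun h => h.2.symm⟩ rfl rfl
    · rw [if_neg h2, mul_zero, coeff_zero, if_neg fun h => h2 h.1.2]
  · rw [if_neg h1, mul_zero, zero_mul, coeff_zero, if_neg fun h => h1 h.1.1]

/-- A diagram `ν` corresponds to the set of rows in which it has one cell more than `μ`. Row `L`
must be included, since `ν` may have one row more than `ρ` and `μ`; all later rows are empty because
ν_i ≤ ρ_(i−1). -/
theorem card_upper (ρ μ : YoungDiagram) (L K j : ℕ) (hρ : ρ.rowLen L = 0) (hμ : μ.rowLen L = 0)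
    (hK : μ.card + j ≤ K) :
    (∏ i ∈ Finset.range (L + 1), upperFactor ρ.rowLen μ.rowLen i).coeff j =
      (by classical exact ((diagramsUpTo K).filter fun ν =>
        IsVStrip μ ν ∧ IsHStrip ρ ν ∧ ν.card = μ.card + j).card) := by
  classical
  have hzero : ∀ {ν : YoungDiagram}, ν.rowLen L = 0 → ∀ i, L ≤ i → ν.rowLen i = 0 :=
    fun {ν} h i hi => Nat.le_zero.1 (h ▸ ν.rowLen_anti _ _ hi)
  simp only [upperFactor]
  rw [coeff_prod_indicator]
  symm
  refine Finset.card_bij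
    (fun ν _ => (Finset.range (L + 1)).filter fun i => ν.rowLen i = μ.rowLen i + 1) ?_ ?_ ?_
  · intro ν hν
    obtain ⟨-, hV, hH, hc⟩ := Finset.mem_filter.1 hν
    have hνL : ∀ i, L + 1 ≤ i → ν.rowLen i = 0 := by
      intro i hi
      have := (hH (i - 1)).2
      rw [Nat.sub_add_cancel (by omega), hzero hρ (i - 1) (by omega)] at this
      omega
    rw [Finset.mem_filter, Finset.mem_powerset]
    refine ⟨Finset.filter_subset _ _, fun i hi => ?_, ?_⟩
    · have h1 := hV i
      have h2 := (hH i).1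
      have h3 : i = 0 ∨ ν.rowLen i ≤ ρ.rowLen (i - 1) := by
        rcases i with _ | i
        · exact .inl rfl
        · exact .inr (hH i).2
      split_ifs with h
      · have := (Finset.mem_filter.1 h).2
        omega
      · have : ν.rowLen i ≠ μ.rowLen i + 1 := fun e => h (Finset.mem_filter.2 ⟨hi, e⟩)
        omega
    · rw [YoungDiagram_card_eq_sum ν hνL, YoungDiagram_card_eq_sum μ (fun i hi => hzero hμ i (by omega)
        : ∀ i, L + 1 ≤ i → _)] at hc
      have : ∑ i ∈ Finset.range (L + 1), ν.rowLen i = ∑ i ∈ Finset.range (L + 1), (μ.rowLen i +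
          if ν.rowLen i = μ.rowLen i + 1 then 1 else 0) := by
        refine Finset.sum_congr rfl fun i _ => ?_
        have := hV i
        split_ifs <;> omega
      rw [Finset.card_filter]
      rw [this, Finset.sum_add_distrib] at hc
      omega
  · intro ν hν ν' hν' h
    obtain ⟨-, hV, hH, -⟩ := Finset.mem_filter.1 hν
    obtain ⟨-, hV', hH', -⟩ := Finset.mem_filter.1 hν'
    refine YoungDiagram_ext_rowLen fun i => ?_
    have h1 := hV i
    have h2 := hV' i
    by_cases hi : i < L + 1
    · have := Finset.ext_iff.1 h i
      simp only [Finset.mem_filter, Finset.mem_range, hi, true_and] at this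
      omega
    · have h3 := (hH (i - 1)).2
      have h4 := (hH' (i - 1)).2
      rw [Nat.sub_add_cancel (by omega), hzero hρ (i - 1) (by omega)] at h3 h4
      omega
  · intro A hA
    obtain ⟨hA, hA', hj⟩ := Finset.mem_filter.1 hA
    rw [Finset.mem_powerset] at hA
    obtain ⟨f, hf⟩ : ∃ f : ℕ → ℕ, ∀ i, f i = μ.rowLen i + if i ∈ A then 1 else 0 :=
      ⟨_, fun _ => rfl⟩
    have hbig : ∀ i, L + 1 ≤ i → f i = 0 := by
      intro i hi
      have : i ∉ A := fun h => by have := hA h; simp at this; omega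
      simp [hf, this, hzero hμ i (by omega)]
    have hf1 : ∀ i, ρ.rowLen i ≤ f i ∧ f (i + 1) ≤ ρ.rowLen i := by
      intro i
      constructor
      · by_cases hi : i < L + 1
        · have := hA' i (by simpa using hi)
          simp only [hf]
          split_ifs at this ⊢ <;> omega
        · rw [hzero hρ i (by omega)]; omega
      · by_cases hi : i + 1 < L + 1
        · have := hA' (i + 1) (by simpa using hi)
          simp only [hf]
          simp only [Nat.add_eq_zero_iff, one_ne_zero, and_false, false_or, Nat.add_sub_cancel] at this
          split_ifs at this ⊢ <;> omega
        · rw [hbig (i + 1) (by omega)]; omega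
    -- Interlacing with `ρ` makes the row lengths decrease, so every admissible choice of rows is a
    -- Young diagram.
    have hanti : Antitone f := antitone_nat_of_succ_le fun i => (hf1 i).2.trans (hf1 i).1
    have hrow := rowLen_diagramOfRows f (L + 1) hanti hbig
    have hcard : (diagramOfRows f (L + 1) hanti).card = μ.card + j := by
      rw [YoungDiagram_card_eq_sum _ (fun i hi => (hrow i).trans (hbig i hi)),
        YoungDiagram_card_eq_sum μ (fun i hi => hzero hμ i (by omega) : ∀ i, L + 1 ≤ i → _)]
      simp only [hrow, hf]
      rw [Finset.sum_add_distrib, ← Finset.card_filter, Finset.filter_mem_eq_inter,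
        Finset.inter_eq_right.2 hA, hj]
    refine ⟨diagramOfRows f (L + 1) hanti, ?_, ?_⟩
    · rw [Finset.mem_filter, mem_diagramsUpTo, hcard]
      refine ⟨hK, fun i => ?_, fun i => ?_, rfl⟩
      · rw [hrow]; simp only [hf]; split_ifs <;> omega
      · rw [hrow, hrow]; exact hf1 i
    · ext i
      simp only [Finset.mem_filter, hrow, hf]
      constructor
      · rintro ⟨-, h⟩
        by_contra hc
        simp [hc] at h
      · intro h
        exact ⟨hA h, by simp [h]⟩

/-- A diagram `κ` corresponds to the set of rows in which `ρ` has one cell more; interlacing with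
`μ` makes `κ` a diagram. -/
theorem card_lower (ρ μ : YoungDiagram) (L K j : ℕ) (hρ : ρ.rowLen L = 0) (hμ : μ.rowLen L = 0)
    (hK : ρ.card ≤ K) :
    (∏ i ∈ Finset.range (L + 1), lowerFactor ρ.rowLen μ.rowLen i).coeff j =
      (by classical exact ((diagramsUpTo K).filter fun κ =>
        IsHStrip κ μ ∧ IsVStrip κ ρ ∧ κ.card + j = ρ.card).card) := by
  classical
  have hzero : ∀ {ν : YoungDiagram}, ν.rowLen L = 0 → ∀ i, L + 1 ≤ i → ν.rowLen i = 0 :=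
    fun {ν} h i hi => Nat.le_zero.1 (h ▸ ν.rowLen_anti _ _ (by omega))
  simp only [lowerFactor]
  rw [coeff_prod_indicator]
  symm
  refine Finset.card_bij
    (fun κ _ => (Finset.range (L + 1)).filter fun i => ρ.rowLen i = κ.rowLen i + 1) ?_ ?_ ?_
  · intro κ hκ
    obtain ⟨-, hH, hV, hc⟩ := Finset.mem_filter.1 hκ
    have hκL : ∀ i, L + 1 ≤ i → κ.rowLen i = 0 := by
      intro i hi
      have := (hV i).1
      rw [hzero hρ i hi] at this
      omega
    rw [Finset.mem_filter, Finset.mem_powerset]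
    refine ⟨Finset.filter_subset _ _, fun i hi => ?_, ?_⟩
    · have h1 := hV i
      have h2 := hH i
      split_ifs with h
      · have := (Finset.mem_filter.1 h).2
        omega
      · have : ρ.rowLen i ≠ κ.rowLen i + 1 := fun e => h (Finset.mem_filter.2 ⟨hi, e⟩)
        omega
    · rw [YoungDiagram_card_eq_sum κ hκL, YoungDiagram_card_eq_sum ρ (hzero hρ)] at hc
      have : ∑ i ∈ Finset.range (L + 1), ρ.rowLen i = ∑ i ∈ Finset.range (L + 1), (κ.rowLen i +
          if ρ.rowLen i = κ.rowLen i + 1 then 1 else 0) := by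
        refine Finset.sum_congr rfl fun i _ => ?_
        have := hV i
        split_ifs <;> omega
      rw [Finset.card_filter]
      rw [this, Finset.sum_add_distrib] at hc
      omega
  · intro κ hκ κ' hκ' h
    obtain ⟨-, -, hV, -⟩ := Finset.mem_filter.1 hκ
    obtain ⟨-, -, hV', -⟩ := Finset.mem_filter.1 hκ'
    refine YoungDiagram_ext_rowLen fun i => ?_
    have h1 := hV i
    have h2 := hV' i
    by_cases hi : i < L + 1
    · have := Finset.ext_iff.1 h i
      simp only [Finset.mem_filter, Finset.mem_range, hi, true_and] at this
      omega
    · rw [hzero hρ i (by omega)] at h1 h2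
      omega
  · intro A hA
    obtain ⟨hA, hA', hj⟩ := Finset.mem_filter.1 hA
    rw [Finset.mem_powerset] at hA
    obtain ⟨f, hf⟩ : ∃ f : ℕ → ℕ, ∀ i, f i = ρ.rowLen i - if i ∈ A then 1 else 0 :=
      ⟨_, fun _ => rfl⟩
    have hbig : ∀ i, L + 1 ≤ i → f i = 0 := by
      intro i hi
      simp [hf, hzero hρ i hi]
    have hpos : ∀ i, i ∈ A → 1 ≤ ρ.rowLen i := by
      intro i hi
      have := hA' i (hA hi)
      rw [if_pos hi] at this
      omega
    have hf1 : ∀ i, f i ≤ μ.rowLen i ∧ μ.rowLen (i + 1) ≤ f i := by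
      intro i
      by_cases hi : i < L + 1
      · have := hA' i (by simpa using hi)
        simp only [hf]
        split_ifs at this ⊢ <;> omega
      · rw [hbig i (by omega), hzero hμ (i + 1) (by omega)]; omega
    have hanti : Antitone f := antitone_nat_of_succ_le fun i => (hf1 (i + 1)).1.trans (hf1 i).2
    have hrow := rowLen_diagramOfRows f (L + 1) hanti hbig
    have hcard : (diagramOfRows f (L + 1) hanti).card + j = ρ.card := by
      rw [YoungDiagram_card_eq_sum _ (fun i hi => (hrow i).trans (hbig i hi)),
        YoungDiagram_card_eq_sum ρ (hzero hρ), ← hj,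
        ← Finset.inter_eq_right.2 hA, ← Finset.filter_mem_eq_inter, Finset.card_filter,
        ← Finset.sum_add_distrib]
      refine Finset.sum_congr rfl fun i _ => ?_
      rw [hrow]
      have := hpos i
      simp only [hf]
      split_ifs with h
      · have := this h; omega
      · omega
    refine ⟨diagramOfRows f (L + 1) hanti, ?_, ?_⟩
    · rw [Finset.mem_filter, mem_diagramsUpTo]
      refine ⟨by omega, fun i => ?_, fun i => ?_, hcard⟩
      · rw [hrow]; exact hf1 i
      · rw [hrow]; simp only [hf]; split_ifs <;> omega
    · ext i
      simp only [Finset.mem_filter, hrow, hf]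
      constructor
      · rintro ⟨-, h⟩
        by_contra hc
        simp [hc] at h
      · intro h
        have := hpos i h
        exact ⟨hA h, by simp only [h, if_true]; omega⟩

open scoped Classical in
/-- The local rule: adding a horizontal strip and removing a vertical strip commute up to one cell. -/
theorem card_strips (ρ μ : YoungDiagram) (K : ℕ) (d : ℤ) (hK : (μ.card : ℤ) + d ≤ K)
    (hK' : ρ.card ≤ K) :
    ((diagramsUpTo K).filter fun ν =>
        IsVStrip μ ν ∧ IsHStrip ρ ν ∧ (ν.card : ℤ) = μ.card + d).card =
      ((diagramsUpTo K).filter fun κ =>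
        IsHStrip κ μ ∧ IsVStrip κ ρ ∧ (ρ.card : ℤ) = κ.card + d).card +
      ((diagramsUpTo K).filter fun κ =>
        IsHStrip κ μ ∧ IsVStrip κ ρ ∧ (ρ.card : ℤ) = κ.card + (d - 1)).card := by
  set L := max ρ.card μ.card
  have hρ : ρ.rowLen L = 0 := YoungDiagram_rowLen_eq_zero _ (le_max_left _ _)
  have hμ : μ.rowLen L = 0 := YoungDiagram_rowLen_eq_zero _ (le_max_right _ _)
  have hprod := prod_upperFactor ρ.rowLen μ.rowLen (fun i j h => ρ.rowLen_anti i j h)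
    (fun i j h => μ.rowLen_anti i j h) L hρ hμ
  have hempty : ∀ d' : ℤ, d' < 0 → ((diagramsUpTo K).filter fun κ =>
      IsHStrip κ μ ∧ IsVStrip κ ρ ∧ (ρ.card : ℤ) = κ.card + d').card = 0 := by
    intro d' hd'
    rw [Finset.card_eq_zero, Finset.filter_eq_empty_iff]
    rintro κ - ⟨-, hV, h⟩
    have := hV.card_le
    omega
  rcases lt_or_ge d 0 with hd | hd
  · rw [hempty d hd, hempty (d - 1) (by omega), add_zero, Finset.card_eq_zero,
      Finset.filter_eq_empty_iff]
    rintro ν - ⟨hV, -, h⟩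
    have := hV.card_le
    omega
  · obtain ⟨j, rfl⟩ := Int.eq_ofNat_of_zero_le hd
    have h1 := card_upper ρ μ L K j hρ hμ (by omega)
    have h2 := card_lower ρ μ L K j hρ hμ hK'
    rw [hprod, add_mul, one_mul, coeff_add, h2] at h1
    have e1 : ((diagramsUpTo K).filter fun ν =>
        IsVStrip μ ν ∧ IsHStrip ρ ν ∧ (ν.card : ℤ) = μ.card + j).card =
        ((diagramsUpTo K).filter fun ν => IsVStrip μ ν ∧ IsHStrip ρ ν ∧ ν.card = μ.card + j).card := by
      congr 1; ext; simp only [Finset.mem_filter]; norm_cast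
    have e2 : ∀ j : ℕ, ((diagramsUpTo K).filter fun κ =>
        IsHStrip κ μ ∧ IsVStrip κ ρ ∧ (ρ.card : ℤ) = κ.card + j).card =
        ((diagramsUpTo K).filter fun κ => IsHStrip κ μ ∧ IsVStrip κ ρ ∧ κ.card + j = ρ.card).card := by
      intro j; congr 1; ext; simp only [Finset.mem_filter]; norm_cast; simp only [eq_comm]
    rw [e1, e2, ← h1]
    congr 1
    -- The factor `X` shifts the size difference by one. For `j = 0` the difference would be −1, and
    -- both the count and the constant coefficient vanish.
    rcases j with _ | j
    · rw [coeff_X_mul_zero, hempty _ (by simp)]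
    · rw [coeff_X_mul, card_lower ρ μ L K j hρ hμ hK', ← e2]
      push_cast
      rw [add_sub_cancel_right]

end LocalRule

/-! ### Restriction of tableaux -/

section Tableaux
variable {ν : YoungDiagram}

theorem tableau_mono (T : SemistandardYoungTableau ν) {i i' j j' : ℕ} (hi : i ≤ i') (hj : j ≤ j')
    (h : (i', j') ∈ ν) : T i j ≤ T i' j' :=
  (T.row_weak_of_le hj (ν.up_left_mem hi le_rfl h)).trans (T.col_weak hi h)

/-- The cells of a tableau with entries smaller than `t`. -/
def belowDiagram (T : SemistandardYoungTableau ν) (t : ℕ) : YoungDiagram where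
  cells := ν.cells.filter fun c => T c.1 c.2 < t
  isLowerSet := by
    rintro ⟨i, j⟩ ⟨i', j'⟩ ⟨hi, hj⟩ h
    simp only [Finset.coe_filter, YoungDiagram.mem_cells, Set.mem_ofPred_eq] at *
    exact ⟨ν.up_left_mem hi hj h.1, (tableau_mono T hi hj h.1).trans_lt h.2⟩

theorem mem_belowDiagram (T : SemistandardYoungTableau ν) (t : ℕ) (c : ℕ × ℕ) :
    c ∈ belowDiagram T t ↔ c ∈ ν ∧ T c.1 c.2 < t := by
  rw [← YoungDiagram.mem_cells]; simp [belowDiagram]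

/-- The restriction of a tableau to the entries smaller than `t`. -/
def restrictBelow (T : SemistandardYoungTableau ν) (t : ℕ) :
    SemistandardYoungTableau (belowDiagram T t) where
  entry i j := if (i, j) ∈ belowDiagram T t then T i j else 0
  row_weak' {i j1 j2} hj h := by
    rw [if_pos h, if_pos ((belowDiagram T t).up_left_mem le_rfl hj.le h)]
    exact T.row_weak hj ((mem_belowDiagram T t _).1 h).1
  col_strict' {i1 i2 j} hi h := by
    rw [if_pos h, if_pos ((belowDiagram T t).up_left_mem hi.le le_rfl h)]
    exact T.col_strict hi ((mem_belowDiagram T t _).1 h).1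
  zeros' h := if_neg h

theorem restrictBelow_apply (T : SemistandardYoungTableau ν) (t i j : ℕ) :
    restrictBelow T t i j = if (i, j) ∈ belowDiagram T t then T i j else 0 := rfl

/-- Extend a tableau to a larger shape by entries that are given by a function. -/
def extendTableau {κ : YoungDiagram} (T : SemistandardYoungTableau κ) (ν : YoungDiagram)
    (g : ℕ → ℕ → ℕ)
    (hrow : ∀ {i j1 j2}, j1 < j2 → (i, j2) ∈ ν → (i, j2) ∉ κ →
      (if (i, j1) ∈ κ then T i j1 else g i j1) ≤ g i j2)
    (hcol : ∀ {i1 i2 j}, i1 < i2 → (i2, j) ∈ ν → (i2, j) ∉ κ →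
      (if (i1, j) ∈ κ then T i1 j else g i1 j) < g i2 j)
    (hle : κ ≤ ν) :
    SemistandardYoungTableau ν where
  entry i j := if (i, j) ∈ κ then T i j else if (i, j) ∈ ν then g i j else 0
  row_weak' {i j1 j2} hj h := by
    have h1 := ν.up_left_mem le_rfl hj.le h
    by_cases h2 : (i, j2) ∈ κ
    · rw [if_pos h2, if_pos (κ.up_left_mem le_rfl hj.le h2)]
      exact T.row_weak hj h2
    · rw [if_neg h2, if_pos h, if_pos h1]
      exact hrow hj h h2
  col_strict' {i1 i2 j} hi h := by
    have h1 := ν.up_left_mem hi.le le_rfl h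
    by_cases h2 : (i2, j) ∈ κ
    · rw [if_pos h2, if_pos (κ.up_left_mem hi.le le_rfl h2)]
      exact T.col_strict hi h2
    · rw [if_neg h2, if_pos h, if_pos h1]
      exact hcol hi h h2
  zeros' {i j} h := by rw [if_neg fun h' => h (hle h'), if_neg h]

/-- The tableaux of shape `ν` in which each `v` appears `δ v` times. -/
abbrev TableauxOfContent (ν : YoungDiagram) (δ : ℕ →₀ ℕ) : Type :=
  {T : SemistandardYoungTableau ν // ∀ v, (ν.cells.filter fun c => T c.1 c.2 = v).card = δ v}

theorem finite_tableaux_of_bounded (ν : YoungDiagram) (B : ℕ) :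
    Finite {T : SemistandardYoungTableau ν // ∀ c ∈ ν, T c.1 c.2 < B} := by
  refine Finite.of_injective (β := ν.cells → Fin B)
    (fun T c => ⟨T.1 c.1.1 c.1.2, T.2 c.1 c.2⟩) fun T T' h => ?_
  refine Subtype.ext (SemistandardYoungTableau.ext fun i j => ?_)
  by_cases hc : (i, j) ∈ ν
  · simpa using congrFun h ⟨(i, j), hc⟩
  · rw [T.1.zeros hc, T'.1.zeros hc]

theorem TableauxOfContent.pos {δ : ℕ →₀ ℕ} (T : TableauxOfContent ν δ) {c : ℕ × ℕ} (hc : c ∈ ν) :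
    δ (T.1 c.1 c.2) ≠ 0 := by
  rw [← T.2, Finset.card_ne_zero]
  exact ⟨c, by simpa using hc⟩

instance (δ : ℕ →₀ ℕ) : Finite (TableauxOfContent ν δ) := by
  have := finite_tableaux_of_bounded ν (δ.support.sup id + 1)
  refine Finite.of_injective (β := {T : SemistandardYoungTableau ν // ∀ c ∈ ν, T c.1 c.2 < _})
    (fun T => ⟨T.1, fun c hc => Nat.lt_succ_of_le (Finset.le_sup (f := id)
      (Finsupp.mem_support_iff.2 (T.pos hc)))⟩) fun T T' h => ?_
  exact Subtype.ext (by simpa using h)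

/-- Extend a tableau by a horizontal strip of equal large entries. -/
def extendConst {κ : YoungDiagram} (T : SemistandardYoungTableau κ) (h : IsHStrip κ ν) (N : ℕ)
    (hT : ∀ c ∈ κ, T c.1 c.2 < N) : SemistandardYoungTableau ν :=
  extendTableau T ν (fun _ _ => N)
    (fun {i j1 j2} _ _ _ => by
      split_ifs with h1
      exacts [(hT _ h1).le, le_rfl])
    (fun {i1 i2 j} hi h1 _ => by
      have : (i1, j) ∈ κ := by
        rw [YoungDiagram.mem_iff_lt_rowLen] at h1 ⊢
        exact h1.trans_le ((ν.rowLen_anti _ _ hi).trans (h i1).2)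
      rw [if_pos this]
      exact hT _ this)
    (le_of_rowLen_le fun i => (h i).1)

open scoped Classical in
-- The letter `N` is the largest allowed one, so by strictness of columns its cells form a
-- horizontal strip. Removing them leaves a tableau in the smaller letters, and this is reversible.
theorem card_tableauxOfContent (ν : YoungDiagram) (δ : ℕ →₀ ℕ) (N K : ℕ)
    (hδ : ∀ v, N < v → δ v = 0) (hK : ν.card ≤ K) :
    Nat.card (TableauxOfContent ν δ) =
      ∑ κ ∈ diagramsUpTo K with IsHStrip κ ν ∧ δ N = ν.card - κ.card,
        Nat.card (TableauxOfContent κ (δ.erase N)) := by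
  have hlt : ∀ {κ : YoungDiagram} (T : TableauxOfContent κ (δ.erase N)), ∀ c ∈ κ, T.1 c.1 c.2 < N := by
    intro κ T c hc
    have := T.pos hc
    by_contra hcon
    rcases (not_lt.1 hcon).eq_or_lt with h | h
    · rw [← h, Finsupp.erase_same] at this; exact this rfl
    · rw [Finsupp.erase_ne h.ne', hδ _ h] at this; exact this rfl
  have hsub : ∀ {κ : YoungDiagram}, IsHStrip κ ν → κ.cells ⊆ ν.cells := fun h =>
    YoungDiagram.cells_subset_iff.2 (le_of_rowLen_le fun i => (h i).1)
  set F := (diagramsUpTo K).filter fun κ => IsHStrip κ ν ∧ δ N = ν.card - κ.card with hF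
  have hFmem : ∀ κ : F, IsHStrip κ.1 ν ∧ δ N = ν.card - κ.1.card := fun κ =>
    (Finset.mem_filter.1 κ.2).2
  let e : (Σ κ : F, TableauxOfContent κ.1 (δ.erase N)) → TableauxOfContent ν δ := fun x =>
    ⟨extendConst x.2.1 (hFmem x.1).1 N (hlt x.2), by
      obtain ⟨⟨κ, hκ⟩, T⟩ := x
      have hκ' := hFmem ⟨κ, hκ⟩
      intro v
      by_cases hv : v = N
      · subst hv
        refine Eq.trans ?_ ((Finset.card_sdiff_of_subset (hsub hκ'.1)).trans hκ'.2.symm)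
        congr 1
        ext ⟨i, j⟩
        simp only [Finset.mem_filter, Finset.mem_sdiff, YoungDiagram.mem_cells]
        refine and_congr_right fun hc => ?_
        change (if (i, j) ∈ κ then T.1 i j else if (i, j) ∈ ν then v else 0) = v ↔ _
        by_cases h : (i, j) ∈ κ
        · have := hlt T _ h
          simp only [h, if_true, not_true, iff_false]; exact this.ne
        · simp [h, hc]
      · have := T.2 v
        rw [Finsupp.erase_ne hv] at this
        rw [← this]
        congr 1
        ext ⟨i, j⟩
        simp only [Finset.mem_filter, YoungDiagram.mem_cells]
        change _ ∧ (if (i, j) ∈ κ then T.1 i j else if (i, j) ∈ ν then N else 0) = v ↔ _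
        by_cases h : (i, j) ∈ κ
        · have : (i, j) ∈ ν := hsub hκ'.1 h
          simp [h, this]
        · simp only [h, if_false, false_and, iff_false]
          rintro ⟨h1, h2⟩
          rw [if_pos h1] at h2
          exact hv h2.symm⟩
  have he : ∀ x i j, (e x).1 i j = if (i, j) ∈ x.1.1 then x.2.1 i j else if (i, j) ∈ ν then N else 0 :=
    fun _ _ _ => rfl
  have hbij : Function.Bijective e := by
    constructor
    -- The inner shape is recovered as the set of cells with entries below `N`.
    · have hrec : ∀ x c, c ∈ x.1.1 ↔ c ∈ ν ∧ (e x).1 c.1 c.2 < N := by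
        rintro x ⟨i, j⟩
        simp only [he]
        by_cases h : (i, j) ∈ x.1.1
        · simp [h, hlt x.2 _ h, (YoungDiagram.mem_cells _).1 (hsub (hFmem x.1).1 h)]
        · simp only [h, if_false, false_iff]
          rintro ⟨h1, h2⟩
          simp [h1] at h2
      rintro ⟨⟨κ, hκ⟩, T⟩ ⟨⟨κ', hκ'⟩, T'⟩ h
      have hκκ : κ = κ' := by
        ext c
        rw [YoungDiagram.mem_cells, YoungDiagram.mem_cells, hrec ⟨⟨κ, hκ⟩, T⟩,
          hrec ⟨⟨κ', hκ'⟩, T'⟩, h]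
      subst hκκ
      have : T = T' := by
        refine Subtype.ext (SemistandardYoungTableau.ext fun i j => ?_)
        by_cases hc : (i, j) ∈ κ
        · have h1 := he ⟨⟨κ, hκ⟩, T⟩ i j
          have h2 := he ⟨⟨κ, hκ'⟩, T'⟩ i j
          rw [h] at h1
          simp only [hc, if_true] at h1 h2
          rw [← h1, h2]
        · rw [T.1.zeros hc, T'.1.zeros hc]
      subst this
      rfl
    · intro T
      have hle : ∀ c ∈ ν, T.1 c.1 c.2 ≤ N := fun c hc => by
        by_contra hcon
        exact T.pos hc (hδ _ (not_le.1 hcon))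
      have hH : IsHStrip (belowDiagram T.1 N) ν := by
        refine fun i => ⟨le_of_forall_lt fun j hj => ?_, le_of_forall_lt fun j hj => ?_⟩
        · rw [← YoungDiagram.mem_iff_lt_rowLen] at hj ⊢
          exact ((mem_belowDiagram _ _ _).1 hj).1
        · rw [← YoungDiagram.mem_iff_lt_rowLen] at hj ⊢
          exact (mem_belowDiagram _ _ _).2 ⟨ν.up_left_mem (Nat.le_succ i) le_rfl hj,
            (T.1.col_strict (Nat.lt_succ_self i) hj).trans_le (hle _ hj)⟩
      have hcard : δ N = ν.card - (belowDiagram T.1 N).card := by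
        rw [← T.2 N, YoungDiagram.card, YoungDiagram.card, ← Finset.card_sdiff_of_subset (hsub hH)]
        congr 1
        ext c
        simp only [Finset.mem_filter, Finset.mem_sdiff, YoungDiagram.mem_cells, mem_belowDiagram]
        refine and_congr_right fun hc => ?_
        have := hle c hc
        simp only [hc, true_and, not_lt]
        omega
      have hcont : ∀ v, ((belowDiagram T.1 N).cells.filter
          fun c => restrictBelow T.1 N c.1 c.2 = v).card = δ.erase N v := by
        intro v
        have : ((belowDiagram T.1 N).cells.filter fun c => restrictBelow T.1 N c.1 c.2 = v) =
            if v < N then ν.cells.filter fun c => T.1 c.1 c.2 = v else ∅ := by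
          ext ⟨i, j⟩
          rw [Finset.mem_filter, YoungDiagram.mem_cells]
          simp only [restrictBelow_apply]
          by_cases h : (i, j) ∈ belowDiagram T.1 N
          · have h' := (mem_belowDiagram _ _ _).1 h
            simp only at h'
            rw [if_pos h]
            split_ifs with hv
            · simp [h, h'.1]
            · simp only [Finset.notMem_empty, iff_false]; rintro ⟨-, rfl⟩; exact hv h'.2
          · rw [mem_belowDiagram] at h
            simp only [mem_belowDiagram, h, false_and, false_iff]
            split_ifs with hv
            · rw [Finset.mem_filter]
              rintro ⟨h1, rfl⟩
              exact h ⟨h1, hv⟩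
            · simp
        rw [this]
        split_ifs with hv
        · rw [T.2, Finsupp.erase_ne hv.ne]
        · rcases (not_lt.1 hv).eq_or_lt with h | h
          · rw [← h, Finsupp.erase_same, Finset.card_empty]
          · rw [Finsupp.erase_ne h.ne', hδ _ h, Finset.card_empty]
      refine ⟨⟨⟨belowDiagram T.1 N, Finset.mem_filter.2 ⟨mem_diagramsUpTo.2 (hH.card_le.trans hK),
        hH, hcard⟩⟩, ⟨restrictBelow T.1 N, hcont⟩⟩, ?_⟩
      refine Subtype.ext (SemistandardYoungTableau.ext fun i j => ?_)
      rw [he]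
      simp only [restrictBelow_apply]
      split_ifs with h1 h2
      · rfl
      · refine le_antisymm ?_ (hle _ h2)
        by_contra hcon
        exact h1 ((mem_belowDiagram _ _ _).2 ⟨h2, not_le.1 hcon⟩)
      · exact (T.1.zeros h2).symm
  rw [← Nat.card_congr (Equiv.ofBijective e hbij), Nat.card_sigma]
  exact Finset.sum_coe_sort F fun κ => Nat.card (TableauxOfContent κ (δ.erase N))

end Tableaux

/-! ### Truncation to finitely many variables and the Pieri rule -/

section Pieri
open MvPowerSeries

open scoped Classical in
/-- Set the variables `x_v`, `v ≥ N`, to zero. -/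
noncomputable def truncVarsFun (N : ℕ) (f : MvPowerSeries ℕ ℂ) : MvPowerSeries ℕ ℂ :=
  fun δ => if ∀ v, N ≤ v → δ v = 0 then coeff δ f else 0

open scoped Classical in
theorem coeff_truncVarsFun (N : ℕ) (f : MvPowerSeries ℕ ℂ) (δ : ℕ →₀ ℕ) :
    coeff δ (truncVarsFun N f) = if ∀ v, N ≤ v → δ v = 0 then coeff δ f else 0 := rfl

/-- `truncVarsFun` as a ring homomorphism. -/
noncomputable def truncVars (N : ℕ) : MvPowerSeries ℕ ℂ →+* MvPowerSeries ℕ ℂ where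
  toFun := truncVarsFun N
  map_zero' := by ext δ; simp [coeff_truncVarsFun]
  map_one' := by
    classical
    ext δ
    rw [coeff_truncVarsFun, coeff_one]
    by_cases h : δ = 0 <;> simp [h]
  map_add' f g := by
    ext δ
    simp only [map_add, coeff_truncVarsFun]
    split_ifs <;> simp
  map_mul' f g := by
    classical
    ext δ
    rw [coeff_mul]
    simp only [coeff_truncVarsFun]
    split_ifs with h
    · rw [coeff_mul]
      refine Finset.sum_congr rfl fun x hx => ?_
      rw [Finset.HasAntidiagonal.mem_antidiagonal] at hx
      have hx' : ∀ v, N ≤ v → x.1 v = 0 ∧ x.2 v = 0 := fun v hv => by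
        have := h v hv
        rw [← hx, Finsupp.add_apply] at this
        omega
      rw [if_pos fun v hv => (hx' v hv).1, if_pos fun v hv => (hx' v hv).2]
    · refine (Finset.sum_eq_zero fun x hx => ?_).symm
      rw [Finset.HasAntidiagonal.mem_antidiagonal] at hx
      by_contra hne
      rcases ne_zero_and_ne_zero_of_mul hne with ⟨h1, h2⟩
      refine h fun v hv => ?_
      rw [← hx, Finsupp.add_apply, (ite_ne_right_iff.1 h1).1 v hv, (ite_ne_right_iff.1 h2).1 v hv]

open scoped Classical in
theorem coeff_truncVars (N : ℕ) (f : MvPowerSeries ℕ ℂ) (δ : ℕ →₀ ℕ) :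
    coeff δ (truncVars N f) = if ∀ v, N ≤ v → δ v = 0 then coeff δ f else 0 := rfl

/-- A monomial involves only finitely many variables. Identities can therefore be proved by
induction on the number of variables kept. -/
theorem ext_truncVars {f g : MvPowerSeries ℕ ℂ} (h : ∀ N, truncVars N f = truncVars N g) : f = g := by
  ext δ
  have hδ : ∀ v, δ.support.sup id + 1 ≤ v → δ v = 0 := fun v hv => by
    by_contra hc
    have := Finset.le_sup (f := id) (Finsupp.mem_support_iff.2 hc)
    simp only [id] at this
    omega
  have := congrArg (coeff δ) (h (δ.support.sup id + 1))
  rwa [coeff_truncVars, coeff_truncVars, if_pos hδ, if_pos hδ] at this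

open scoped Classical in
theorem coeff_X_pow_mul_truncVars (N a : ℕ) (f : MvPowerSeries ℕ ℂ) (δ : ℕ →₀ ℕ) :
    coeff δ (X N ^ a * truncVars N f) =
      if δ N = a ∧ ∀ v, N < v → δ v = 0 then coeff (δ.erase N) f else 0 := by
  rw [X_pow_eq, coeff_monomial_mul, one_mul, coeff_truncVars]
  have h1 : (∀ v, N < v → (δ - Finsupp.single N a) v = 0) ↔ ∀ v, N < v → δ v = 0 := by
    refine forall₂_congr fun v hv => ?_
    rw [Finsupp.tsub_apply, Finsupp.single_eq_of_ne hv.ne', Nat.sub_zero]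
  have h2 : (∀ v, N ≤ v → (δ - Finsupp.single N a) v = 0) ↔
      (δ N ≤ a ∧ ∀ v, N < v → δ v = 0) := by
    rw [← h1]
    constructor
    · intro h
      have := h N le_rfl
      simp only [Finsupp.tsub_apply, Finsupp.single_eq_same] at this
      exact ⟨by omega, fun v hv => h v hv.le⟩
    · rintro ⟨h, h'⟩ v hv
      rcases hv.eq_or_lt with rfl | hv
      · simp only [Finsupp.tsub_apply, Finsupp.single_eq_same]; omega
      · exact h' v hv
  simp only [h2, Finsupp.single_le_iff]
  rw [← ite_and]
  by_cases h : δ N = a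
  · have : δ - Finsupp.single N a = δ.erase N := by
      ext v
      by_cases hv : v = N
      · subst hv; simp [h]
      · rw [Finsupp.tsub_apply, Finsupp.erase_ne hv, Finsupp.single_eq_of_ne hv, Nat.sub_zero]
    simp [h, this]
  · rw [if_neg (by omega), if_neg (by tauto)]

/-! ### Splitting off the last variable -/

theorem degree_erase (δ : ℕ →₀ ℕ) (N : ℕ) : δ.degree = (δ.erase N).degree + δ N := by
  conv_lhs => rw [← Finsupp.erase_add_single N δ]
  rw [map_add, Finsupp.degree_single]

open scoped Classical in
theorem coeff_elemSymm (d : ℤ) (δ : ℕ →₀ ℕ) :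
    coeff δ (elemSymm d) = if (δ.degree : ℤ) = d ∧ ∀ v, δ v ≤ 1 then 1 else 0 := rfl

/-- A squarefree monomial contains x_N to the power 0 or 1. An integer `d` avoids a special case
when d − 1 is negative. -/
theorem truncVars_succ_elemSymm (N : ℕ) (d : ℤ) : truncVars (N + 1) (elemSymm d) =
    truncVars N (elemSymm d) + X N * truncVars N (elemSymm (d - 1)) := by
  classical
  ext δ
  rw [← one_mul (truncVars N (elemSymm d)), ← pow_zero (X N : MvPowerSeries ℕ ℂ), ← pow_one (X N),
    ← pow_mul, map_add, coeff_X_pow_mul_truncVars, coeff_X_pow_mul_truncVars, coeff_truncVars]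
  simp only [Nat.succ_le_iff, mul_zero, coeff_elemSymm]
  by_cases h : ∀ v, N < v → δ v = 0
  · have hd := degree_erase δ N
    have hle : (∀ v, δ v ≤ 1) ↔ (∀ v, δ.erase N v ≤ 1) ∧ δ N ≤ 1 := by
      constructor
      · refine fun h => ⟨fun v => ?_, h N⟩
        by_cases hv : v = N
        · rw [hv, Finsupp.erase_same]; omega
        · rw [Finsupp.erase_ne hv]; exact h v
      · rintro ⟨h1, h2⟩ v
        by_cases hv : v = N
        · rwa [hv]
        · rw [← Finsupp.erase_ne (f := δ) hv]; exact h1 v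
    rw [hle, hd]
    simp only [eq_true h, and_true, if_true]
    generalize (∀ v, δ.erase N v ≤ 1) = p
    by_cases h0 : δ N = 0
    · simp [h0]
    · by_cases h1 : δ N = 1
      · simp [h1, eq_sub_iff_add_eq]
      · have : ¬ δ N ≤ 1 := by omega
        simp [h0, h1, this]
  · rw [if_neg h, if_neg (by tauto), if_neg (by tauto), add_zero]

theorem coeff_schur (ν : YoungDiagram) (δ : ℕ →₀ ℕ) :
    coeff δ (schur ν) = Nat.card (TableauxOfContent ν δ) := rfl

open scoped Classical in
-- The branching rule: the exponent of x_N is the number of cells filled with the largest letter.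
theorem truncVars_succ_schur (N K : ℕ) (ν : YoungDiagram) (hK : ν.card ≤ K) :
    truncVars (N + 1) (schur ν) = ∑ κ ∈ (diagramsUpTo K).filter fun κ => IsHStrip κ ν,
      X N ^ (ν.card - κ.card) * truncVars N (schur κ) := by
  ext δ
  rw [map_sum, coeff_truncVars]
  simp only [coeff_X_pow_mul_truncVars, Nat.succ_le_iff, coeff_schur]
  by_cases h : ∀ v, N < v → δ v = 0
  · simp only [eq_true h, and_true, if_true]
    rw [card_tableauxOfContent ν δ N K h hK, ← Finset.sum_filter,
      Finset.filter_filter, Nat.cast_sum]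
  · rw [if_neg h]
    exact (Finset.sum_eq_zero fun κ _ => if_neg (by tauto)).symm

/-! ### Constant terms, for the start of the induction -/

theorem coeff_zero_schur (ν : YoungDiagram) : coeff 0 (schur ν) = if ν.card = 0 then 1 else 0 := by
  rw [coeff_schur]
  split_ifs with h
  · have hν : ∀ c, c ∉ ν := fun c hc => by
      rw [YoungDiagram.card, Finset.card_eq_zero] at h
      have : c ∈ ν.cells := hc
      simp [h] at this
    rw [Nat.cast_eq_one, Nat.card_eq_one_iff_unique]
    refine ⟨⟨fun T T' => Subtype.ext (SemistandardYoungTableau.ext fun i j => ?_)⟩,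
      ⟨⟨default, fun v => ?_⟩⟩⟩
    · rw [T.1.zeros (hν _), T'.1.zeros (hν _)]
    · rw [YoungDiagram.card, Finset.card_eq_zero] at h
      simp [h]
  · obtain ⟨c, hc⟩ := Finset.card_ne_zero.1 h
    have : IsEmpty (TableauxOfContent ν 0) := ⟨fun T => T.pos hc rfl⟩
    simp

theorem truncVars_zero_eq {f g : MvPowerSeries ℕ ℂ} (h : coeff 0 f = coeff 0 g) :
    truncVars 0 f = truncVars 0 g := by
  classical
  ext δ
  rw [coeff_truncVars, coeff_truncVars]
  split_ifs with hδ
  · have : δ = 0 := Finsupp.ext fun v => hδ v (Nat.zero_le v)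
    rw [this, h]
  · rfl

open scoped Classical in
-- If the summand depends only on the end of a two-step chain, only the number of possible middle
-- terms matters. This is what brings a double sum over strips into the form of the local rule.
theorem sum_filter_sum_filter {α A : Type*} [AddCommMonoid A] (U : Finset α) (P : α → Prop)
    [DecidablePred P] (Q : α → α → Prop) [∀ κ, DecidablePred (Q κ)] (G : α → A) :
    ∑ κ ∈ U with P κ, ∑ ρ ∈ U with Q κ ρ, G ρ =
      ∑ ρ ∈ U, (U.filter fun κ => P κ ∧ Q κ ρ).card • G ρ := by
  simp_rw [Finset.sum_filter (p := fun ρ => Q _ ρ)]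
  rw [Finset.sum_comm]
  refine Finset.sum_congr rfl fun ρ _ => ?_
  rw [← Finset.sum_filter, Finset.filter_filter, Finset.sum_const]

open scoped Classical in
/-- The dual Pieri rule. -/
theorem elemSymm_mul_schur (μ : YoungDiagram) (d : ℤ) (K : ℕ) (hK : μ.card ≤ K)
    (hK' : (μ.card : ℤ) + d ≤ K) :
    elemSymm d * schur μ = ∑ ν ∈ (diagramsUpTo K).filter fun ν =>
      IsVStrip μ ν ∧ (ν.card : ℤ) = μ.card + d, schur ν := by
  refine ext_truncVars fun N => ?_
  induction N generalizing μ d with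
  | zero =>
    refine truncVars_zero_eq ?_
    have he : coeff 0 (elemSymm d) = if d = 0 then 1 else 0 := by
      rw [coeff_elemSymm]; simp [eq_comm]
    rw [coeff_zero_eq_constantCoeff_apply, map_mul, ← coeff_zero_eq_constantCoeff_apply,
      ← coeff_zero_eq_constantCoeff_apply, he, map_sum]
    simp only [coeff_zero_schur]
    rw [← Finset.sum_filter, Finset.filter_filter, Finset.sum_const, ite_zero_mul_ite_zero, mul_one]
    by_cases h : d = 0 ∧ μ.card = 0
    · rw [if_pos h]
      have : ((diagramsUpTo K).filter fun ν =>
          (IsVStrip μ ν ∧ (ν.card : ℤ) = μ.card + d) ∧ ν.card = 0) = {μ} := by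
        ext ν
        simp only [Finset.mem_filter, mem_diagramsUpTo, Finset.mem_singleton]
        constructor
        · rintro ⟨-, -, h1⟩
          refine YoungDiagram_ext_rowLen fun i => ?_
          rw [YoungDiagram_rowLen_eq_zero ν (by omega), YoungDiagram_rowLen_eq_zero μ (by omega)]
        · rintro rfl
          exact ⟨hK, ⟨fun i => ⟨le_rfl, by omega⟩, by omega⟩, h.2⟩
      rw [this]; simp
    · rw [if_neg h, Finset.filter_eq_empty_iff.2]
      · simp
      · rintro ν - ⟨⟨hV, h1⟩, h2⟩
        have := hV.card_le
        exact h ⟨by omega, by omega⟩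
  | succ N ih =>
    set U := diagramsUpTo K with hU
    -- By homogeneity the power of x_N next to s_ρ must be |μ| + d − |ρ|, whichever chain leads to
    -- `ρ`. So one summand `G` serves all three double sums.
    let G : YoungDiagram → MvPowerSeries ℕ ℂ := fun ρ =>
      X N ^ ((μ.card : ℤ) + d - ρ.card).toNat * truncVars N (schur ρ)
    have hL : truncVars (N + 1) (elemSymm d * schur μ) =
        ∑ κ ∈ U with IsHStrip κ μ, ∑ ρ ∈ U with IsVStrip κ ρ ∧ (ρ.card : ℤ) = κ.card + d, G ρ +
        ∑ κ ∈ U with IsHStrip κ μ, ∑ ρ ∈ U with IsVStrip κ ρ ∧ (ρ.card : ℤ) = κ.card + (d - 1), G ρ := by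
      rw [map_mul, truncVars_succ_elemSymm, truncVars_succ_schur N K μ hK, Finset.mul_sum,
        ← Finset.sum_add_distrib]
      refine Finset.sum_congr rfl fun κ hκ => ?_
      have hκ' := (Finset.mem_filter.1 hκ).2.card_le
      have h1 := ih κ d (by omega) (by omega)
      have h2 := ih κ (d - 1) (by omega) (by omega)
      rw [map_mul, map_sum] at h1 h2
      have e : (truncVars N (elemSymm d) + X N * truncVars N (elemSymm (d - 1))) *
          (X N ^ (μ.card - κ.card) * truncVars N (schur κ)) =
          X N ^ (μ.card - κ.card) * (truncVars N (elemSymm d) * truncVars N (schur κ)) +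
          X N ^ (μ.card - κ.card + 1) * (truncVars N (elemSymm (d - 1)) * truncVars N (schur κ)) := by
        ring
      rw [e, h1, h2, Finset.mul_sum, Finset.mul_sum]
      congr 1
      · refine Finset.sum_congr rfl fun ρ hρ => ?_
        have := (Finset.mem_filter.1 hρ).2.2
        simp only [G]
        congr 2
        omega
      · refine Finset.sum_congr rfl fun ρ hρ => ?_
        have := (Finset.mem_filter.1 hρ).2.2
        simp only [G]
        congr 2
        omega
    have hR : truncVars (N + 1) (∑ ν ∈ U.filter fun ν =>
        IsVStrip μ ν ∧ (ν.card : ℤ) = μ.card + d, schur ν) =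
        ∑ ν ∈ U with IsVStrip μ ν ∧ (ν.card : ℤ) = μ.card + d, ∑ ρ ∈ U with IsHStrip ρ ν, G ρ := by
      rw [map_sum]
      refine Finset.sum_congr rfl fun ν hν => ?_
      obtain ⟨h1, -, h2⟩ := Finset.mem_filter.1 hν
      rw [truncVars_succ_schur N K ν (mem_diagramsUpTo.1 h1)]
      refine Finset.sum_congr rfl fun ρ hρ => ?_
      have := (Finset.mem_filter.1 hρ).2.card_le
      simp only [G]
      congr 2
      omega
    rw [hL, hR, sum_filter_sum_filter, sum_filter_sum_filter, sum_filter_sum_filter,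
      ← Finset.sum_add_distrib]
    refine Finset.sum_congr rfl fun ρ hρ => ?_
    rw [← add_smul]
    congr 1
    have := card_strips ρ μ K d hK' (mem_diagramsUpTo.1 hρ)
    convert this.symm using 2
    congr 1
    funext ν
    exact propext (by tauto)

end Pieri

/-! ### Standard tableaux with prescribed descents -/

section Standard
variable {ν μ : YoungDiagram}

/-- An injection from |ν| cells into |ν| numbers is onto. -/
theorem isStandard_of_injOn {T : SemistandardYoungTableau ν}
    (h : ∀ c ∈ ν, 1 ≤ T c.1 c.2 ∧ T c.1 c.2 ≤ ν.card)
    (hinj : ∀ c ∈ ν, ∀ c' ∈ ν, T c.1 c.2 = T c'.1 c'.2 → c = c') : IsStandard T := by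
  have hinj' : Set.InjOn (fun c : ℕ × ℕ => T c.1 c.2) ν.cells := fun c hc c' hc' => hinj c hc c' hc'
  refine ⟨fun c hc => h c hc, hinj', ?_⟩
  have : ν.cells.image (fun c => T c.1 c.2) = Finset.Icc 1 ν.card := by
    refine Finset.eq_of_subset_of_card_le (fun x hx => ?_) ?_
    · obtain ⟨c, hc, rfl⟩ := Finset.mem_image.1 hx
      exact Finset.mem_Icc.2 (h c hc)
    · rw [Finset.card_image_of_injOn hinj', Nat.card_Icc]
      exact le_of_eq (by rw [YoungDiagram.card]; omega)
  intro x hx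
  have hx' : x ∈ ν.cells.image (fun c => T c.1 c.2) := by rw [this]; simpa using hx
  obtain ⟨c, hc, rfl⟩ := Finset.mem_image.1 hx'
  exact ⟨c, hc, rfl⟩

/-- The standard tableaux of shape `ν` that have descents at all elements of `B` below `|ν|`. -/
abbrev StandardWithDescents (ν : YoungDiagram) (B : Set ℕ) : Type :=
  {T : SemistandardYoungTableau ν // IsStandard T ∧ ∀ a ∈ B, a < ν.card → a ∈ tableauDes T}

theorem finite_standard (ν : YoungDiagram) (P : SemistandardYoungTableau ν → Prop) :
    Finite {T : SemistandardYoungTableau ν // IsStandard T ∧ P T} := by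
  have := finite_tableaux_of_bounded ν (ν.card + 1)
  refine Finite.of_injective (β := {T : SemistandardYoungTableau ν // ∀ c ∈ ν, T c.1 c.2 < _})
    (fun T => ⟨T.1, fun c hc => Nat.lt_succ_of_le (T.2.1.mapsTo hc).2⟩) fun T T' h => ?_
  exact Subtype.ext (by simpa using h)

instance (B : Set ℕ) : Finite (StandardWithDescents ν B) := finite_standard ν _

/-- The number of cells of `ν/μ` in the rows up to `i`. -/
def stripRank (μ ν : YoungDiagram) (i : ℕ) : ℕ := ((ν.cells \ μ.cells).filter fun c => c.1 ≤ i).card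

theorem stripRank_mono : Monotone (stripRank μ ν) := fun i j h =>
  Finset.card_le_card fun c hc => by
    rw [Finset.mem_filter] at hc ⊢
    exact ⟨hc.1, hc.2.trans h⟩

theorem stripRank_lt {i i' j : ℕ} (h : i < i') (hc : (i', j) ∈ ν) (hc' : (i', j) ∉ μ) :
    stripRank μ ν i < stripRank μ ν i' := by
  refine Finset.card_lt_card (Finset.ssubset_iff_subset_ne.2 ⟨fun c hc => ?_, fun e => ?_⟩)
  · rw [Finset.mem_filter] at hc ⊢
    exact ⟨hc.1, hc.2.trans h.le⟩
  · have := Finset.ext_iff.1 e (i', j)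
    simp only [Finset.mem_filter, Finset.mem_sdiff, YoungDiagram.mem_cells, hc, hc'] at this
    simp at this
    omega

theorem stripRank_pos {i j : ℕ} (hc : (i, j) ∈ ν) (hc' : (i, j) ∉ μ) : 0 < stripRank μ ν i :=
  Finset.card_pos.2 ⟨(i, j), by simp [hc, hc']⟩

theorem stripRank_le (h : μ ≤ ν) (i : ℕ) : stripRank μ ν i ≤ ν.card - μ.card :=
  (Finset.card_filter_le _ _).trans_eq
    (Finset.card_sdiff_of_subset (YoungDiagram.cells_subset_iff.2 h))

theorem IsVStrip.le (h : IsVStrip μ ν) : μ ≤ ν := le_of_rowLen_le fun i => (h i).1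

theorem IsVStrip.eq_rowLen (h : IsVStrip μ ν) {i j : ℕ} (hc : (i, j) ∈ ν) (hc' : (i, j) ∉ μ) :
    j = μ.rowLen i := by
  rw [YoungDiagram.mem_iff_lt_rowLen] at hc hc'
  have := h i
  omega

/-- Extend a tableau by a vertical strip, numbered from top to bottom. -/
def extendStrip (T : SemistandardYoungTableau μ) (h : IsVStrip μ ν) (m : ℕ)
    (hT : ∀ c ∈ μ, T c.1 c.2 ≤ m) : SemistandardYoungTableau ν :=
  extendTableau T ν (fun i _ => m + stripRank μ ν i)
    (fun {i j1 j2} hj h1 h2 => by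
      have := h.eq_rowLen h1 h2
      have h3 : (i, j1) ∈ μ := YoungDiagram.mem_iff_lt_rowLen.2 (by omega)
      rw [if_pos h3]
      exact (hT _ h3).trans (Nat.le_add_right _ _))
    (fun {i1 i2 j} hi h1 h2 => by
      split_ifs with h3
      · have := hT _ h3
        have := stripRank_pos h1 h2
        simp only at *
        omega
      · have := stripRank_lt hi h1 h2
        omega)
    h.le

theorem extendStrip_of_mem (T : SemistandardYoungTableau μ) (h : IsVStrip μ ν) (m : ℕ)
    (hT : ∀ c ∈ μ, T c.1 c.2 ≤ m) {i j : ℕ} (hc : (i, j) ∈ μ) :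
    extendStrip T h m hT i j = T i j := if_pos hc

theorem extendStrip_of_notMem (T : SemistandardYoungTableau μ) (h : IsVStrip μ ν) (m : ℕ)
    (hT : ∀ c ∈ μ, T c.1 c.2 ≤ m) {i j : ℕ} (hc : (i, j) ∉ μ) (hc' : (i, j) ∈ ν) :
    extendStrip T h m hT i j = m + stripRank μ ν i := (if_neg hc).trans (if_pos hc')

theorem isStandard_extendStrip {T : SemistandardYoungTableau μ} (hs : IsStandard T)
    (h : IsVStrip μ ν) :
    IsStandard (extendStrip T h μ.card fun _ hc => (hs.mapsTo hc).2) := by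
  have hle := h.card_le
  set E := extendStrip T h μ.card fun _ hc => (hs.mapsTo hc).2 with hE
  have h1 : ∀ {i j}, (i, j) ∈ μ → E i j = T i j := fun hc => extendStrip_of_mem _ _ _ _ hc
  have h2 : ∀ {i j}, (i, j) ∉ μ → (i, j) ∈ ν → E i j = μ.card + stripRank μ ν i :=
    fun hc hc' => extendStrip_of_notMem _ _ _ _ hc hc'
  refine isStandard_of_injOn ?_ ?_
  · rintro ⟨i, j⟩ hc
    simp only
    by_cases hμ : (i, j) ∈ μ
    · have := hs.mapsTo hμ
      simp only [Set.mem_Icc] at this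
      rw [h1 hμ]; omega
    · rw [h2 hμ hc]
      have := stripRank_pos hc hμ
      have := stripRank_le h.le i
      omega
  · rintro ⟨i, j⟩ hc ⟨i', j'⟩ hc' e
    simp only at e
    by_cases hμ : (i, j) ∈ μ <;> by_cases hμ' : (i', j') ∈ μ
    · rw [h1 hμ, h1 hμ'] at e
      exact hs.injOn hμ hμ' e
    · rw [h1 hμ, h2 hμ' hc'] at e
      have h3 := (hs.mapsTo hμ).2
      have h4 := stripRank_pos hc' hμ'
      simp only at h3
      omega
    · rw [h2 hμ hc, h1 hμ'] at e
      have h3 := (hs.mapsTo hμ').2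
      have h4 := stripRank_pos hc hμ
      simp only at h3
      omega
    · rw [h2 hμ hc, h2 hμ' hc'] at e
      have : i = i' := by
        rcases lt_trichotomy i i' with hlt | heq | hgt
        · have := stripRank_lt hlt hc' hμ'
          omega
        · exact heq
        · have := stripRank_lt hgt hc hμ
          omega
      subst this
      rw [h.eq_rowLen hc hμ, h.eq_rowLen hc' hμ']

/-- Old descents persist, and the new entries run downwards through distinct rows. The value a = |μ|
is left out: whether it is a descent depends on where the last old and the first new entry lie. -/
theorem mem_tableauDes_extendStrip {T : SemistandardYoungTableau μ} (hs : IsStandard T)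
    (h : IsVStrip μ ν) {a : ℕ} (ha : a ∈ tableauDes T ∨ μ.card < a) (ha' : a < ν.card) :
    a ∈ tableauDes (extendStrip T h μ.card fun _ hc => (hs.mapsTo hc).2) := by
  have hE := isStandard_extendStrip hs h
  set E := extendStrip T h μ.card fun _ hc => (hs.mapsTo hc).2
  have h1 : ∀ {i j}, (i, j) ∈ μ → E i j = T i j := fun hc => extendStrip_of_mem _ _ _ _ hc
  have h2 : ∀ {i j}, (i, j) ∉ μ → (i, j) ∈ ν → E i j = μ.card + stripRank μ ν i :=
    fun hc hc' => extendStrip_of_notMem _ _ _ _ hc hc'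
  rcases ha with ⟨⟨i, j⟩, hc, ⟨i', j'⟩, hc', e, e', hlt⟩ | ha
  · exact ⟨(i, j), h.le hc, (i', j'), h.le hc', (h1 hc).trans e, (h1 hc').trans e', hlt⟩
  · obtain ⟨⟨i, j⟩, hc, e⟩ := hE.surjOn (show a ∈ Set.Icc 1 ν.card from ⟨by omega, ha'.le⟩)
    obtain ⟨⟨i', j'⟩, hc', e'⟩ := hE.surjOn (show a + 1 ∈ Set.Icc 1 ν.card from ⟨by omega, ha'⟩)
    simp only at e e'
    have hbig : ∀ {i j}, (i, j) ∈ ν → μ.card < E i j → (i, j) ∉ μ := fun {i j} _ hlt hμ => by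
      have := (hs.mapsTo hμ).2
      rw [h1 hμ] at hlt
      simp only at this
      omega
    refine ⟨(i, j), hc, (i', j'), hc', e, e', ?_⟩
    rw [h2 (hbig hc (by omega)) hc] at e
    rw [h2 (hbig hc' (by omega)) hc'] at e'
    by_contra hcon
    have := stripRank_mono (μ := μ) (ν := ν) (not_lt.1 hcon)
    simp only at this
    omega

/-- If all numbers strictly between `m` and `|ν|` are descents, then larger entries above `m` are in
lower rows. -/
theorem row_lt_of_descents {T : SemistandardYoungTableau ν} (hs : IsStandard T) {m : ℕ}
    (hd : ∀ a, m < a → a < ν.card → a ∈ tableauDes T) {c c' : ℕ × ℕ} (hc : c ∈ ν) (hc' : c' ∈ ν)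
    (hm : m < T c.1 c.2) (hlt : T c.1 c.2 < T c'.1 c'.2) : c.1 < c'.1 := by
  obtain ⟨k, hk⟩ := Nat.exists_eq_add_of_lt hlt
  induction k generalizing c' with
  | zero =>
    have hle : T c'.1 c'.2 ≤ ν.card := (hs.mapsTo hc').2
    obtain ⟨x, hx, x', hx', e, e', h⟩ := hd _ hm (by omega)
    rw [← hs.injOn hx hc e, ← hs.injOn hx' hc' (e'.trans (by omega))]
    exact h
  | succ k ih =>
    have hle : T c'.1 c'.2 ≤ ν.card := (hs.mapsTo hc').2
    obtain ⟨x, hx, x', hx', e, e', h⟩ := hd (T c.1 c.2 + k + 1) (by omega) (by omega)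
    have h1 := ih hx (by omega) e
    rw [← hs.injOn hx' hc' (e'.trans (by omega))]
    exact h1.trans h

theorem card_filter_standard_le {T : SemistandardYoungTableau ν} (hs : IsStandard T) {m : ℕ}
    (hm : m ≤ ν.card) : (ν.cells.filter fun c => T c.1 c.2 ≤ m).card = m := by
  conv_rhs => rw [← Nat.add_sub_cancel (n := m) (m := 1), ← Nat.card_Icc]
  refine Finset.card_bij (fun c _ => T c.1 c.2) ?_ ?_ ?_
  · intro c hc
    rw [Finset.mem_filter] at hc
    exact Finset.mem_Icc.2 ⟨(hs.mapsTo hc.1).1, hc.2⟩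
  · intro c hc c' hc' e
    exact hs.injOn (Finset.mem_filter.1 hc).1 (Finset.mem_filter.1 hc').1 e
  · intro a ha
    rw [Finset.mem_Icc] at ha
    obtain ⟨c, hc, rfl⟩ := hs.surjOn (show a ∈ Set.Icc 1 ν.card from ⟨ha.1, ha.2.trans hm⟩)
    exact ⟨c, Finset.mem_filter.2 ⟨hc, ha.2⟩, rfl⟩

open scoped Classical in
-- Descents at all numbers strictly between m and m + r force the last r entries into successively
-- lower rows. They thus form a vertical strip with a unique numbering, and the tableau is
-- determined by its restriction to 1, …, m. As m ∉ B, nothing is required where the two pieces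
-- meet.
theorem card_standardWithDescents (B : Set ℕ) (m r K : ℕ) (hν : ν.card = m + r) (hm : m ∉ B)
    (hB : ∀ x, m < x → x < m + r → x ∈ B) (hK : m ≤ K) :
    Nat.card (StandardWithDescents ν B) =
      ∑ μ ∈ diagramsUpTo K with IsVStrip μ ν ∧ μ.card = m, Nat.card (StandardWithDescents μ B) := by
  set F := (diagramsUpTo K).filter fun μ => IsVStrip μ ν ∧ μ.card = m with hF
  have hFmem : ∀ μ : F, IsVStrip μ.1 ν ∧ μ.1.card = m := fun μ => (Finset.mem_filter.1 μ.2).2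
  let e : (Σ μ : F, StandardWithDescents μ.1 B) → StandardWithDescents ν B := fun x =>
    ⟨extendStrip x.2.1 (hFmem x.1).1 _ fun c hc => (x.2.2.1.mapsTo hc).2,
      isStandard_extendStrip x.2.2.1 _, fun a ha ha' => mem_tableauDes_extendStrip x.2.2.1 (hFmem x.1).1 (by
        have h1 := (hFmem x.1).2
        by_cases h : a < x.1.1.card
        · exact .inl (x.2.2.2 a ha h)
        · have : a ≠ m := fun h => hm (h ▸ ha)
          exact .inr (by omega)) ha'⟩
  have he1 : ∀ x i j, (i, j) ∈ x.1.1 → (e x).1 i j = x.2.1 i j := fun x _ _ hc =>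
    extendStrip_of_mem x.2.1 (hFmem x.1).1 _ (fun _ hc => (x.2.2.1.mapsTo hc).2) hc
  have he2 : ∀ x i j, (i, j) ∉ x.1.1 → (i, j) ∈ ν → (e x).1 i j = m + stripRank x.1.1 ν i :=
    fun x _ _ hc hc' => (extendStrip_of_notMem x.2.1 (hFmem x.1).1 _
      (fun _ hc => (x.2.2.1.mapsTo hc).2) hc hc').trans (by rw [(hFmem x.1).2])
  have hbij : Function.Bijective e := by
    constructor
    · have hrec : ∀ x c, c ∈ x.1.1 ↔ c ∈ ν ∧ (e x).1 c.1 c.2 ≤ m := by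
        rintro x ⟨i, j⟩
        by_cases h : (i, j) ∈ x.1.1
        · have h1 := (x.2.2.1.mapsTo h).2.trans_eq (hFmem x.1).2
          simp only [h, true_iff, he1 x i j h]
          exact ⟨(hFmem x.1).1.le h, h1⟩
        · simp only [h, false_iff]
          rintro ⟨h1, h2⟩
          rw [he2 x i j h h1] at h2
          have := stripRank_pos h1 h
          omega
      rintro ⟨⟨κ, hκ⟩, T⟩ ⟨⟨κ', hκ'⟩, T'⟩ h
      have hκκ : κ = κ' := by
        ext c
        rw [YoungDiagram.mem_cells, YoungDiagram.mem_cells, hrec ⟨⟨κ, hκ⟩, T⟩,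
          hrec ⟨⟨κ', hκ'⟩, T'⟩, h]
      subst hκκ
      have : T = T' := by
        refine Subtype.ext (SemistandardYoungTableau.ext fun i j => ?_)
        by_cases hc : (i, j) ∈ κ
        · have h1 := he1 ⟨⟨κ, hκ⟩, T⟩ i j hc
          have h2 := he1 ⟨⟨κ, hκ'⟩, T'⟩ i j hc
          rw [h] at h1
          exact h1.symm.trans h2
        · rw [T.1.zeros hc, T'.1.zeros hc]
      subst this
      rfl
    · rintro ⟨T, hs, hT⟩
      have hd : ∀ a, m < a → a < ν.card → a ∈ tableauDes T := fun a h1 h2 =>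
        hT a (hB a h1 (hν ▸ h2)) h2
      set κ := belowDiagram T (m + 1) with hκ
      have hmem : ∀ c, c ∈ κ ↔ c ∈ ν ∧ T c.1 c.2 ≤ m := fun c => by
        rw [hκ, mem_belowDiagram, Nat.lt_succ_iff]
      have hcard : κ.card = m := by
        rw [← card_filter_standard_le hs (show m ≤ ν.card by omega), YoungDiagram.card]
        congr 1
        ext c
        rw [YoungDiagram.mem_cells, hmem, Finset.mem_filter, YoungDiagram.mem_cells]
      have hV : IsVStrip κ ν := by
        intro i
        refine ⟨le_of_forall_lt fun j hj => ?_, ?_⟩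
        · rw [← YoungDiagram.mem_iff_lt_rowLen] at hj ⊢
          exact ((hmem _).1 hj).1
        · by_contra hcon
          have h1 : (i, κ.rowLen i) ∈ ν := YoungDiagram.mem_iff_lt_rowLen.2 (by omega)
          have h2 : (i, κ.rowLen i + 1) ∈ ν := YoungDiagram.mem_iff_lt_rowLen.2 (by omega)
          have h3 : (i, κ.rowLen i) ∉ κ := by rw [YoungDiagram.mem_iff_lt_rowLen]; omega
          have h4 : m < T i (κ.rowLen i) := by
            rw [hmem] at h3
            by_contra hc
            exact h3 ⟨h1, not_lt.1 hc⟩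
          have h5 := T.row_weak (Nat.lt_succ_self (κ.rowLen i)) h2
          rcases h5.eq_or_lt with h6 | h6
          · have := hs.injOn h1 h2 h6
            simp at this
          · exact lt_irrefl i (row_lt_of_descents hs hd h1 h2 h4 h6)
      have happ : ∀ i j, restrictBelow T (m + 1) i j = if (i, j) ∈ κ then T i j else 0 :=
        restrictBelow_apply T (m + 1)
      have hs' : IsStandard (restrictBelow T (m + 1)) := by
        refine isStandard_of_injOn ?_ ?_
        · rintro ⟨i, j⟩ hc
          have h1 := (hmem _).1 hc
          rw [happ, if_pos hc, ← hκ, hcard]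
          exact ⟨(hs.mapsTo h1.1).1, h1.2⟩
        · rintro ⟨i, j⟩ hc ⟨i', j'⟩ hc' e
          rw [happ, happ, if_pos hc, if_pos hc'] at e
          exact hs.injOn ((hmem _).1 hc).1 ((hmem _).1 hc').1 e
      have hT' : ∀ a ∈ B, a < κ.card → a ∈ tableauDes (restrictBelow T (m + 1)) := by
        intro a ha ha'
        obtain ⟨⟨i, j⟩, hc, ⟨i', j'⟩, hc', e, e', hlt⟩ := hT a ha (by omega)
        simp only at e e'
        have h1 : (i, j) ∈ κ := (hmem _).2 ⟨hc, by simp only; omega⟩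
        have h2 : (i', j') ∈ κ := (hmem _).2 ⟨hc', by simp only; omega⟩
        refine ⟨(i, j), h1, (i', j'), h2, ?_, ?_, hlt⟩
        · rw [happ, if_pos h1, e]
        · rw [happ, if_pos h2, e']
      refine ⟨⟨⟨κ, Finset.mem_filter.2 ⟨mem_diagramsUpTo.2 (hcard.trans_le hK), hV, hcard⟩⟩,
        ⟨restrictBelow T (m + 1), hs', hT'⟩⟩, ?_⟩
      refine Subtype.ext (SemistandardYoungTableau.ext fun i j => ?_)
      by_cases h1 : (i, j) ∈ κ
      · rw [he1 _ i j h1]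
        exact (happ i j).trans (if_pos h1)
      by_cases h2 : (i, j) ∈ ν
      · rw [he2 _ i j h1 h2]
        have h3 : m < T i j := by
          rw [hmem] at h1
          by_contra hc
          exact h1 ⟨h2, not_lt.1 hc⟩
        have h4 := (hs.mapsTo h2).2
        simp only at h4
        -- Among the entries above `m`, lying in a row up to `i` is the same as being at most T(i,
        -- j). So the rank of the cell in the strip is T(i, j) − m.
        have h5 : ((ν.cells \ κ.cells).filter fun c => c.1 ≤ i) =
            (ν.cells.filter fun c => T c.1 c.2 ≤ T i j) \ (ν.cells.filter fun c => T c.1 c.2 ≤ m) := by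
          ext c
          simp only [Finset.mem_filter, Finset.mem_sdiff, YoungDiagram.mem_cells, hmem]
          constructor
          · rintro ⟨⟨h6, h7⟩, h8⟩
            refine ⟨⟨h6, ?_⟩, h7⟩
            by_contra hcon
            have := row_lt_of_descents hs hd (c := (i, j)) h2 h6 h3 (not_le.1 hcon)
            simp only at this
            omega
          · rintro ⟨⟨h6, h7⟩, h8⟩
            refine ⟨⟨h6, h8⟩, ?_⟩
            have h9 : m < T c.1 c.2 := by
              by_contra hc
              exact h8 ⟨h6, not_lt.1 hc⟩
            rcases h7.eq_or_lt with h10 | h10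
            · have := hs.injOn h6 h2 h10
              rw [this]
            · exact (row_lt_of_descents hs hd (c' := (i, j)) h6 h2 h9 h10).le
        simp only [stripRank]
        rw [h5, Finset.card_sdiff_of_subset, card_filter_standard_le hs h4,
          card_filter_standard_le hs (by omega)]
        · omega
        · intro c hc
          rw [Finset.mem_filter] at hc ⊢
          exact ⟨hc.1, hc.2.trans h3.le⟩
      · rw [SemistandardYoungTableau.zeros _ h2, SemistandardYoungTableau.zeros _ h2]
  rw [← Nat.card_congr (Equiv.ofBijective e hbij), Nat.card_sigma]
  exact Finset.sum_coe_sort F fun μ => Nat.card (StandardWithDescents μ B)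

/-- The generating function of the standard tableaux of size `m` with descents at `B`. -/
noncomputable def descentSeries (B : Set ℕ) (m : ℕ) : MvPowerSeries ℕ ℂ :=
  ∑ ν : PartitionOf m, Nat.card (StandardWithDescents ν.1 B) • schur ν.1

/-- Stripping off the last `r` entries matches the dual Pieri rule term by term. Only elements of
`B` below the size impose a condition, so one set `B` serves all stages of the construction. -/
theorem descentSeries_add (B : Set ℕ) (m r : ℕ) (hm : m ∉ B)
    (hB : ∀ x, m < x → x < m + r → x ∈ B) :
    descentSeries B (m + r) = elemSymm r * descentSeries B m := by
  classical
  rw [descentSeries, descentSeries, sum_partitionOf le_rfl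
    (fun ν => Nat.card (StandardWithDescents ν B) • schur ν), sum_partitionOf (Nat.le_add_right m r)
    (fun ν => Nat.card (StandardWithDescents ν B) • schur ν), Finset.mul_sum]
  have h1 : ∀ ν ∈ (diagramsUpTo (m + r)).filter fun ν => ν.card = m + r,
      Nat.card (StandardWithDescents ν B) • schur ν =
      ∑ μ ∈ diagramsUpTo (m + r), if IsVStrip μ ν ∧ μ.card = m then
        Nat.card (StandardWithDescents μ B) • schur ν else 0 := by
    intro ν hν
    rw [card_standardWithDescents B m r (m + r) (Finset.mem_filter.1 hν).2 hm hB
      (Nat.le_add_right m r), Finset.sum_smul, Finset.sum_filter]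
  have h2 : ∀ μ ∈ (diagramsUpTo (m + r)).filter fun μ => μ.card = m,
      elemSymm r * Nat.card (StandardWithDescents μ B) • schur μ =
      ∑ ν ∈ diagramsUpTo (m + r), if IsVStrip μ ν ∧ ν.card = m + r then
        Nat.card (StandardWithDescents μ B) • schur ν else 0 := by
    intro μ hμ
    have hμ' := (Finset.mem_filter.1 hμ).2
    rw [mul_smul_comm, elemSymm_mul_schur μ r (m + r) (by omega) (by push_cast; omega),
      Finset.smul_sum, Finset.sum_filter]
    refine Finset.sum_congr rfl fun ν _ => if_congr (and_congr_right fun _ => ?_) rfl rfl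
    rw [hμ']; norm_cast
  rw [Finset.sum_congr rfl h1, Finset.sum_congr rfl h2, Finset.sum_filter, Finset.sum_filter]
  simp_rw [Finset.ite_sum_zero]
  rw [Finset.sum_comm]
  refine Finset.sum_congr rfl fun μ _ => Finset.sum_congr rfl fun ν _ => ?_
  rw [← ite_and, ← ite_and]
  exact if_congr (by tauto) rfl rfl

theorem descentSeries_zero (B : Set ℕ) : descentSeries B 0 = 1 := by
  have hempty : ∀ ν : YoungDiagram, ν.card = 0 → ∀ c, c ∉ ν := fun ν h c hc => by
    rw [YoungDiagram.card, Finset.card_eq_zero] at h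
    have : c ∈ ν.cells := hc
    simp [h] at this
  have huniq : ∀ ν : PartitionOf 0, ν = ⟨⊥, rfl⟩ := fun ν => Subtype.ext (by
    ext c
    rw [YoungDiagram.mem_cells]
    simp [hempty ν.1 ν.2 c])
  have hext : ∀ T T' : SemistandardYoungTableau ⊥, T = T' := fun T T' =>
    SemistandardYoungTableau.ext fun i j => by
      rw [T.zeros (YoungDiagram.notMem_bot _), T'.zeros (YoungDiagram.notMem_bot _)]
  rw [descentSeries, Finset.sum_eq_single (⟨⊥, rfl⟩ : PartitionOf 0)
    (fun ν _ h => absurd (huniq ν) h) (fun h => absurd (Finset.mem_univ _) h)]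
  have h1 : Nat.card (StandardWithDescents ⊥ B) = 1 := by
    rw [Nat.card_eq_one_iff_unique]
    refine ⟨⟨fun T T' => Subtype.ext (hext _ _)⟩, ⟨⟨default, ?_, fun a _ h => absurd h (Nat.not_lt_zero _)⟩⟩⟩
    exact isStandard_of_injOn (fun c hc => absurd hc (YoungDiagram.notMem_bot c))
      (fun c hc => absurd hc (YoungDiagram.notMem_bot c))
  have h2 : schur ⊥ = 1 := by
    classical
    ext δ
    rw [coeff_schur, MvPowerSeries.coeff_one]
    split_ifs with h
    · rw [Nat.cast_eq_one, Nat.card_eq_one_iff_unique]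
      exact ⟨⟨fun T T' => Subtype.ext (hext _ _)⟩, ⟨⟨default, fun v => by simp [h]⟩⟩⟩
    · rw [Nat.cast_eq_zero, Nat.card_eq_zero]
      refine .inl ⟨fun T => h (Finsupp.ext fun v => ?_)⟩
      rw [← T.2 v]; simp
  rw [h1, one_smul, h2]

end Standard

/-! ### Ribbons -/

namespace SkewShape
variable {R : SkewShape}

theorem mem_cells_iff {i j : ℕ} :
    (i, j) ∈ R.cells ↔ R.inner.rowLen i ≤ j ∧ j < R.outer.rowLen i := by
  rw [cells, Finset.mem_sdiff, YoungDiagram.mem_cells, YoungDiagram.mem_cells,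
    YoungDiagram.mem_iff_lt_rowLen, YoungDiagram.mem_iff_lt_rowLen, not_lt, and_comm]

theorem inner_rowLen_le (R : SkewShape) (i : ℕ) : R.inner.rowLen i ≤ R.outer.rowLen i := by
  refine le_of_forall_lt fun j hj => ?_
  rw [← YoungDiagram.mem_iff_lt_rowLen] at hj ⊢
  exact R.inner_le hj

theorem outer_succ_le (R : SkewShape) (i : ℕ) : R.outer.rowLen (i + 1) ≤ R.outer.rowLen i :=
  R.outer.rowLen_anti _ _ (Nat.le_succ i)

theorem inner_succ_le (R : SkewShape) (i : ℕ) : R.inner.rowLen (i + 1) ≤ R.inner.rowLen i :=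
  R.inner.rowLen_anti _ _ (Nat.le_succ i)

theorem outer_rowLen_eq_zero {i : ℕ} (h : R.length ≤ i) : R.outer.rowLen i = 0 := by
  by_contra hc
  have h1 : (i, 0) ∈ R.outer := YoungDiagram.mem_iff_lt_rowLen.2 (Nat.pos_of_ne_zero hc)
  rw [YoungDiagram.mem_iff_lt_colLen] at h1
  exact absurd h (not_le.2 h1)

/-- An element of `innerRows` is a cut with cells on both sides: being one-based, `i` lies between
the zero-based rows i − 1 and i. -/
theorem mem_innerRows_iff {i : ℕ} : i ∈ R.innerRows ↔
    (∃ a, a < i ∧ R.inner.rowLen a < R.outer.rowLen a) ∧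
      ∃ b, i ≤ b ∧ R.inner.rowLen b < R.outer.rowLen b := by
  have hbdd : BddAbove R.rows := ⟨R.length, fun j hj => by
    by_contra hc
    have h1 := hj.2
    rw [outer_rowLen_eq_zero (i := j - 1) (by omega)] at h1
    omega⟩
  rw [innerRows, Finset.mem_Ico, firstRow, lastRow]
  constructor
  · rintro ⟨h1, h2⟩
    -- For the empty shape the supremum has the default value 0, and no index lies below it.
    have hne : R.rows.Nonempty := by
      by_contra hc
      rw [Set.not_nonempty_iff_eq_empty.1 hc, csSup_empty] at h2
      exact absurd h2 (Nat.not_lt_zero _)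
    have ha := Nat.sInf_mem hne
    have hb := Nat.sSup_mem hne hbdd
    exact ⟨⟨_, by have := ha.1; omega, ha.2⟩, ⟨_, by omega, hb.2⟩⟩
  · rintro ⟨⟨a, ha, ha'⟩, ⟨b, hb, hb'⟩⟩
    have h1 : sInf R.rows ≤ a + 1 := Nat.sInf_le (show a + 1 ∈ R.rows from ⟨by omega, ha'⟩)
    have h2 : b + 1 ≤ sSup R.rows := le_csSup hbdd (show b + 1 ∈ R.rows from ⟨by omega, hb'⟩)
    omega

theorem outer_succ_le_inner {j : ℕ} (h : j + 1 ∉ R.innerRows) :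
    R.outer.rowLen (j + 1) ≤ R.inner.rowLen j := by
  by_contra hc
  have h1 := R.outer_succ_le j
  have h2 := R.inner_succ_le j
  exact h (mem_innerRows_iff.2 ⟨⟨j, by omega, by omega⟩, ⟨j + 1, le_rfl, by omega⟩⟩)

/-- A path from a cell above the cut to a cell below it has a vertical step across the cut, so the
rows `j` and `j + 1` share a column. -/
theorem inner_lt_outer_of_connected
    (hR : ((SimpleGraph.hasse (ℕ × ℕ)).induce (R.cells : Set (ℕ × ℕ))).Preconnected) {j : ℕ}
    (h : j + 1 ∈ R.innerRows) : R.inner.rowLen j < R.outer.rowLen (j + 1) := by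
  obtain ⟨⟨a, ha, ha'⟩, ⟨b, hb, hb'⟩⟩ := mem_innerRows_iff.1 h
  by_contra hc
  have hu : (a, R.inner.rowLen a) ∈ R.cells := mem_cells_iff.2 ⟨le_rfl, ha'⟩
  have hv : (b, R.inner.rowLen b) ∈ R.cells := mem_cells_iff.2 ⟨le_rfl, hb'⟩
  obtain ⟨w⟩ := hR ⟨_, hu⟩ ⟨_, hv⟩
  have key : ∀ (u v : (R.cells : Set (ℕ × ℕ))),
      ((SimpleGraph.hasse (ℕ × ℕ)).induce (R.cells : Set (ℕ × ℕ))).Walk u v →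
      u.1.1 ≤ j → v.1.1 ≤ j := by
    intro u v w
    induction w with
    | nil => exact id
    | @cons u v _ hadj _ ih =>
      refine fun hu => ih ?_
      obtain ⟨⟨i1, j1⟩, h1⟩ := u
      obtain ⟨⟨i2, j2⟩, h2⟩ := v
      have h1' := mem_cells_iff.1 h1
      have h2' := mem_cells_iff.1 h2
      simp only at hu ⊢
      have hadj' : (SimpleGraph.hasse (ℕ × ℕ)).Adj (i1, j1) (i2, j2) := hadj
      rw [SimpleGraph.hasse_adj, Prod.mk_covBy_mk_iff, Prod.mk_covBy_mk_iff] at hadj'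
      simp only [Order.covBy_iff_add_one_eq] at hadj'
      by_contra hcon
      obtain ⟨rfl, rfl⟩ : i1 = j ∧ i2 = j + 1 := by omega
      omega
  have := key _ _ w (show a ≤ j by omega)
  simp only at this
  omega

/-- Connectedness gives at least one common column of adjacent rows, and the absence of a 2 × 2
block at most one. -/
theorem IsRibbon.outer_succ_eq (hR : R.IsRibbon) {j : ℕ} (h : j + 1 ∈ R.innerRows) :
    R.outer.rowLen (j + 1) = R.inner.rowLen j + 1 := by
  have h1 := inner_lt_outer_of_connected hR.1 h
  by_contra hc
  have h2 := R.outer_succ_le j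
  have h3 := R.inner_succ_le j
  exact hR.2 ⟨j, R.inner.rowLen j, mem_cells_iff.2 ⟨by omega, by omega⟩,
    mem_cells_iff.2 ⟨by omega, by omega⟩, mem_cells_iff.2 ⟨by omega, by omega⟩,
    mem_cells_iff.2 ⟨by omega, by omega⟩⟩

theorem pos_of_mem_innerRows {i : ℕ} (h : i ∈ R.innerRows) : 0 < i := by
  obtain ⟨⟨a, ha, -⟩, -⟩ := mem_innerRows_iff.1 h
  omega

theorem lt_length_of_mem_innerRows {i : ℕ} (h : i ∈ R.innerRows) : i < R.length := by
  obtain ⟨-, ⟨b, hb, hb'⟩⟩ := mem_innerRows_iff.1 h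
  by_contra hc
  rw [outer_rowLen_eq_zero (by omega)] at hb'
  omega

/-- The number of cells in the first `i` rows. -/
def prefixSize (R : SkewShape) (i : ℕ) : ℕ := ∑ j ∈ Finset.range i, R.rowSize j

theorem prefixSize_succ (i : ℕ) : R.prefixSize (i + 1) = R.prefixSize i + R.rowSize i :=
  Finset.sum_range_succ _ _

theorem prefixSize_mono : Monotone R.prefixSize :=
  monotone_nat_of_le_succ fun i => by rw [prefixSize_succ]; omega

theorem card_filter_row_lt (R : SkewShape) (i : ℕ) :
    (R.cells.filter fun c => c.1 < i).card = R.prefixSize i := by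
  rw [prefixSize, Finset.card_eq_sum_card_fiberwise (f := Prod.fst) (t := Finset.range i)]
  · refine Finset.sum_congr rfl fun k hk => ?_
    rw [Finset.mem_range] at hk
    have : ((R.cells.filter fun c => c.1 < i).filter fun c => c.1 = k) =
        {k} ×ˢ Finset.Ico (R.inner.rowLen k) (R.outer.rowLen k) := by
      ext ⟨a, b⟩
      simp only [Finset.mem_filter, Finset.mem_product, Finset.mem_singleton, Finset.mem_Ico,
        mem_cells_iff]
      constructor
      · rintro ⟨⟨h1, h2⟩, rfl⟩
        exact ⟨rfl, h1⟩
      · rintro ⟨rfl, h1⟩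
        exact ⟨⟨h1, hk⟩, rfl⟩
    rw [this, Finset.card_product, Finset.card_singleton, one_mul, Nat.card_Ico, rowSize]
  · intro c hc
    simp only [Finset.coe_filter, Set.mem_ofPred_eq] at hc
    simpa using hc.2

theorem prefixSize_eq_size {i : ℕ} (h : ∀ b, i ≤ b → ¬ R.inner.rowLen b < R.outer.rowLen b) :
    R.prefixSize i = R.size := by
  rw [← card_filter_row_lt, size, Finset.filter_true_of_mem]
  rintro ⟨a, b⟩ hc
  have := mem_cells_iff.1 hc
  by_contra hcon
  exact h a (not_lt.1 hcon) (by omega)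

theorem prefixSize_of_length_le {n : ℕ} (h : R.length ≤ n) : R.prefixSize n = R.size :=
  prefixSize_eq_size fun b hb => by rw [outer_rowLen_eq_zero (h.trans hb)]; omega

theorem prefixSize_le_size (i : ℕ) : R.prefixSize i ≤ R.size := by
  rw [← card_filter_row_lt, size]
  exact Finset.card_filter_le _ _

theorem prefixSize_eq_zero {i : ℕ} (h : ∀ a, a < i → ¬ R.inner.rowLen a < R.outer.rowLen a) :
    R.prefixSize i = 0 :=
  Finset.sum_eq_zero fun a ha => by
    have := h a (Finset.mem_range.1 ha)
    rw [rowSize]; omega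

/-- Such a cut has no cells above it or none below it. Its prefix size is therefore outside [1,
m−1]. -/
theorem prefixSize_of_notMem_innerRows {i : ℕ} (h : i ∉ R.innerRows) :
    R.prefixSize i = 0 ∨ R.prefixSize i = R.size := by
  rw [mem_innerRows_iff, not_and_or] at h
  push Not at h
  rcases h with h | h
  · exact .inl (prefixSize_eq_zero fun a ha => not_lt.2 (h a ha))
  · exact .inr (prefixSize_eq_size fun a ha => not_lt.2 (h a ha))

/-- Row `i` overlaps the row above it and hence is not empty; this makes the prefix sizes of
different inner cuts distinct. -/
theorem IsRibbon.prefixSize_lt_succ (hR : R.IsRibbon) {i : ℕ} (h : i ∈ R.innerRows) :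
    R.prefixSize i < R.prefixSize (i + 1) := by
  rw [prefixSize_succ, rowSize]
  obtain ⟨j, rfl⟩ := Nat.exists_eq_succ_of_ne_zero (pos_of_mem_innerRows h).ne'
  have h1 := hR.outer_succ_eq h
  have h2 := R.inner_succ_le j
  simp only [Nat.succ_eq_add_one]
  omega

theorem IsRibbon.prefixSize_lt (hR : R.IsRibbon) {i i' : ℕ} (h : i ∈ R.innerRows) (hlt : i < i') :
    R.prefixSize i < R.prefixSize i' :=
  (hR.prefixSize_lt_succ h).trans_le (prefixSize_mono hlt)

theorem IsRibbon.prefixSize_inj (hR : R.IsRibbon) {i i' : ℕ} (h : i ∈ R.innerRows) (h' : i' ∈ R.innerRows)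
    (e : R.prefixSize i = R.prefixSize i') : i = i' := by
  rcases lt_trichotomy i i' with hlt | heq | hgt
  · exact absurd e (hR.prefixSize_lt h hlt).ne
  · exact heq
  · exact absurd e (hR.prefixSize_lt h' hgt).ne'

theorem IsRibbon.prefixSize_mem (hR : R.IsRibbon) {i : ℕ} (h : i ∈ R.innerRows) :
    R.prefixSize i ∈ Finset.Icc 1 (R.size - 1) := by
  have h1 := (hR.prefixSize_lt_succ h).trans_le (prefixSize_le_size (i + 1))
  obtain ⟨⟨a, ha, ha'⟩, -⟩ := mem_innerRows_iff.1 h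
  have h2 : R.prefixSize (a + 1) ≤ R.prefixSize i := prefixSize_mono ha
  rw [prefixSize_succ, rowSize] at h2
  rw [Finset.mem_Icc]
  omega

theorem label_eq {i j : ℕ} (h : (i, j) ∈ R.cells) :
    R.label (i, j) = R.prefixSize i + (R.outer.rowLen i - j) := by
  have h1 := mem_cells_iff.1 h
  have h2 : (R.cells.filter fun c' => c'.1 < (i, j).1 ∨ (c'.1 = (i, j).1 ∧ (i, j).2 ≤ c'.2)) =
      (R.cells.filter fun c => c.1 < i) ∪ {i} ×ˢ Finset.Ico j (R.outer.rowLen i) := by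
    ext ⟨a, b⟩
    simp only [Finset.mem_filter, Finset.mem_union, Finset.mem_product, Finset.mem_singleton,
      Finset.mem_Ico, mem_cells_iff]
    constructor
    · rintro ⟨h3, h4 | ⟨rfl, h4⟩⟩
      · exact .inl ⟨h3, h4⟩
      · exact .inr ⟨rfl, h4, h3.2⟩
    · rintro (⟨h3, h4⟩ | ⟨rfl, h4, h5⟩)
      · exact ⟨h3, .inl h4⟩
      · exact ⟨⟨by omega, h5⟩, .inr ⟨rfl, h4⟩⟩
  rw [label, h2, Finset.card_union_of_disjoint, card_filter_row_lt, Finset.card_product,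
    Finset.card_singleton, one_mul, Nat.card_Ico]
  rw [Finset.disjoint_left]
  rintro ⟨a, b⟩ h3 h4
  simp only [Finset.mem_filter, Finset.mem_product, Finset.mem_singleton] at h3 h4
  omega

/-- A vertical step joins the leftmost cell of one row to the rightmost cell of the next, and the
label of the former is the number of cells down to its row. -/
theorem IsRibbon.des_eq (hR : R.IsRibbon) : R.des = R.innerRows.image R.prefixSize := by
  ext x
  rw [des, Finset.mem_filter, Finset.mem_image]
  constructor
  · rintro ⟨-, ⟨i, j⟩, hc, hc', hl, -⟩
    have h1 := mem_cells_iff.1 hc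
    have h2 : R.inner.rowLen (i + 1) ≤ j ∧ j < R.outer.rowLen (i + 1) := mem_cells_iff.1 hc'
    have h3 : i + 1 ∈ R.innerRows :=
      mem_innerRows_iff.2 ⟨⟨i, by omega, by omega⟩, ⟨i + 1, le_rfl, by omega⟩⟩
    refine ⟨i + 1, h3, ?_⟩
    have h4 := hR.outer_succ_eq h3
    rw [label_eq hc] at hl
    rw [prefixSize_succ, rowSize, ← hl]
    omega
  · rintro ⟨i, hi, rfl⟩
    refine ⟨hR.prefixSize_mem hi, ?_⟩
    obtain ⟨j, rfl⟩ := Nat.exists_eq_succ_of_ne_zero (pos_of_mem_innerRows hi).ne'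
    have h1 := hR.outer_succ_eq hi
    have h2 := R.inner_succ_le j
    have h3 := R.outer_succ_le j
    have hc : (j, R.inner.rowLen j) ∈ R.cells := mem_cells_iff.2 ⟨le_rfl, by omega⟩
    have hc' : (j + 1, R.inner.rowLen j) ∈ R.cells := mem_cells_iff.2 ⟨h2, by omega⟩
    refine ⟨_, hc, hc', ?_, ?_⟩
    · rw [label_eq hc, prefixSize_succ, rowSize]
    · rw [label_eq hc', h1]
      simp only [Nat.succ_eq_add_one]
      omega

/-! ### The sets NDes(R) ∪ d(J, R) -/

theorem d_eq (J : Finset ℕ) : d J R = J.image R.prefixSize := rfl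

theorem IsRibbon.mem_ndes_iff (hR : R.IsRibbon) {x : ℕ} : x ∈ R.ndes ↔ x ∈ Finset.Icc 1 (R.size - 1) ∧
    ∀ i ∈ R.innerRows, R.prefixSize i ≠ x := by
  rw [ndes, Finset.mem_sdiff, hR.des_eq, Finset.mem_image]
  push Not
  rfl

theorem IsRibbon.prefixSize_mem_iff (hR : R.IsRibbon) {J : Finset ℕ} (hJ : J ⊆ R.innerRows) {i : ℕ}
    (hi : i ∈ R.innerRows) : R.prefixSize i ∈ R.ndes ∪ d J R ↔ i ∈ J := by
  rw [Finset.mem_union, hR.mem_ndes_iff, d_eq, Finset.mem_image]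
  constructor
  · rintro (⟨-, h⟩ | ⟨i', h, e⟩)
    · exact absurd rfl (h i hi)
    · rwa [← hR.prefixSize_inj (hJ h) hi e]
  · exact fun h => .inr ⟨i, h, rfl⟩

theorem IsRibbon.ndes_union_d_injective (hR : R.IsRibbon) {J J' : Finset ℕ} (hJ : J ⊆ R.innerRows)
    (hJ' : J' ⊆ R.innerRows) (h : R.ndes ∪ d J R = R.ndes ∪ d J' R) : J = J' := by
  ext i
  constructor
  · intro hi
    rwa [← hR.prefixSize_mem_iff hJ' (hJ hi), ← h, hR.prefixSize_mem_iff hJ (hJ hi)]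
  · intro hi
    rwa [← hR.prefixSize_mem_iff hJ (hJ' hi), h, hR.prefixSize_mem_iff hJ' (hJ' hi)]

theorem IsRibbon.ndes_union_d_subset (hR : R.IsRibbon) {J : Finset ℕ} (hJ : J ⊆ R.innerRows) :
    R.ndes ∪ d J R ⊆ Finset.Icc 1 (R.size - 1) := by
  refine Finset.union_subset (Finset.sdiff_subset) fun x hx => ?_
  obtain ⟨i, hi, rfl⟩ := Finset.mem_image.1 hx
  exact hR.prefixSize_mem (hJ hi)

/-- The elements of [m−1] outside NDes(R) are the prefix sizes of the inner cuts, so `J` records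
which of them lie in `A`. -/
theorem IsRibbon.exists_eq_ndes_union_d (hR : R.IsRibbon) {A : Set ℕ} (hA : A ⊆ Finset.Icc 1 (R.size - 1))
    (h : (R.ndes : Set ℕ) ⊆ A) : ∃ J ⊆ R.innerRows, A = ((R.ndes ∪ d J R : Finset ℕ) : Set ℕ) := by
  classical
  refine ⟨R.innerRows.filter fun i => R.prefixSize i ∈ A, Finset.filter_subset _ _, ?_⟩
  ext x
  rw [Finset.coe_union, Set.mem_union, d_eq, Finset.coe_image, Set.mem_image]
  constructor
  · intro hx
    by_cases hx' : ∃ i ∈ R.innerRows, R.prefixSize i = x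
    · obtain ⟨i, hi, rfl⟩ := hx'
      exact .inr ⟨i, Finset.mem_filter.2 ⟨hi, hx⟩, rfl⟩
    · push Not at hx'
      exact .inl (hR.mem_ndes_iff.2 ⟨hA hx, hx'⟩)
  · rintro (hx | ⟨i, hi, rfl⟩)
    · exact h hx
    · exact (Finset.mem_filter.1 hi).2

end SkewShape

theorem tableauDes_subset {ν : YoungDiagram} {T : SemistandardYoungTableau ν} (hs : IsStandard T) :
    tableauDes T ⊆ Finset.Icc 1 (ν.card - 1) := by
  rintro a ⟨c, hc, c', hc', e, e', -⟩
  have h1 : 1 ≤ T c.1 c.2 := (hs.mapsTo hc).1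
  have h2 : T c'.1 c'.2 ≤ ν.card := (hs.mapsTo hc').2
  rw [Finset.coe_Icc, Set.mem_Icc]
  omega

open SkewShape in
-- A descent set containing NDes(R) has the form NDes(R) ∪ d(J, R) for a unique `J`, and it contains
-- d(S, R) exactly if S ⊆ J. So the tableaux are sorted by their exact descent set.
theorem card_standardWithDescents_ribbon {R : SkewShape} (hR : R.IsRibbon) {S : Finset ℕ}
    (hS : S ⊆ R.innerRows) (ν : PartitionOf R.size) :
    Nat.card (StandardWithDescents ν.1 (R.ndes ∪ d S R : Finset ℕ)) =
      ∑ J ∈ R.innerRows.powerset with S ⊆ J, sytCount ν.1 (R.ndes ∪ d J R) := by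
  obtain ⟨ν, hν⟩ := ν
  set F := R.innerRows.powerset.filter fun J => S ⊆ J with hF
  have hFmem : ∀ J : F, J.1 ⊆ R.innerRows ∧ S ⊆ J := fun J => by
    rw [← Finset.mem_powerset, ← Finset.mem_filter]
    exact J.2
  let e : (Σ J : F, {T : SemistandardYoungTableau ν // IsStandard T ∧
      tableauDes T = ((R.ndes ∪ d J.1 R : Finset ℕ) : Set ℕ)}) →
      StandardWithDescents ν (R.ndes ∪ d S R : Finset ℕ) := fun x =>
    ⟨x.2.1, x.2.2.1, fun a ha _ => by
      rw [x.2.2.2]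
      refine Finset.union_subset_union_right ?_ ha
      exact Finset.image_subset_image (hFmem x.1).2⟩
  have hbij : Function.Bijective e := by
    constructor
    · rintro ⟨⟨J, hJ⟩, T, hT⟩ ⟨⟨J', hJ'⟩, T', hT'⟩ h
      have hTT : T = T' := congrArg Subtype.val h
      subst hTT
      have h1 := hR.ndes_union_d_injective (hFmem ⟨J, hJ⟩).1 (hFmem ⟨J', hJ'⟩).1
        (Finset.coe_injective (hT.2.symm.trans hT'.2))
      change J = J' at h1
      subst h1
      rfl
    · rintro ⟨T, hs, hT⟩
      have hle : ∀ a ∈ R.ndes ∪ d S R, a ∈ tableauDes T := fun a ha => hT a ha (by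
        have := Finset.mem_Icc.1 (hR.ndes_union_d_subset hS ha)
        omega)
      obtain ⟨J, hJ, hJ'⟩ := hR.exists_eq_ndes_union_d
        ((tableauDes_subset hs).trans_eq (by rw [hν]))
        (fun a ha => hle a (Finset.mem_union_left _ ha))
      have hSJ : S ⊆ J := fun i hi => by
        have := hle (R.prefixSize i)
          (Finset.mem_union_right _ (Finset.mem_image_of_mem R.prefixSize hi))
        rw [hJ'] at this
        exact (hR.prefixSize_mem_iff hJ (hS hi)).1 this
      exact ⟨⟨⟨J, by simp [hF, hJ, hSJ]⟩, ⟨T, hs, hJ'⟩⟩, rfl⟩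
  have := fun J : Finset ℕ => finite_standard ν fun T =>
    tableauDes T = ((R.ndes ∪ d J R : Finset ℕ) : Set ℕ)
  rw [← Nat.card_congr (Equiv.ofBijective e hbij), Nat.card_sigma]
  exact Finset.sum_coe_sort F fun J => sytCount ν (R.ndes ∪ d J R)

/-- The generating function of the standard tableaux with descent set `NDes(R) ∪ d(J, R)`. -/
noncomputable def ribbonSeries (R : SkewShape) (J : Finset ℕ) : MvPowerSeries ℕ ℂ :=
  ∑ ν : PartitionOf R.size, sytCount ν.1 (R.ndes ∪ SkewShape.d J R) • schur ν.1

theorem descentSeries_ribbon {R : SkewShape} (hR : R.IsRibbon) {S : Finset ℕ}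
    (hS : S ⊆ R.innerRows) :
    descentSeries (R.ndes ∪ SkewShape.d S R : Finset ℕ) R.size =
      ∑ J ∈ R.innerRows.powerset with S ⊆ J, ribbonSeries R J := by
  simp only [descentSeries, ribbonSeries, card_standardWithDescents_ribbon hR hS, Finset.sum_smul]
  rw [Finset.sum_comm]

/-! ### The Jacobi--Trudi matrix of a ribbon -/

section JacobiTrudi
open SkewShape
variable {R : SkewShape} {n : ℕ}

theorem elemSymm_of_neg {d : ℤ} (h : d < 0) : elemSymm d = 0 := by
  ext δ
  rw [coeff_elemSymm, if_neg fun h' => by omega, map_zero]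

theorem elemSymm_zero : elemSymm 0 = 1 := by
  classical
  ext δ
  rw [coeff_elemSymm, MvPowerSeries.coeff_one]
  refine if_congr ⟨fun h => ?_, fun h => ?_⟩ rfl rfl
  · exact (Finsupp.degree_eq_zero_iff δ).1 (by exact_mod_cast h.1)
  · subst h; simp

theorem jacobiTrudi_apply (p q : Fin n) : jacobiTrudi n R p q = elemSymm
    ((R.outer.rowLen p : ℤ) - (R.inner.rowLen q : ℤ) - ((p : ℕ) : ℤ) + ((q : ℕ) : ℤ)) := rfl

/-- Two or more rows below the diagonal, λ_p ≤ λ_(q+1) ≤ μ_q + 1 makes the index of the elementary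
symmetric function negative. -/
theorem jacobiTrudi_hessenberg (hR : R.IsRibbon) (p q : Fin n) (h : (q : ℕ) + 1 < p) :
    jacobiTrudi n R p q = 0 := by
  have h1 := R.outer.rowLen_anti (q + 1) p h.le
  have h2 : R.outer.rowLen (q + 1) ≤ R.inner.rowLen q + 1 := by
    by_cases hq : (q : ℕ) + 1 ∈ R.innerRows
    · exact (hR.outer_succ_eq hq).le
    · exact (outer_succ_le_inner hq).trans (Nat.le_succ _)
  exact elemSymm_of_neg (by omega)

/-- The index λ_(q+1) − μ_q − 1 is 0 if the two rows overlap and negative otherwise. The zero-based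
row number `p` is also the one-based name of the cut above this row. -/
theorem jacobiTrudi_subdiagonal (hR : R.IsRibbon) (p q : Fin n) (h : (q : ℕ) + 1 = p) :
    jacobiTrudi n R p q = if (p : ℕ) ∈ R.innerRows then 1 else 0 := by
  rw [jacobiTrudi_apply, ← h]
  split_ifs with hq
  · rw [hR.outer_succ_eq hq, ← elemSymm_zero]
    congr 1
    push_cast; ring
  · have := outer_succ_le_inner hq
    exact elemSymm_of_neg (by push_cast; omega)

/-- The row sizes of a block telescope, because λ_(i+1) = μ_i + 1 at each inner cut. -/
theorem IsRibbon_outer_sub_inner (hR : R.IsRibbon) (p k : ℕ)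
    (h : ∀ i, p < i → i ≤ p + k → i ∈ R.innerRows) :
    (R.outer.rowLen p : ℤ) - R.inner.rowLen (p + k) + k =
      R.prefixSize (p + k + 1) - R.prefixSize p := by
  induction k with
  | zero =>
    have := R.inner_rowLen_le p
    rw [add_zero, prefixSize_succ, rowSize]
    push_cast [this]
    ring
  | succ k ih =>
    have h1 := ih fun i hi hi' => h i hi (by omega)
    have h2 := hR.outer_succ_eq (h (p + k + 1) (by omega) (by omega))
    have h3 := R.inner_rowLen_le (p + k + 1)
    rw [← add_assoc, prefixSize_succ (p + k + 1), rowSize, h2]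
    rw [h2] at h3
    push_cast [h3] at h1 ⊢
    linarith

theorem jacobiTrudi_block (hR : R.IsRibbon) (p q : Fin n) (hpq : (p : ℕ) ≤ q)
    (h : ∀ i, (p : ℕ) < i → i ≤ q → i ∈ R.innerRows) :
    jacobiTrudi n R p q = elemSymm ((R.prefixSize (q + 1) - R.prefixSize p : ℕ) : ℤ) := by
  rw [jacobiTrudi_apply]
  congr 1
  obtain ⟨k, hk⟩ := Nat.exists_eq_add_of_le hpq
  have h1 := IsRibbon_outer_sub_inner hR p k fun i hi hi' => h i hi (by omega)
  have h2 : R.prefixSize p ≤ R.prefixSize (q + 1) := prefixSize_mono (by omega)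
  rw [← hk] at h1
  push_cast [h2]
  rw [← h1]
  omega

theorem mem_oneBased {S : Finset (Fin (n - 1))} {i : ℕ} :
    i ∈ oneBased S ↔ ∃ j ∈ S, (j : ℕ) + 1 = i := by
  rw [oneBased, Finset.mem_image]

/-- The products that occur in the Temperley--Lieb immanants of the Jacobi--Trudi matrix. -/
theorem prod_jacobiTrudi_ascendingPerm (hR : R.IsRibbon) (hn : R.length ≤ n)
    (S : Finset (Fin (n - 1))) :
    ∏ i, jacobiTrudi n R i (ascendingPerm S i) =
      ∑ J ∈ R.innerRows.powerset with oneBased S ⊆ J, ribbonSeries R J := by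
  by_cases hS : oneBased S ⊆ R.innerRows
  · rw [← descentSeries_ribbon hR hS]
    set B : Set ℕ := ((R.ndes ∪ d (oneBased S) R : Finset ℕ) : Set ℕ) with hB
    set F : ℕ → MvPowerSeries ℕ ℂ := fun i =>
      if h : i < n then jacobiTrudi n R ⟨i, h⟩ (ascendingPerm S ⟨i, h⟩) else 1 with hF
    -- At the ends of the blocks no descent is required: an inner cut outside `S` has a prefix size
    -- different from those of `S`, and any other cut has prefix size 0 or m.
    have hnot : ∀ p, p ∉ oneBased S → R.prefixSize p ∉ B := by
      intro p hp hmem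
      have hmem' := Finset.mem_Icc.1 (hR.ndes_union_d_subset hS hmem)
      by_cases hp' : p ∈ R.innerRows
      · exact hp ((hR.prefixSize_mem_iff hS hp').1 hmem)
      · rcases prefixSize_of_notMem_innerRows hp' with h | h <;> omega
    -- Induction over the block ends. Both 0 and n are block ends, as `oneBased S` lies in [1, n−1].
    have main : ∀ t, t ≤ n → t ∉ oneBased S →
        ∏ i ∈ Finset.range t, F i = descentSeries B (R.prefixSize t) := by
      intro t
      induction t using Nat.strong_induction_on with
      | _ t ih =>
      intro ht hbd
      rcases Nat.eq_zero_or_pos t with rfl | hpos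
      · rw [Finset.range_zero, Finset.prod_empty, prefixSize_eq_zero (fun a ha => absurd ha
          (Nat.not_lt_zero a)), descentSeries_zero]
      have h0 : 0 ∉ oneBased S := by rw [mem_oneBased]; rintro ⟨j, -, hj⟩; omega
      -- The last block before `t` starts at the greatest cut `p` below `t` outside `S`. The
      -- permutation sends `p` to `t - 1` and drops every other row of the block by one.
      set p := Nat.findGreatest (fun p => p ∉ oneBased S) (t - 1) with hp
      have hp1 : p ∉ oneBased S := Nat.findGreatest_spec (P := fun p => p ∉ oneBased S)
        (Nat.zero_le (t - 1)) h0
      have hp2 : p ≤ t - 1 := Nat.findGreatest_le _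
      have hp3 : ∀ i, p < i → i < t → i ∈ oneBased S := fun i hi hi' => by
        by_contra hc
        exact Nat.findGreatest_is_greatest hi (by omega) hc
      have hw : ascendingPerm S ⟨p, by omega⟩ = ⟨t - 1, by omega⟩ := by
        refine ascendingPerm_apply_start S _ _ hp2 ?_ ?_ ?_
        · intro j hj e
          rw [hi, Fin.mk.injEq] at e
          exact hp1 (mem_oneBased.2 ⟨j, hj, e⟩)
        · intro j hj e
          rw [lo, Fin.mk.injEq] at e
          exact hbd (mem_oneBased.2 ⟨j, hj, by omega⟩)
        · intro j h1 h2
          rw [lo, Fin.mk_le_mk] at h1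
          rw [hi, Fin.mk_le_mk] at h2
          obtain ⟨j', hj', e⟩ := mem_oneBased.1 (hp3 (j + 1) (by omega) (by omega))
          have : j' = j := Fin.ext (by omega)
          rwa [← this]
      have hFp : F p = elemSymm ((R.prefixSize t - R.prefixSize p : ℕ) : ℤ) := by
        rw [hF]
        simp only
        rw [dif_pos (by omega), hw, jacobiTrudi_block hR _ _ hp2]
        · simp only
          rw [Nat.sub_add_cancel hpos]
        · intro i h1 h2
          simp only at h1 h2
          exact hS (hp3 i h1 (by omega))
      -- The other rows of the block contribute subdiagonal entries, all equal to e_0.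
      have hone : ∏ i ∈ Finset.Ico (p + 1) t, F i = 1 := by
        refine Finset.prod_eq_one fun i hi' => ?_
        rw [Finset.mem_Ico] at hi'
        have hi1 := hp3 i (by omega) hi'.2
        obtain ⟨j, hj, e⟩ := mem_oneBased.1 hi1
        have e' : (⟨i, by omega⟩ : Fin n) = hi j := by rw [hi, Fin.mk.injEq]; exact e.symm
        rw [hF]
        simp only
        rw [dif_pos (by omega), e', (ascendingPerm_apply_hi S j).2 hj,
          jacobiTrudi_subdiagonal hR _ _ rfl, if_pos]
        exact hS (mem_oneBased.2 ⟨j, hj, rfl⟩)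
      have hsum : R.prefixSize t = R.prefixSize p + (R.prefixSize t - R.prefixSize p) := by
        have : R.prefixSize p ≤ R.prefixSize t := prefixSize_mono (by omega)
        omega
      rw [← Finset.prod_range_mul_prod_Ico F (show p ≤ t by omega),
        Finset.prod_eq_prod_Ico_succ_bot (by omega), hone, mul_one, hFp,
        ih p (by omega) (by omega) hp1, mul_comm, ← descentSeries_add B _ _ (hnot p hp1), ← hsum]
      rw [← hsum]
      -- A number strictly between the prefix sizes of two consecutive block ends is either a
      -- non-descent of the ribbon or the prefix size of a cut strictly inside the block, which
      -- belongs to `S`.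
      intro x h1 h2
      have hx : x ∈ Finset.Icc 1 (R.size - 1) := by
        have := prefixSize_le_size (R := R) t
        rw [Finset.mem_Icc]; omega
      rw [hB, Finset.coe_union, Set.mem_union]
      by_cases hx' : ∃ i ∈ R.innerRows, R.prefixSize i = x
      · obtain ⟨i, -, rfl⟩ := hx'
        refine .inr (Finset.mem_image_of_mem R.prefixSize (hp3 i ?_ ?_))
        · by_contra hc
          exact absurd (prefixSize_mono (R := R) (not_lt.1 hc)) (not_le.2 h1)
        · by_contra hc
          exact absurd (prefixSize_mono (R := R) (not_lt.1 hc)) (not_le.2 h2)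
      · push Not at hx'
        exact .inl (hR.mem_ndes_iff.2 ⟨hx, hx'⟩)
    have hlast := main n le_rfl (by
      rw [mem_oneBased]
      rintro ⟨j, -, hj⟩
      omega)
    rw [prefixSize_of_length_le hn, Finset.prod_range] at hlast
    rw [← hlast]
    exact Finset.prod_congr rfl fun i _ => by simp [hF]
  -- An element of `S` that is not an inner cut contributes a zero subdiagonal entry, and on the
  -- other side no `J` contains `S`.
  · obtain ⟨x, hx, hx'⟩ := Finset.not_subset.1 hS
    obtain ⟨j, hj, rfl⟩ := mem_oneBased.1 hx
    rw [Finset.prod_eq_zero (Finset.mem_univ (hi j)), Finset.filter_eq_empty_iff.2, Finset.sum_empty]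
    · intro J hJ h
      exact hx' (Finset.mem_powerset.1 hJ (h hx))
    · rw [(ascendingPerm_apply_hi S j).2 hj, jacobiTrudi_subdiagonal hR _ _ rfl, if_neg]
      exact hx'

end JacobiTrudi

/-! ### Immanants of Hadamard products -/

section Hadamard
variable {k n : ℕ}

/-- `inVars` as an algebra homomorphism. -/
noncomputable def inVarsHom (i : Fin k) : MvPowerSeries ℕ ℂ →ₐ[ℂ] MultiSeries k :=
  MvPowerSeries.rename (Function.Embedding.sectR i ℕ)

theorem inVarsHom_apply (i : Fin k) (f : MvPowerSeries ℕ ℂ) : inVarsHom i f = inVars i f := rfl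

/-- Inclusion–exclusion: the sets between `I` and `K` correspond to the subsets of K ∖ I, whose
signs cancel unless K ∖ I is empty. -/
theorem alternating_sum_Icc {α A : Type*} [Fintype α] [DecidableEq α] [CommRing A]
    (I K : Finset α) :
    ∑ S : Finset α, (if I ⊆ S ∧ S ⊆ K then (-1 : A) ^ (S \ I).card else 0) =
      if I = K then 1 else 0 := by
  rw [← Finset.sum_filter]
  by_cases hIK : I ⊆ K
  · have h1 : ∑ S ∈ Finset.univ.filter (fun S => I ⊆ S ∧ S ⊆ K), (-1 : A) ^ (S \ I).card =
        ∑ T ∈ (K \ I).powerset, (-1 : A) ^ T.card := by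
      refine Finset.sum_nbij' (fun S => S \ I) (fun T => T ∪ I) ?_ ?_ ?_ ?_ (fun _ _ => rfl)
      · intro S hS
        rw [Finset.mem_filter] at hS
        exact Finset.mem_powerset.2 (Finset.sdiff_subset_sdiff hS.2.2 le_rfl)
      · intro T hT
        rw [Finset.mem_powerset] at hT
        exact Finset.mem_filter.2 ⟨Finset.mem_univ _, Finset.subset_union_right,
          Finset.union_subset (hT.trans Finset.sdiff_subset) hIK⟩
      · intro S hS
        rw [Finset.mem_filter] at hS
        exact Finset.sdiff_union_of_subset hS.2.1
      · intro T hT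
        rw [Finset.mem_powerset] at hT
        exact (Finset.union_sdiff_right _ _).trans
          (Finset.sdiff_eq_self_of_disjoint (Finset.disjoint_of_subset_left hT Finset.sdiff_disjoint))
    have h2 := congrArg (Int.cast : ℤ → A) (Finset.sum_powerset_neg_one_pow_card (x := K \ I))
    push_cast at h2
    rw [h1, h2]
    refine if_congr ?_ rfl rfl
    rw [Finset.sdiff_eq_empty_iff_subset]
    exact ⟨fun h => hIK.antisymm h, fun h => h.symm.subset⟩
  · rw [if_neg fun h => hIK h.subset, Finset.filter_eq_empty_iff.2, Finset.sum_empty]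
    rintro S - ⟨h1, h2⟩
    exact hIK (h1.trans h2)

theorem mem_tuplesWithInter {S : Fin k → Finset ℕ} {T : Finset ℕ} {J : Fin k → Finset ℕ} :
    J ∈ tuplesWithInter S T ↔ (∀ i, J i ⊆ S i) ∧ ∀ x, (∀ i, x ∈ J i) ↔ x ∈ T := by
  rw [tuplesWithInter, Finset.mem_filter, Fintype.mem_piFinset, Set.ext_iff]
  simp only [Finset.mem_powerset, Set.mem_iInter, Finset.mem_coe]

/-- After exchanging the sums, a fixed tuple has the coefficient Σ (−1)^|S∖I| over the `S` between
`I` and the common elements of the J_i, so only tuples with intersection `I` survive. -/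
theorem tlImmanant_hadamardProd (hk : 1 ≤ k) (I : Finset (Fin (n - 1))) (R : Fin k → SkewShape)
    (hR : ∀ i, (R i).IsRibbon) (hn : ∀ i, (R i).length ≤ n) :
    tlImmanant (tau I) (hadamardProd fun i => (jacobiTrudi n (R i)).map (inVars i)) =
      ∑ J ∈ tuplesWithInter (fun i => (R i).innerRows) (oneBased I),
        ∏ i, inVars i (ribbonSeries (R i) (J i)) := by
  classical
  set M : Matrix (Fin n) (Fin n) (MultiSeries k) :=
    hadamardProd fun i => (jacobiTrudi n (R i)).map (inVars i) with hM
  have hMapp : ∀ p q, M p q = ∏ i, inVars i (jacobiTrudi n (R i) p q) := fun _ _ => rfl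
  have hprod : ∀ S, ∏ p, M p (ascendingPerm S p) =
      ∑ J ∈ Fintype.piFinset fun i => (R i).innerRows.powerset, if ∀ i, oneBased S ⊆ J i then
        ∏ i, inVars i (ribbonSeries (R i) (J i)) else 0 := by
    intro S
    simp only [hMapp]
    rw [Finset.prod_comm]
    have h1 : ∀ i, ∏ p, inVars i (jacobiTrudi n (R i) p (ascendingPerm S p)) =
        ∑ J ∈ (R i).innerRows.powerset with oneBased S ⊆ J, inVars i (ribbonSeries (R i) J) := by
      intro i
      simp only [← inVarsHom_apply]
      rw [← map_prod, prod_jacobiTrudi_ascendingPerm (hR i) (hn i), map_sum]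
    rw [Finset.prod_congr rfl fun i _ => h1 i, Finset.prod_univ_sum, ← Finset.sum_filter]
    refine Finset.sum_congr ?_ fun _ _ => rfl
    ext J
    simp only [Fintype.mem_piFinset, Finset.mem_filter, forall_and]
  rw [tlImmanant_hessenberg I M fun p q h => by
    rw [hMapp]
    -- An empty Hadamard product would be the all-ones matrix, which is not Hessenberg in general;
    -- `hk` supplies a vanishing factor.
    refine Finset.prod_eq_zero (Finset.mem_univ ⟨0, hk⟩) ?_
    rw [jacobiTrudi_hessenberg (hR _) p q h, ← inVarsHom_apply, map_zero]]
  have hswap : ∀ S : Finset (Fin (n - 1)),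
      (if I ⊆ S then (-1) ^ (S \ I).card * ∏ p, M p (ascendingPerm S p) else 0) =
      ∑ J ∈ Fintype.piFinset fun i => (R i).innerRows.powerset,
        (∏ i, inVars i (ribbonSeries (R i) (J i))) *
          if I ⊆ S ∧ S ⊆ Finset.univ.filter (fun j : Fin (n - 1) => ∀ i, (j : ℕ) + 1 ∈ J i)
          then (-1) ^ (S \ I).card else 0 := by
    intro S
    split_ifs with hI
    · rw [hprod, Finset.mul_sum]
      refine Finset.sum_congr rfl fun J _ => ?_
      rw [mul_ite, mul_zero, mul_ite, mul_zero, mul_comm]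
      refine if_congr ?_ rfl rfl
      simp only [hI, true_and, Finset.subset_iff, Finset.mem_filter, Finset.mem_univ, mem_oneBased]
      constructor
      · intro h j hj i
        exact h i ⟨j, hj, rfl⟩
      · rintro h i x ⟨j, hj, rfl⟩
        exact h hj i
    · exact (Finset.sum_eq_zero fun J _ => by rw [if_neg fun h => hI h.1, mul_zero]).symm
  rw [Finset.sum_congr rfl fun S _ => hswap S, Finset.sum_comm]
  simp only [← Finset.mul_sum, alternating_sum_Icc]
  simp only [mul_ite, mul_one, mul_zero]
  rw [← Finset.sum_filter]
  refine Finset.sum_congr ?_ fun _ _ => rfl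
  ext J
  rw [Finset.mem_filter, Fintype.mem_piFinset, mem_tuplesWithInter]
  simp only [Finset.mem_powerset]
  refine and_congr_right fun hJ => ?_
  simp only [Finset.ext_iff, Finset.mem_filter, Finset.mem_univ, true_and, mem_oneBased]
  constructor
  · intro h x
    constructor
    · intro hx
      -- A common element is an inner cut of a ribbon with at most `n` rows, so it lies in [1, n−1]
      -- and is the one-based form of x − 1.
      have h1 := hJ ⟨0, hk⟩ (hx _)
      have h2 := SkewShape.pos_of_mem_innerRows h1
      have h3 := (SkewShape.lt_length_of_mem_innerRows h1).trans_le (hn _)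
      exact ⟨⟨x - 1, by omega⟩, (h _).2 fun i => by
        rw [Nat.sub_add_cancel h2]; exact hx i, Nat.sub_add_cancel h2⟩
    · rintro ⟨j, hj, rfl⟩
      exact (h j).1 hj
  · intro h j
    rw [h]
    constructor
    · exact fun hj => ⟨j, hj, rfl⟩
    · rintro ⟨j', hj', e⟩
      rwa [← show j' = j from Fin.ext (by omega)]

/-- Multiplying out the product over the alphabets. The function `C` turns an index set into a
descent set; it is J ↦ NDes ∪ d(J) for (1) and the identity for (2). -/
theorem sum_partitions_eq {m : Fin k → ℕ} (𝒯 : Finset (Fin k → Finset ℕ))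
    (C : Fin k → Finset ℕ → Finset ℕ) :
    ∑ ν : (i : Fin k) → PartitionOf (m i),
      ((∑ J ∈ 𝒯, ∏ i, sytCount (ν i).1 (C i (J i)) : ℕ) : MultiSeries k) *
        ∏ i, inVars i (schur (ν i).1) =
      ∑ J ∈ 𝒯, ∏ i, inVars i
        (∑ ν : PartitionOf (m i), sytCount ν.1 (C i (J i)) • schur ν.1) := by
  have h1 : ∀ J : Fin k → Finset ℕ, ∏ i, inVars i
      (∑ ν : PartitionOf (m i), sytCount ν.1 (C i (J i)) • schur ν.1) =
      ∑ ν : (i : Fin k) → PartitionOf (m i),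
        (∏ i, (sytCount (ν i).1 (C i (J i)) : MultiSeries k)) * ∏ i, inVars i (schur (ν i).1) := by
    intro J
    simp only [← inVarsHom_apply, map_sum, nsmul_eq_mul, map_mul, map_natCast]
    rw [Finset.prod_univ_sum, Fintype.piFinset_univ]
    exact Finset.sum_congr rfl fun ν _ => Finset.prod_mul_distrib
  simp only [h1]
  rw [Finset.sum_comm]
  refine Finset.sum_congr rfl fun ν _ => ?_
  rw [Nat.cast_sum, Finset.sum_mul]
  simp only [Nat.cast_prod]

open SkewShape in
-- If the intersection of the sets B_i contains NDes(R), so does each B_i. Each is then NDes(R) ∪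
-- d(J_i, R) for a unique J_i, and membership can be compared one prefix size at a time.
theorem sum_tuples_ribbon (hk : 1 ≤ k) {A : Type*} [AddCommMonoid A] {R : SkewShape}
    (hR : R.IsRibbon) (T : Finset ℕ) (F : (Fin k → Finset ℕ) → A) :
    ∑ J ∈ tuplesWithInter (fun _ : Fin k => R.innerRows) T, F (fun i => R.ndes ∪ d (J i) R) =
      ∑ B ∈ tuplesWithInter (fun _ : Fin k => Finset.Icc 1 (R.size - 1)) (R.ndes ∪ d T R), F B := by
  refine Finset.sum_bij (fun J _ i => R.ndes ∪ d (J i) R) ?_ ?_ ?_ (fun _ _ => rfl)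
  · intro J hJ
    obtain ⟨h1, h2⟩ := mem_tuplesWithInter.1 hJ
    have hT : T ⊆ R.innerRows := fun x hx => h1 ⟨0, hk⟩ ((h2 x).2 hx _)
    refine mem_tuplesWithInter.2 ⟨fun i => hR.ndes_union_d_subset (h1 i), fun x => ?_⟩
    by_cases hx : ∃ j ∈ R.innerRows, R.prefixSize j = x
    · obtain ⟨j, hj, rfl⟩ := hx
      simp only [hR.prefixSize_mem_iff (h1 _) hj, hR.prefixSize_mem_iff hT hj, h2]
    · have hd : ∀ J ⊆ R.innerRows, x ∈ R.ndes ∪ d J R ↔ x ∈ R.ndes := fun J hJ => by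
        rw [Finset.mem_union, d_eq, Finset.mem_image]
        exact ⟨fun h => h.resolve_right fun ⟨j, hj, e⟩ => hx ⟨j, hJ hj, e⟩, .inl⟩
      simp only [hd _ (h1 _), hd _ hT]
      exact ⟨fun h => h ⟨0, hk⟩, fun h _ => h⟩
  · intro J hJ J' hJ' h
    funext i
    exact hR.ndes_union_d_injective ((mem_tuplesWithInter.1 hJ).1 i) ((mem_tuplesWithInter.1 hJ').1 i)
      (congrFun h i)
  · intro B hB
    obtain ⟨h1, h2⟩ := mem_tuplesWithInter.1 hB
    -- A cut outside `innerRows` has prefix size 0 or m, which no subset of [1, m−1] contains. For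
    -- such `T` both sums are empty.
    have hT : T ⊆ R.innerRows := fun x hx => by
      have h3 := (h2 _).2 (Finset.mem_union_right R.ndes
        (Finset.mem_image_of_mem R.prefixSize hx)) ⟨0, hk⟩
      have h4 := Finset.mem_Icc.1 (h1 _ h3)
      by_contra hc
      rcases prefixSize_of_notMem_innerRows hc with h | h <;> omega
    have h3 : ∀ i, ∃ J ⊆ R.innerRows, B i = R.ndes ∪ d J R := fun i => by
      obtain ⟨J, hJ, e⟩ := hR.exists_eq_ndes_union_d (A := (B i : Set ℕ))
        (Finset.coe_subset.2 (h1 i))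
        (fun x hx => (h2 x).2 (Finset.mem_union_left _ hx) i)
      exact ⟨J, hJ, Finset.coe_injective e⟩
    choose J hJ hJB using h3
    refine ⟨J, mem_tuplesWithInter.2 ⟨hJ, fun x => ?_⟩, funext fun i => (hJB i).symm⟩
    constructor
    · intro hx
      have hx' := hJ ⟨0, hk⟩ (hx _)
      rw [← hR.prefixSize_mem_iff hT hx', ← h2]
      intro i
      rw [hJB, hR.prefixSize_mem_iff (hJ i) hx']
      exact hx i
    · intro hx i
      rw [← hR.prefixSize_mem_iff (hJ i) (hT hx), ← hJB]
      exact (h2 _).2 ((hR.prefixSize_mem_iff hT (hT hx)).2 hx) i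

end Hadamard
end RibbonImmanant

/-! ### The two expansions -/

theorem mainTheorem4 (k n : ℕ) (hk : 1 ≤ k) (I : Finset (Fin (n - 1))) :
    (∀ R : Fin k → SkewShape, (∀ i, (R i).IsRibbon) → (∀ i, (R i).length ≤ n) →
      tlImmanant (tau I) (hadamardProd fun i => (jacobiTrudi n (R i)).map (inVars i)) =
        ∑ ν : (i : Fin k) → PartitionOf (R i).size,
          ((∑ J ∈ tuplesWithInter (fun i => (R i).innerRows) (oneBased I),
              ∏ i, sytCount (ν i).1 ((R i).ndes ∪ SkewShape.d (J i) (R i)) : ℕ) : MultiSeries k) *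
            ∏ i, inVars i (schur (ν i).1)) ∧
    (∀ R : SkewShape, R.IsRibbon → R.length ≤ n →
      tlImmanant (tau I) (hadamardProd fun i : Fin k => (jacobiTrudi n R).map (inVars i)) =
        ∑ ν : Fin k → PartitionOf R.size,
          ((∑ A ∈ tuplesWithInter (fun _ : Fin k => Finset.Icc 1 (R.size - 1))
                (R.ndes ∪ SkewShape.d (oneBased I) R),
              ∏ i, sytCount (ν i).1 (A i) : ℕ) : MultiSeries k) *
            ∏ i, inVars i (schur (ν i).1)) := by
  refine ⟨fun R hR hn => ?_, fun R hR hn => ?_⟩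
  · rw [tlImmanant_hadamardProd hk I R hR hn]
    exact (sum_partitions_eq _ fun i J => (R i).ndes ∪ SkewShape.d J (R i)).symm
  · rw [tlImmanant_hadamardProd hk I (fun _ => R) (fun _ => hR) (fun _ => hn)]
    refine Eq.trans ?_ (sum_partitions_eq _ fun _ A => A).symm
    exact sum_tuples_ribbon hk hR (oneBased I) fun B =>
      ∏ i, inVars i (∑ ν : PartitionOf R.size, sytCount ν.1 (B i) • schur ν.1)
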